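/- Conventions. An open set $\Omega\subset\mathbb R^d$ has $C^{1,1}$ boundary if near each $x_0\in\partial\Omega$, for some unit vector $e$ (a choice of coordinates), $\Omega$ is the region lying below the graph, in direction $e$, of a $C^1$ function with Lipschitz gradient over the hyperplane $e^\perp$. A function $h$ is *Neumann harmonic* in $\Omega$ if $h\in C(\overline\Omega)$, $\Delta h=0$ in $\Omega$, and $\partial_\nu h=0$ on $\partial\Omega$ in the weak sense: $\int_{\Omega\cap B(0,R)}|\nabla h|^2<\infty$ for all $R>0$ and $\int_\Omega\nabla h\cdot\nabla\psi=0$ for all $\psi\in C_c^\infty(\mathbb R^d)$. Solutions of $\operatorname{div}(B\nabla v)=0$ are weak solutions in $W^{1,2}_{loc}$. **Lemma 2.1 (Boundary covering with balls).** Let $n\ge 0$. There is a rule $\mathcal B$ that assigns a field of real $(n+1)\times(n+1)$ matrices to each triple $(x_0,r,U)$ with $x_0\in\mathbb R^{n+1}$, $r\in\mathbb R$, $U\subset\mathbb R^{n+1}$, with the following property. Let $\Omega\subset\mathbb R^{n+1}$ be either (a) a bounded open set with $C^{1,1}$ boundary, or (b) a cylinder $\Omega=\Omega_0\times\mathbb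 R$, where $\Omega_0\subset\mathbb R^n$ is a bounded open set with $C^{1,1}$ boundary. Then there are $r_0>0$ and constants $0<\lambda$, $\Lambda$, $L$, $K$, depending on $\Omega$, such that: 1. (Covering.) In case (a), $\partial\Omega$ is covered by finitely many balls $B(x_\beta,r_0)$ with $x_\beta\in\partial\Omega$. In case (b), for every $T$, the part $\partial\Omega\cap\{|x_{n+1}|\le T\}$ of the boundary is covered by finitely many balls $B(x_\beta,r_0)$ with $x_\beta\in\partial\Omega$. 2. (Reflection.) For every $x_0\in\partial\Omega$ and every $0<r\le r_0$ (in particular for each ball $B(x_\beta,r_0)$ of the covering), the matrix field $B=\mathcal B(x_0,r,\Omega\cap B(x_0,r))$ is symmetric on $B(x_0,r)$, satisfies $\lambda|\xi|^2\le \xi\cdot B(x)\xi\le\Lambda|\xi|^2$ for all $x\in B(x_0,r)$ and $\xi\in\mathbb R^{n+1}$, has entries that are Lipschitz on $B(x_0,r)$ with constant $L$, and equals $I$ on $\Omega\cap B(x_0,r)$. Moreover there is a map $\Phi$ on $B(x_0,r)$, Lipschitz with constant $K$, that is the identity on $\overline\Omega\cap B(x_0,r)$, maps $B(x_0,r)\setminus\overline\Omega$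 into $\Omega$, and satisfies $|x-y|\le K|\Phi(x)-\Phi(y)|$ for $x,y\in B(x_0,r)\setminus\Omega$, such that for every Neumann harmonic function $h$ in $\Omega$ the reflection $\widetilde h=h\circ\Phi$ belongs to $W^{1,2}_{loc}(B(x_0,r))$ and is a weak solution of $\operatorname{div}(B\nabla\widetilde h)=0$ in $B(x_0,r)$. In particular $B$ does not depend on $h$, and it depends on $\Omega$ only through $\Omega\cap B(x_0,r)$, that is, through $\partial\Omega\cap B(x_0,r)$ and the side of it on which $\Omega$ lies. -/

import Mathlib

open Set Metric MeasureTheory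
open scoped NNReal ContDiff Matrix Gradient

noncomputable section

/-- Euclidean space of dimension `d`. -/
abbrev Euc (d : ℕ) : Type := EuclideanSpace ℝ (Fin d)

/-- Fields of real `d × d` matrices on Euclidean space. -/
abbrev MatField (d : ℕ) : Type := Euc d → Matrix (Fin d) (Fin d) ℝ

/-- `Ω` is an open set with `C^{1,1}` boundary: near each boundary point `x₀` there are a unit
vector `e` and a `C^{1,1}` function `φ` such that `Ω` is the region lying below the graph of `φ`
over the hyperplane orthogonal to `e`. Only the values of `φ` on that hyperplane matter, since it is
evaluated at the orthogonal projection of `x - x₀` to it. -/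
structure IsC11Domain {d : ℕ} (Ω : Set (Euc d)) : Prop where
  isOpen : IsOpen Ω
  graph : ∀ x₀ ∈ frontier Ω, ∃ (e : Euc d) (φ : Euc d → ℝ) (ρ : ℝ) (M : ℝ≥0),
    ‖e‖ = 1 ∧ 0 < ρ ∧ ContDiff ℝ 1 φ ∧ LipschitzWith M (fderiv ℝ φ) ∧
    ∀ x ∈ ball x₀ ρ,
      (x ∈ Ω ↔ inner ℝ (x - x₀) e < φ ((x - x₀) - (inner ℝ (x - x₀) e) • e))

/-- The cylinder `Ω₀ × ℝ` in `ℝ^{n+1}`; the last coordinate is the one in `ℝ`. -/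
def solidCylinder {n : ℕ} (Ω₀ : Set (Euc n)) : Set (Euc (n + 1)) :=
  {x | WithLp.toLp 2 (fun i : Fin n => x i.castSucc) ∈ Ω₀}

/-- `Δ h = 0` in `Ω` and `∂_ν h = 0` on `∂Ω`. The function is harmonic in `Ω`, continuous up to the
boundary, has finite energy on bounded parts of `Ω`, and the boundary condition holds in the usual
weak sense: the test functions need not vanish on `∂Ω`. -/
structure IsNeumannHarmonic {d : ℕ} (Ω : Set (Euc d)) (h : Euc d → ℝ) : Prop where
  harmonic : InnerProductSpace.HarmonicOnNhd h Ω
  continuousOn : ContinuousOn h (closure Ω)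
  energy : ∀ R : ℝ, IntegrableOn (fun x => ‖∇ h x‖ ^ 2) (Ω ∩ ball 0 R) volume
  neumann : ∀ ψ : Euc d → ℝ, ContDiff ℝ ∞ ψ → HasCompactSupport ψ →
    ∫ x in Ω, inner ℝ (∇ h x) (∇ ψ x) = 0

/-- `g` is the weak gradient in `U` of `v`, and both are in `L²_loc(U)`; so `v ∈ W^{1,2}_loc(U)`. -/
structure IsWeakGradient {d : ℕ} (U : Set (Euc d)) (v : Euc d → ℝ) (g : Euc d → Euc d) : Prop where
  memLp : ∀ K ⊆ U, IsCompact K → MemLp v 2 (volume.restrict K)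
  memLp_grad : ∀ K ⊆ U, IsCompact K → MemLp g 2 (volume.restrict K)
  parts : ∀ ψ : Euc d → ℝ, ContDiff ℝ ∞ ψ → HasCompactSupport ψ → tsupport ψ ⊆ U →
    ∀ i : Fin d, ∫ x, v x * (∇ ψ x) i = - ∫ x, (g x) i * ψ x

/-- `v ∈ W^{1,2}_loc(U)` is a weak solution of `div (A ∇v) = 0` in `U`. -/
def IsWeakSolution {d : ℕ} (A : MatField d) (U : Set (Euc d)) (v : Euc d → ℝ) : Prop :=
  ∃ g : Euc d → Euc d, IsWeakGradient U v g ∧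
    ∀ ψ : Euc d → ℝ, ContDiff ℝ ∞ ψ → HasCompactSupport ψ → tsupport ψ ⊆ U →
      ∫ x, (∇ ψ x).ofLp ⬝ᵥ (A x *ᵥ (g x).ofLp) = 0

/-- `Φ` reflects the ball `B(x₀, r)` across `∂Ω` into the closure of `Ω`: it is the identity on the
closure of `Ω`, it maps the part outside the closure of `Ω` into `Ω`, and it is Lipschitz on the ball
and bi-Lipschitz on the part outside `Ω`, with constant `K`. The function `h ∘ Φ` is then a
reflection of `h` across `∂Ω`. -/
structure IsReflectionMap {d : ℕ} (Ω : Set (Euc d)) (x₀ : Euc d) (r : ℝ) (K : ℝ≥0)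
    (Φ : Euc d → Euc d) : Prop where
  eq_self : ∀ x ∈ ball x₀ r ∩ closure Ω, Φ x = x
  mapsTo : MapsTo Φ (ball x₀ r \ closure Ω) Ω
  lipschitz : LipschitzOnWith K Φ (ball x₀ r)
  antilipschitz : ∀ x ∈ ball x₀ r \ Ω, ∀ y ∈ ball x₀ r \ Ω, dist x y ≤ K * dist (Φ x) (Φ y)

/-- On `U` the matrix field `A` is symmetric and uniformly elliptic with constants `lam`, `Lam`, and
its coefficients are Lipschitz with constant `L`. -/
structure IsEllipticLipschitz {d : ℕ} (U : Set (Euc d)) (lam Lam : ℝ) (L : ℝ≥0)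
    (A : MatField d) : Prop where
  symm : ∀ x ∈ U, (A x).IsSymm
  elliptic : ∀ x ∈ U, ∀ ξ : Fin d → ℝ,
    lam * (ξ ⬝ᵥ ξ) ≤ ξ ⬝ᵥ (A x *ᵥ ξ) ∧ ξ ⬝ᵥ (A x *ᵥ ξ) ≤ Lam * (ξ ⬝ᵥ ξ)
  lipschitz : ∀ i j : Fin d, LipschitzOnWith L (fun x => A x i j) U

/-- In `B(x₀, r)` every Neumann harmonic function on `Ω` has a reflection across `∂Ω` that solves
`div (A ∇ ·) = 0`. Neither `A` nor the reflection map depends on the function. -/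
structure ReflectsNeumann {d : ℕ} (Ω : Set (Euc d)) (x₀ : Euc d) (r : ℝ) (lam Lam : ℝ) (L K : ℝ≥0)
    (A : MatField d) : Prop where
  coeff : IsEllipticLipschitz (ball x₀ r) lam Lam L A
  eq_one : ∀ x ∈ ball x₀ r ∩ Ω, A x = 1
  reflection : ∃ Φ : Euc d → Euc d, IsReflectionMap Ω x₀ r K Φ ∧
    ∀ h : Euc d → ℝ, IsNeumannHarmonic Ω h → IsWeakSolution A (ball x₀ r) (h ∘ Φ)

/-- All balls of radius at most `r₀` centered on `∂Ω` carry reflections, with constants that depend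
only on `Ω`, and the matrix field in `B(x₀, r)` is given by the rule `𝓑` from the ball and from the
piece of `Ω` in the ball alone. -/
def ReflectsUpTo {d : ℕ} (𝓑 : Euc d → ℝ → Set (Euc d) → MatField d) (Ω : Set (Euc d))
    (r₀ : ℝ) : Prop :=
  ∃ (lam Lam : ℝ) (L K : ℝ≥0), 0 < lam ∧
    ∀ x₀ ∈ frontier Ω, ∀ r : ℝ, 0 < r → r ≤ r₀ →
      ReflectsNeumann Ω x₀ r lam Lam L K (𝓑 x₀ r (Ω ∩ ball x₀ r))

end

/-!
The reflection is built from a piece of graph, and the rule chooses the graph.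

*Reflection across a graph.* Let `Ω` be `{heightAbove e f < 0}` near `x₀`, where `f` is `C^{1,1}`
and, after a cutoff, `fderiv ℝ f` is everywhere close to a linear form (`IsNearlyLinearGraph`). The
map `straighten e f` sends the hyperplane orthogonal to `e` to the graph and the direction `e`, to
first order, to the normal direction of the graph. The usual map of this kind, `x ↦ x + f x • e -
⟪e, x⟫ • ∇ f x`, is only Lipschitz when `f` is `C^{1,1}`. If each product of the height `s` and a
partial derivative of `f` is replaced by the increment of `f` over a step of length `s` in that
direction, the map is `C^{1,1}` and has the same derivative on the hyperplane. Conjugating the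
orthogonal mirror by it gives a `C^{1,1}` involution `graphReflection e f` that fixes the graph and
whose derivative on the graph is an isometry (`norm_fderiv_graphReflection_apply`).

*The equation.* If `Ψ` is such an involution and `h` is harmonic, then `h ∘ Ψ` solves
`div (A ∇ ·) = 0` with `A = |det DΨ| (DΨ)⁻¹ (DΨ)⁻ᵀ`. This `A` is Lipschitz, and it is the identity on
the graph because `DΨ` is an isometry there, so extending it by the identity into `Ω` keeps it
Lipschitz (`exists_isEllipticLipschitz_reflectedCoeff`). For a test function `ψ` in the ball, a
change of variables on the far side of the graph turns the weak formulation for the reflected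
function into `∫_Ω ∇ h · ∇ (ψ + ψ ∘ Ψ)`, where `ψ ∘ Ψ` is a `C¹` function with compact support. It
vanishes by the Neumann condition, which extends from smooth to `C¹` test functions
(`IsReflectedInBall.isWeakSolution`).

*The rule.* A rule that sees only `Ω ∩ B(x₀, r)` cannot know the graph that describes `Ω` in a larger
ball. `reflectionRule` chooses any graph that describes the piece of `Ω` in `B(x₀, r)`, with the
least possible constant. Its reflection may move points out of `B(x₀, r)`, where the chosen graph
says nothing about `Ω`. Since both graphs are nearly linear and bound the same set in the ball,
they stay close to one another at distances comparable with the height above the graph, and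
therefore the chosen reflection still exchanges the two sides of `Ω`
(`heightAbove_graphReflection_of_sign`).

*Uniformity.* By compactness of the boundary, the balls on which `Ω` is below a graph and the
constants of the graphs are uniform (`IsC11Domain.exists_uniform`), and a cutoff at a small scale
makes the graphs as nearly linear as needed (`exists_isNearlyLinearGraph`). The cylinder inherits
its graphs from the cross-section.
-/

/-! ### Graphs of nearly linear functions -/

/-- `f`, read off on the hyperplane orthogonal to the unit vector `e`, is a `C^{1,1}` function whose
derivative stays within `ε` of the linear form `a`. The function is extended to the whole space as
a constant in the direction `e`, so that its graph is the zero set of `heightAbove e f`. -/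
structure IsNearlyLinearGraph {d : ℕ} (e : Euc d) (f : Euc d → ℝ) (a : Euc d →L[ℝ] ℝ) (ε : ℝ)
    (L : ℝ≥0) : Prop where
  norm_dir : ‖e‖ = 1
  invariant : ∀ (x : Euc d) (t : ℝ), f (x + t • e) = f x
  differentiable : Differentiable ℝ f
  lipschitz_fderiv : LipschitzWith L (fderiv ℝ f)
  slope_dir : a e = 0
  close : ∀ x, ‖fderiv ℝ f x - a‖ ≤ ε

/-- The height of `x` above the graph of `f`, measured in the direction `e`. -/
noncomputable def heightAbove {d : ℕ} (e : Euc d) (f : Euc d → ℝ) (x : Euc d) : ℝ :=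
  inner ℝ e x - f x

/-- The vector that represents the linear form `a`. -/
noncomputable def slopeVector {d : ℕ} (a : Euc d →L[ℝ] ℝ) : Euc d :=
  (InnerProductSpace.toDual ℝ (Euc d)).symm a

/-- The map that straightens the graph of `f`: it sends the hyperplane orthogonal to `e` to the
graph, and the direction `e` to the normal direction of the graph, to first order. The difference
`f (x + s b) - f x`, where `s` is the height of `x` and `b` a basis vector, replaces the product of
`s` and the partial derivative of `f`. The two agree to first order at `s = 0`, but the difference
is as smooth as `f` is, and the product is not. -/
noncomputable def straighten {d : ℕ} (e : Euc d) (f : Euc d → ℝ) (x : Euc d) : Euc d :=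
  x + f x • e -
    ∑ j, (f (x + inner ℝ e x • EuclideanSpace.basisFun (Fin d) ℝ j) - f x) •
      EuclideanSpace.basisFun (Fin d) ℝ j

/-- The derivative of `straighten e f`. -/
noncomputable def straightenDeriv {d : ℕ} (e : Euc d) (f : Euc d → ℝ) (x : Euc d) :
    Euc d →L[ℝ] Euc d :=
  ContinuousLinearMap.id ℝ (Euc d) + (fderiv ℝ f x).smulRight e -
    ∑ j, ((fderiv ℝ f (x + inner ℝ e x • EuclideanSpace.basisFun (Fin d) ℝ j)).comp
        (ContinuousLinearMap.id ℝ (Euc d) +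
          (innerSL ℝ e).smulRight (EuclideanSpace.basisFun (Fin d) ℝ j)) -
      fderiv ℝ f x).smulRight (EuclideanSpace.basisFun (Fin d) ℝ j)

/-- The straightening map of the graph of the linear form `a`, up to translation. It is the sum of
the identity and of a skew map. -/
noncomputable def straightenLinear {d : ℕ} (e : Euc d) (a : Euc d →L[ℝ] ℝ) : Euc d →L[ℝ] Euc d :=
  ContinuousLinearMap.id ℝ (Euc d) + a.smulRight e - (innerSL ℝ e).smulRight (slopeVector a)

section Graph

lemma fderiv_eq_zero_of_invariant {d : ℕ} {e : Euc d} {f : Euc d → ℝ} (hf : Differentiable ℝ f)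
    (hinv : ∀ (x : Euc d) (t : ℝ), f (x + t • e) = f x) (x : Euc d) : fderiv ℝ f x e = 0 := by
  have h1 : HasLineDerivAt ℝ f (fderiv ℝ f x e) x e := (hf x).hasFDerivAt.hasLineDerivAt e
  have h2 : HasLineDerivAt ℝ f 0 x e := by
    unfold HasLineDerivAt
    simp only [hinv]
    exact hasDerivAt_const _ _
  exact h1.unique h2

variable {d : ℕ} {e : Euc d} {f : Euc d → ℝ} {a : Euc d →L[ℝ] ℝ} {ε : ℝ} {L : ℝ≥0}

lemma inner_slopeVector (a : Euc d →L[ℝ] ℝ) (v : Euc d) : inner ℝ (slopeVector a) v = a v := by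
  simp [slopeVector]

lemma norm_slopeVector (a : Euc d →L[ℝ] ℝ) : ‖slopeVector a‖ = ‖a‖ := by
  simp [slopeVector]

lemma sum_apply_smul_basisFun (a : Euc d →L[ℝ] ℝ) :
    ∑ j, a (EuclideanSpace.basisFun (Fin d) ℝ j) • EuclideanSpace.basisFun (Fin d) ℝ j =
      slopeVector a := by
  rw [← (EuclideanSpace.basisFun (Fin d) ℝ).sum_repr' (slopeVector a)]
  refine Finset.sum_congr rfl fun j _ => ?_
  rw [real_inner_comm, inner_slopeVector]

namespace IsNearlyLinearGraph

lemma eps_nonneg (h : IsNearlyLinearGraph e f a ε L) : 0 ≤ ε :=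
  (norm_nonneg _).trans (h.close 0)

lemma dim_pos (h : IsNearlyLinearGraph e f a ε L) : 1 ≤ (d : ℝ) := by
  rcases Nat.eq_zero_or_pos d with rfl | hd
  · have := h.norm_dir
    rw [Subsingleton.elim e 0, norm_zero] at this
    exact absurd this zero_ne_one
  · exact_mod_cast hd

lemma abs_sub_sub_le (h : IsNearlyLinearGraph e f a ε L) (x y : Euc d) :
    |f x - f y - a (x - y)| ≤ ε * ‖x - y‖ := by
  simpa using convex_univ.norm_image_sub_le_of_norm_fderiv_le' (f := f) (φ := a) (C := ε)
    (fun x _ => h.differentiable x) (fun x _ => h.close x) (mem_univ y) (mem_univ x)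

lemma abs_heightAbove_sub_le (h : IsNearlyLinearGraph e f a ε L) (x y : Euc d) :
    |heightAbove e f x - heightAbove e f y - (inner ℝ e (x - y) - a (x - y))| ≤
      ε * ‖x - y‖ := by
  have := h.abs_sub_sub_le x y
  rw [← abs_neg] at this
  convert this using 2
  simp only [heightAbove, inner_sub_right]
  ring

lemma continuous_heightAbove (h : IsNearlyLinearGraph e f a ε L) :
    Continuous (heightAbove e f) := by
  have := h.differentiable.continuous
  unfold heightAbove
  fun_prop

lemma inner_dir_self (h : IsNearlyLinearGraph e f a ε L) : inner ℝ e e = (1 : ℝ) := by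
  rw [real_inner_self_eq_norm_sq, h.norm_dir]; norm_num

lemma heightAbove_add_smul (h : IsNearlyLinearGraph e f a ε L) (x : Euc d) (t : ℝ) :
    heightAbove e f (x + t • e) = heightAbove e f x + t := by
  simp only [heightAbove, h.invariant, inner_add_right, inner_smul_right, h.inner_dir_self]
  ring

lemma fderiv_dir (h : IsNearlyLinearGraph e f a ε L) (x : Euc d) : fderiv ℝ f x e = 0 :=
  fderiv_eq_zero_of_invariant h.differentiable h.invariant x

lemma abs_inner_dir_le (h : IsNearlyLinearGraph e f a ε L) (x : Euc d) : |inner ℝ e x| ≤ ‖x‖ := by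
  simpa [h.norm_dir] using abs_real_inner_le_norm e x

/-- The tangential correction in `straighten` is close to a multiple of the slope. -/
lemma norm_correction_sub_le (h : IsNearlyLinearGraph e f a ε L) (x : Euc d) :
    ‖(∑ j, (f (x + inner ℝ e x • EuclideanSpace.basisFun (Fin d) ℝ j) - f x) •
        EuclideanSpace.basisFun (Fin d) ℝ j) - inner ℝ e x • slopeVector a‖ ≤
      d * ε * |inner ℝ e x| := by
  rw [← sum_apply_smul_basisFun, Finset.smul_sum, ← Finset.sum_sub_distrib]
  refine (norm_sum_le _ _).trans ?_
  have key : ∀ j : Fin d, ‖(f (x + inner ℝ e x • EuclideanSpace.basisFun (Fin d) ℝ j) - f x) •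
      EuclideanSpace.basisFun (Fin d) ℝ j - inner ℝ e x •
        (a (EuclideanSpace.basisFun (Fin d) ℝ j) • EuclideanSpace.basisFun (Fin d) ℝ j)‖ ≤
      ε * |inner ℝ e x| := by
    intro j
    rw [smul_smul, ← sub_smul, norm_smul, (EuclideanSpace.basisFun (Fin d) ℝ).norm_eq_one, mul_one]
    have := h.abs_sub_sub_le (x + inner ℝ e x • EuclideanSpace.basisFun (Fin d) ℝ j) x
    rw [add_sub_cancel_left, map_smul, norm_smul,
      (EuclideanSpace.basisFun (Fin d) ℝ).norm_eq_one, mul_one] at this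
    simpa using this
  refine (Finset.sum_le_sum fun j _ => key j).trans ?_
  simp [mul_assoc]

lemma hasFDerivAt_straighten (h : IsNearlyLinearGraph e f a ε L) (x : Euc d) :
    HasFDerivAt (straighten e f) (straightenDeriv e f x) x := by
  have hf : ∀ y, HasFDerivAt f (fderiv ℝ f y) y := fun y => (h.differentiable y).hasFDerivAt
  unfold straighten straightenDeriv
  refine HasFDerivAt.sub ((hasFDerivAt_id x).add ((hf x).smul_const e)) ?_
  refine HasFDerivAt.fun_sum fun j _ => ?_
  refine HasFDerivAt.smul_const (HasFDerivAt.sub ?_ (hf x)) _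
  refine (hf _).comp x ?_
  exact (hasFDerivAt_id x).add ((innerSL ℝ e).hasFDerivAt.smul_const _)

/-- To first order, straightening a nearly linear graph is straightening a linear one. -/
lemma norm_straightenDeriv_sub_le (h : IsNearlyLinearGraph e f a ε L) (x : Euc d) :
    ‖straightenDeriv e f x - straightenLinear e a‖ ≤ (1 + 3 * d) * ε := by
  have hε := h.eps_nonneg
  refine ContinuousLinearMap.opNorm_le_bound _ (by positivity) fun v => ?_
  set b := EuclideanSpace.basisFun (Fin d) ℝ with hb
  have h1 : (straightenDeriv e f x - straightenLinear e a) v =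
      ((fderiv ℝ f x - a) v) • e - ∑ j, ((fderiv ℝ f (x + inner ℝ e x • b j) - a)
        (v + inner ℝ e v • b j) - (fderiv ℝ f x - a) v) • b j := by
    have h2 : inner ℝ e v • slopeVector a =
        ∑ j, (a (v + inner ℝ e v • b j) - a v) • b j := by
      rw [← sum_apply_smul_basisFun, Finset.smul_sum]
      refine Finset.sum_congr rfl fun j _ => ?_
      rw [map_add, map_smul, add_sub_cancel_left, smul_smul, smul_eq_mul]
    have h3 : straightenDeriv e f x v = v + fderiv ℝ f x v • e -
        ∑ j, (fderiv ℝ f (x + inner ℝ e x • b j) (v + inner ℝ e v • b j) -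
          fderiv ℝ f x v) • b j := by
      simp [straightenDeriv, hb]
    have h4 : straightenLinear e a v = v + a v • e - inner ℝ e v • slopeVector a := by
      simp [straightenLinear]
    rw [sub_apply, h3, h4, h2]
    have h5 : ∑ j, ((fderiv ℝ f (x + inner ℝ e x • b j) - a)
        (v + inner ℝ e v • b j) - (fderiv ℝ f x - a) v) • b j =
        ∑ j, (fderiv ℝ f (x + inner ℝ e x • b j) (v + inner ℝ e v • b j) -
          fderiv ℝ f x v) • b j - ∑ j, (a (v + inner ℝ e v • b j) - a v) • b j := by
      rw [← Finset.sum_sub_distrib]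
      refine Finset.sum_congr rfl fun j _ => ?_
      rw [← sub_smul, sub_apply, sub_apply]
      congr 1; ring
    rw [h5, sub_apply, sub_smul]
    abel
  have h6 : ∀ j, ‖((fderiv ℝ f (x + inner ℝ e x • b j) - a)
        (v + inner ℝ e v • b j) - (fderiv ℝ f x - a) v) • b j‖ ≤ 3 * ε * ‖v‖ := by
    intro j
    rw [norm_smul, b.norm_eq_one, mul_one]
    have h7 : ‖v + inner ℝ e v • b j‖ ≤ 2 * ‖v‖ := by
      refine (norm_add_le _ _).trans ?_
      rw [norm_smul, b.norm_eq_one, mul_one, Real.norm_eq_abs]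
      linarith [h.abs_inner_dir_le v]
    have h8 := (fderiv ℝ f (x + inner ℝ e x • b j) - a).le_of_opNorm_le_of_le (h.close _) h7
    have h9 := (fderiv ℝ f x - a).le_of_opNorm_le (h.close _) v
    refine (norm_sub_le _ _).trans ?_
    linarith
  rw [h1]
  refine (norm_sub_le _ _).trans ?_
  have h10 : ‖((fderiv ℝ f x - a) v) • e‖ ≤ ε * ‖v‖ := by
    rw [norm_smul, h.norm_dir, mul_one]
    exact (fderiv ℝ f x - a).le_of_opNorm_le (h.close _) v
  have h11 := (norm_sum_le Finset.univ _).trans (Finset.sum_le_sum fun j _ => h6 j)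
  simp only [Finset.sum_const, Finset.card_univ, Fintype.card_fin, nsmul_eq_mul] at h11
  linarith

end IsNearlyLinearGraph
end Graph

/-! ### The reflection across a graph -/

/-- The orthogonal reflection in the hyperplane orthogonal to the unit vector `e`. -/
noncomputable def mirror {d : ℕ} (e : Euc d) : Euc d →L[ℝ] Euc d :=
  ContinuousLinearMap.id ℝ (Euc d) - (innerSL ℝ e).smulRight ((2 : ℝ) • e)

/-- The reflection across the graph of `f`: the orthogonal reflection in a hyperplane, conjugated by
the straightening map. -/
noncomputable def graphReflection {d : ℕ} (e : Euc d) (f : Euc d → ℝ) (x : Euc d) : Euc d :=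
  straighten e f (mirror e (Function.invFun (straighten e f) x))

section Reflection

variable {d : ℕ} {e : Euc d} {f : Euc d → ℝ} {a : Euc d →L[ℝ] ℝ} {ε Q : ℝ} {L : ℝ≥0}

lemma mirror_apply (e x : Euc d) : mirror e x = x - (2 * inner ℝ e x) • e := by
  simp [mirror, smul_smul, mul_comm]

namespace IsNearlyLinearGraph

lemma inner_mirror (h : IsNearlyLinearGraph e f a ε L) (x : Euc d) :
    inner ℝ e (mirror e x) = - inner ℝ e x := by
  rw [mirror_apply, inner_sub_right, inner_smul_right, h.inner_dir_self]
  ring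

lemma mirror_mirror (h : IsNearlyLinearGraph e f a ε L) (x : Euc d) :
    mirror e (mirror e x) = x := by
  rw [mirror_apply, h.inner_mirror, mirror_apply]
  module

lemma norm_mirror (h : IsNearlyLinearGraph e f a ε L) (x : Euc d) : ‖mirror e x‖ = ‖x‖ := by
  rw [← sq_eq_sq₀ (norm_nonneg _) (norm_nonneg _), mirror_apply, norm_sub_sq_real, norm_smul,
    h.norm_dir, inner_smul_right, real_inner_comm, mul_one, Real.norm_eq_abs, sq_abs]
  ring

/-- The sum of the identity and of a skew map does not decrease norms. -/
lemma norm_le_norm_straightenLinear (a : Euc d →L[ℝ] ℝ) (e v : Euc d) :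
    ‖v‖ ≤ ‖straightenLinear e a v‖ := by
  have h1 : inner ℝ (straightenLinear e a v) v = ‖v‖ ^ 2 := by
    simp only [straightenLinear, add_apply, sub_apply,
      ContinuousLinearMap.smulRight_apply, ContinuousLinearMap.id_apply, inner_add_left,
      inner_sub_left, real_inner_smul_left, inner_slopeVector, real_inner_self_eq_norm_sq,
      innerSL_apply_apply]
    ring
  have h2 := real_inner_le_norm (straightenLinear e a v) v
  rw [h1] at h2
  by_contra! h3
  have h4 : 0 < ‖v‖ := (norm_nonneg _).trans_lt h3
  nlinarith

lemma norm_straightenLinear_le (h : IsNearlyLinearGraph e f a ε L) :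
    ‖straightenLinear e a‖ ≤ 1 + 2 * ‖a‖ := by
  refine ContinuousLinearMap.opNorm_le_bound _ (by positivity) fun v => ?_
  have h1 : straightenLinear e a v = v + a v • e - inner ℝ e v • slopeVector a := by
    simp [straightenLinear]
  rw [h1]
  refine (norm_sub_le _ _).trans ?_
  have h2 := norm_add_le v (a v • e)
  rw [norm_smul, h.norm_dir] at h2
  rw [norm_smul, norm_slopeVector, Real.norm_eq_abs]
  have h3 := a.le_opNorm v
  have h4 := mul_le_mul_of_nonneg_right (h.abs_inner_dir_le v) (norm_nonneg a)
  nlinarith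

lemma norm_straightenDeriv_sub_le_half (h : IsNearlyLinearGraph e f a ε L) (hQ : 1 + ‖a‖ ≤ Q)
    (hε : 8 * d * Q * ε ≤ 1) (x : Euc d) :
    ‖straightenDeriv e f x - straightenLinear e a‖ ≤ 1 / 2 := by
  refine (h.norm_straightenDeriv_sub_le x).trans ?_
  have h1 := h.dim_pos
  have h2 := h.eps_nonneg
  have h3 : 1 ≤ Q := by linarith [norm_nonneg a]
  have h4 : ε ≤ d * ε := by nlinarith
  have h5 : d * ε ≤ Q * (d * ε) := by nlinarith [mul_nonneg (by linarith : (0:ℝ) ≤ d) h2]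
  nlinarith

lemma norm_straightenDeriv_le (h : IsNearlyLinearGraph e f a ε L) (hQ : 1 + ‖a‖ ≤ Q)
    (hε : 8 * d * Q * ε ≤ 1) (x : Euc d) : ‖straightenDeriv e f x‖ ≤ 2 * Q := by
  have h1 := norm_sub_norm_le (straightenDeriv e f x) (straightenLinear e a)
  have h2 := h.norm_straightenDeriv_sub_le_half hQ hε x
  have h3 := h.norm_straightenLinear_le
  linarith

lemma norm_le_two_mul_norm_straightenDeriv (h : IsNearlyLinearGraph e f a ε L) (hQ : 1 + ‖a‖ ≤ Q)
    (hε : 8 * d * Q * ε ≤ 1) (x v : Euc d) : ‖v‖ ≤ 2 * ‖straightenDeriv e f x v‖ := by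
  have h1 := norm_le_norm_straightenLinear a e v
  have h2 := (straightenDeriv e f x - straightenLinear e a).le_of_opNorm_le
    (h.norm_straightenDeriv_sub_le_half hQ hε x) v
  rw [sub_apply] at h2
  have h3 := norm_sub_norm_le (straightenLinear e a v) (straightenDeriv e f x v)
  rw [norm_sub_rev] at h3
  linarith

lemma norm_straighten_sub_sub_le (h : IsNearlyLinearGraph e f a ε L) (hQ : 1 + ‖a‖ ≤ Q)
    (hε : 8 * d * Q * ε ≤ 1) (x y : Euc d) :
    ‖straighten e f x - straighten e f y - straightenLinear e a (x - y)‖ ≤ 1 / 2 * ‖x - y‖ :=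
  convex_univ.norm_image_sub_le_of_norm_hasFDerivWithin_le' (f := straighten e f)
    (φ := straightenLinear e a) (f' := straightenDeriv e f)
    (fun x _ => (h.hasFDerivAt_straighten x).hasFDerivWithinAt)
    (fun x _ => h.norm_straightenDeriv_sub_le_half hQ hε x) (mem_univ y) (mem_univ x)

lemma norm_sub_le_two_mul (h : IsNearlyLinearGraph e f a ε L) (hQ : 1 + ‖a‖ ≤ Q)
    (hε : 8 * d * Q * ε ≤ 1) (x y : Euc d) :
    ‖x - y‖ ≤ 2 * ‖straighten e f x - straighten e f y‖ := by
  have h1 := norm_le_norm_straightenLinear a e (x - y)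
  have h2 := h.norm_straighten_sub_sub_le hQ hε x y
  have h3 := norm_sub_norm_le (straightenLinear e a (x - y)) (straighten e f x - straighten e f y)
  rw [norm_sub_rev (straightenLinear e a (x - y))] at h3
  linarith

/-- The map `straighten e f` differs from an expanding linear isomorphism by a map with Lipschitz
constant `1 / 2`, so the inverse function theorem applies on the whole space. -/
lemma bijective_straighten (h : IsNearlyLinearGraph e f a ε L) (hQ : 1 + ‖a‖ ≤ Q)
    (hε : 8 * d * Q * ε ≤ 1) : Function.Bijective (straighten e f) := by
  refine ⟨fun x y hxy => ?_, ?_⟩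
  · have := h.norm_sub_le_two_mul hQ hε x y
    rw [hxy, sub_self, norm_zero, mul_zero] at this
    exact sub_eq_zero.1 (norm_le_zero_iff.1 this)
  · have hinj : Function.Injective (straightenLinear e a : Euc d →ₗ[ℝ] Euc d) := by
      refine (injective_iff_map_eq_zero _).2 fun v hv => ?_
      have h1 := norm_le_norm_straightenLinear a e v
      rw [show straightenLinear e a v = 0 from hv, norm_zero] at h1
      exact norm_le_zero_iff.1 h1
    set T := (LinearEquiv.ofInjectiveEndo _ hinj).toContinuousLinearEquiv with hT
    have hTv : ∀ v, T v = straightenLinear e a v := fun v => rfl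
    have hA : ApproximatesLinearOn (straighten e f) (T : Euc d →L[ℝ] Euc d) univ (1 / 2) := by
      intro x _ y _
      have := h.norm_straighten_sub_sub_le hQ hε x y
      simpa [hTv] using this
    have hne : Nontrivial (Euc d) := ⟨e, 0, fun he => by simpa [he] using h.norm_dir⟩
    refine hA.surjective (Or.inr ?_)
    have hle : ‖(T.symm : Euc d →L[ℝ] Euc d)‖₊ ≤ 1 := by
      rw [← NNReal.coe_le_coe, coe_nnnorm, NNReal.coe_one]
      refine ContinuousLinearMap.opNorm_le_bound _ zero_le_one fun v => ?_
      have := norm_le_norm_straightenLinear a e (T.symm v)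
      rw [← hTv, T.apply_symm_apply] at this
      simpa using this
    have hpos : 0 < ‖(T.symm : Euc d →L[ℝ] Euc d)‖₊ := T.nnnorm_symm_pos
    have := one_le_inv₀ hpos |>.2 hle
    refine lt_of_lt_of_le ?_ this
    rw [← NNReal.coe_lt_coe]; norm_num

lemma straighten_invFun (h : IsNearlyLinearGraph e f a ε L) (hQ : 1 + ‖a‖ ≤ Q)
    (hε : 8 * d * Q * ε ≤ 1) (x : Euc d) :
    straighten e f (Function.invFun (straighten e f) x) = x :=
  Function.rightInverse_invFun (h.bijective_straighten hQ hε).2 x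

lemma invFun_straighten (h : IsNearlyLinearGraph e f a ε L) (hQ : 1 + ‖a‖ ≤ Q)
    (hε : 8 * d * Q * ε ≤ 1) (x : Euc d) :
    Function.invFun (straighten e f) (straighten e f x) = x :=
  Function.leftInverse_invFun (h.bijective_straighten hQ hε).1 x

lemma lipschitzWith_invFun (h : IsNearlyLinearGraph e f a ε L) (hQ : 1 + ‖a‖ ≤ Q)
    (hε : 8 * d * Q * ε ≤ 1) : LipschitzWith 2 (Function.invFun (straighten e f)) := by
  refine LipschitzWith.of_dist_le_mul fun x y => ?_
  have := h.norm_sub_le_two_mul hQ hε (Function.invFun (straighten e f) x)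
    (Function.invFun (straighten e f) y)
  rw [h.straighten_invFun hQ hε, h.straighten_invFun hQ hε] at this
  simpa [dist_eq_norm] using this

lemma graphReflection_straighten (h : IsNearlyLinearGraph e f a ε L) (hQ : 1 + ‖a‖ ≤ Q)
    (hε : 8 * d * Q * ε ≤ 1) (x : Euc d) :
    graphReflection e f (straighten e f x) = straighten e f (mirror e x) := by
  rw [graphReflection, h.invFun_straighten hQ hε]

lemma graphReflection_involutive (h : IsNearlyLinearGraph e f a ε L) (hQ : 1 + ‖a‖ ≤ Q)
    (hε : 8 * d * Q * ε ≤ 1) : Function.Involutive (graphReflection e f) := by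
  intro x
  obtain ⟨z, rfl⟩ := (h.bijective_straighten hQ hε).2 x
  rw [h.graphReflection_straighten hQ hε, h.graphReflection_straighten hQ hε, h.mirror_mirror]

lemma norm_straighten_sub_le (h : IsNearlyLinearGraph e f a ε L) (hQ : 1 + ‖a‖ ≤ Q)
    (hε : 8 * d * Q * ε ≤ 1) (x y : Euc d) :
    ‖straighten e f x - straighten e f y‖ ≤ 2 * Q * ‖x - y‖ :=
  convex_univ.norm_image_sub_le_of_norm_hasFDerivWithin_le (f := straighten e f)
    (f' := straightenDeriv e f)
    (fun x _ => (h.hasFDerivAt_straighten x).hasFDerivWithinAt)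
    (fun x _ => h.norm_straightenDeriv_le hQ hε x) (mem_univ y) (mem_univ x)

lemma dist_graphReflection_le (h : IsNearlyLinearGraph e f a ε L) (hQ : 1 + ‖a‖ ≤ Q)
    (hε : 8 * d * Q * ε ≤ 1) (x y : Euc d) :
    dist (graphReflection e f x) (graphReflection e f y) ≤ 4 * Q * dist x y := by
  obtain ⟨z, rfl⟩ := (h.bijective_straighten hQ hε).2 x
  obtain ⟨w, rfl⟩ := (h.bijective_straighten hQ hε).2 y
  rw [h.graphReflection_straighten hQ hε, h.graphReflection_straighten hQ hε, dist_eq_norm,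
    dist_eq_norm]
  have h1 := h.norm_straighten_sub_le hQ hε (mirror e z) (mirror e w)
  rw [← map_sub, h.norm_mirror] at h1
  have h2 := h.norm_sub_le_two_mul hQ hε z w
  have h3 : 0 ≤ 2 * Q := by linarith [norm_nonneg a]
  nlinarith

/-- The height above the graph is comparable to the height above the hyperplane before
straightening, with the same sign. -/
lemma abs_heightAbove_straighten_sub_le (h : IsNearlyLinearGraph e f a ε L) (hQ : 1 + ‖a‖ ≤ Q)
    (hε : 8 * d * Q * ε ≤ 1) (x : Euc d) :
    |heightAbove e f (straighten e f x) - inner ℝ e x * (1 + ‖a‖ ^ 2)| ≤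
      1 / 2 * |inner ℝ e x| := by
  set s : ℝ := inner ℝ e x with hs
  set w := ∑ j, (f (x + inner ℝ e x • EuclideanSpace.basisFun (Fin d) ℝ j) - f x) •
        EuclideanSpace.basisFun (Fin d) ℝ j with hw
  have h1 : ‖w - s • slopeVector a‖ ≤ d * ε * |s| := h.norm_correction_sub_le x
  have h2 : heightAbove e f (straighten e f x) = s - inner ℝ e w + (f x - f (x - w)) := by
    have : straighten e f x = (x - w) + f x • e := by
      simp only [straighten, ← hw]; abel
    rw [this, h.heightAbove_add_smul, heightAbove, inner_sub_right]
    ring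
  have h3 : |inner ℝ e w| ≤ d * ε * |s| := by
    have h4 : inner ℝ e (w - s • slopeVector a) = (inner ℝ e w : ℝ) := by
      rw [inner_sub_right, inner_smul_right, real_inner_comm (slopeVector a), inner_slopeVector,
        h.slope_dir]
      ring
    rw [← h4]
    exact (h.abs_inner_dir_le _).trans h1
  have h5 := h.abs_sub_sub_le x (x - w)
  rw [sub_sub_cancel] at h5
  have h6 : |a w - s * ‖a‖ ^ 2| ≤ ‖a‖ * (d * ε * |s|) := by
    have h7 : a (w - s • slopeVector a) = a w - s * ‖a‖ ^ 2 := by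
      rw [map_sub, map_smul, ← inner_slopeVector a (slopeVector a), real_inner_self_eq_norm_sq,
        norm_slopeVector, smul_eq_mul]
    rw [← h7]
    exact a.le_opNorm_of_le h1
  have h8 : ‖w‖ ≤ (‖a‖ + d * ε) * |s| := by
    have := norm_sub_norm_le w (s • slopeVector a)
    rw [norm_smul, norm_slopeVector, Real.norm_eq_abs] at this
    linarith
  have hε0 := h.eps_nonneg
  have hd := h.dim_pos
  have ha := norm_nonneg a
  have hs0 := abs_nonneg s
  have h9 : ε * ‖w‖ ≤ ε * ((‖a‖ + d * ε) * |s|) := by gcongr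
  have hb : |heightAbove e f (straighten e f x) - s * (1 + ‖a‖ ^ 2)| ≤
      d * ε * |s| + ‖a‖ * (d * ε * |s|) + ε * ((‖a‖ + d * ε) * |s|) := by
    rw [h2]
    rw [abs_le] at h3 h5 h6 ⊢
    constructor <;> linarith [h3.1, h3.2, h5.1, h5.2, h6.1, h6.2]
  refine hb.trans ?_
  -- The first two error terms together, and the third one, are at most `|s| / 8`.
  have hu : d * ε * Q ≤ 1 / 8 := by linarith
  have hde : 0 ≤ d * ε := by positivity
  have hde1 : d * ε * (1 + ‖a‖) ≤ 1 / 8 := (by gcongr : d * ε * (1 + ‖a‖) ≤ d * ε * Q).trans hu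
  have hdeε : ε ≤ d * ε := by nlinarith
  have hde2 : d * ε ≤ 1 / 8 := by nlinarith [mul_nonneg hde ha]
  have h10 : ε * (‖a‖ + d * ε) ≤ d * ε * (‖a‖ + 1) := by
    refine mul_le_mul hdeε (by linarith) (by positivity) hde
  have h11 : ε * ((‖a‖ + d * ε) * |s|) ≤ d * ε * (‖a‖ + 1) * |s| := by
    rw [← mul_assoc]; gcongr
  have h12 : d * ε * (1 + ‖a‖) * |s| ≤ 1 / 8 * |s| := by gcongr
  nlinarith

/-- The reflection maps points above the graph to points below it, and the depth is comparable to
the initial height. -/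
lemma heightAbove_graphReflection_le (h : IsNearlyLinearGraph e f a ε L) (hQ : 1 + ‖a‖ ≤ Q)
    (hε : 8 * d * Q * ε ≤ 1) {x : Euc d} (hx : 0 < heightAbove e f x) :
    heightAbove e f (graphReflection e f x) ≤ -(heightAbove e f x / (4 * Q ^ 2)) := by
  obtain ⟨z, rfl⟩ := (h.bijective_straighten hQ hε).2 x
  rw [h.graphReflection_straighten hQ hε]
  have h1 := h.abs_heightAbove_straighten_sub_le hQ hε z
  have h2 := h.abs_heightAbove_straighten_sub_le hQ hε (mirror e z)
  rw [h.inner_mirror, abs_neg] at h2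
  have ha := norm_nonneg a
  set s : ℝ := inner ℝ e z
  have hs : 0 < s := by
    by_contra! hs
    rw [abs_of_nonpos hs, abs_le] at h1
    nlinarith [h1.2, sq_nonneg ‖a‖]
  rw [abs_of_pos hs, abs_le] at h1 h2
  have h3 : heightAbove e f (straighten e f z) / (4 * Q ^ 2) ≤ s / 2 := by
    rw [div_le_iff₀ (by nlinarith)]
    have : (1 + ‖a‖) ^ 2 ≤ Q ^ 2 := by gcongr
    nlinarith [h1.2]
  nlinarith [h2.2, sq_nonneg ‖a‖]

lemma le_heightAbove_graphReflection (h : IsNearlyLinearGraph e f a ε L) (hQ : 1 + ‖a‖ ≤ Q)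
    (hε : 8 * d * Q * ε ≤ 1) {x : Euc d} (hx : heightAbove e f x < 0) :
    -(heightAbove e f x / (4 * Q ^ 2)) ≤ heightAbove e f (graphReflection e f x) := by
  obtain ⟨z, rfl⟩ := (h.bijective_straighten hQ hε).2 x
  rw [h.graphReflection_straighten hQ hε]
  have h1 := h.abs_heightAbove_straighten_sub_le hQ hε z
  have h2 := h.abs_heightAbove_straighten_sub_le hQ hε (mirror e z)
  rw [h.inner_mirror, abs_neg] at h2
  have ha := norm_nonneg a
  set s : ℝ := inner ℝ e z
  have hs : s < 0 := by
    by_contra! hs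
    rw [abs_of_nonneg hs, abs_le] at h1
    nlinarith [h1.1, sq_nonneg ‖a‖]
  rw [abs_of_neg hs, abs_le] at h1 h2
  have h3 : s / 2 ≤ heightAbove e f (straighten e f z) / (4 * Q ^ 2) := by
    rw [le_div_iff₀ (by nlinarith)]
    have : (1 + ‖a‖) ^ 2 ≤ Q ^ 2 := by gcongr
    nlinarith [h1.1]
  nlinarith [h2.1, sq_nonneg ‖a‖]

/-- A point of the graph comes from a point of the hyperplane. -/
lemma exists_straighten_eq_of_heightAbove_eq_zero (h : IsNearlyLinearGraph e f a ε L)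
    (hQ : 1 + ‖a‖ ≤ Q) (hε : 8 * d * Q * ε ≤ 1) {x : Euc d} (hx : heightAbove e f x = 0) :
    ∃ z, straighten e f z = x ∧ inner ℝ e z = (0 : ℝ) := by
  obtain ⟨z, rfl⟩ := (h.bijective_straighten hQ hε).2 x
  refine ⟨z, rfl, ?_⟩
  have h1 := h.abs_heightAbove_straighten_sub_le hQ hε z
  rw [hx, zero_sub, abs_neg, abs_mul, abs_of_pos (by positivity : 0 < 1 + ‖a‖ ^ 2)] at h1
  have := abs_nonneg (inner ℝ e z : ℝ)
  refine abs_eq_zero.1 (le_antisymm ?_ this)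
  nlinarith [sq_nonneg ‖a‖]

lemma graphReflection_eq_self (h : IsNearlyLinearGraph e f a ε L) (hQ : 1 + ‖a‖ ≤ Q)
    (hε : 8 * d * Q * ε ≤ 1) {x : Euc d} (hx : heightAbove e f x = 0) :
    graphReflection e f x = x := by
  obtain ⟨z, rfl, hz⟩ := h.exists_straighten_eq_of_heightAbove_eq_zero hQ hε hx
  rw [h.graphReflection_straighten hQ hε, mirror_apply, hz, mul_zero, zero_smul, sub_zero]

end IsNearlyLinearGraph
end Reflection

section ReflectionDeriv

variable {d : ℕ} {e : Euc d} {f : Euc d → ℝ} {a : Euc d →L[ℝ] ℝ} {ε Q : ℝ} {L : ℝ≥0}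

namespace IsNearlyLinearGraph

/-- The map `straighten e f` is `C^{1,1}`, although `f` is no better than that. -/
lemma norm_straightenDeriv_sub_straightenDeriv_le (h : IsNearlyLinearGraph e f a ε L)
    (x y : Euc d) :
    ‖straightenDeriv e f x - straightenDeriv e f y‖ ≤ (1 + 5 * d) * L * ‖x - y‖ := by
  refine ContinuousLinearMap.opNorm_le_bound _ (by positivity) fun v => ?_
  set b := EuclideanSpace.basisFun (Fin d) ℝ with hb
  set p : Fin d → Euc d := fun j => x + inner ℝ e x • b j with hp
  set q : Fin d → Euc d := fun j => y + inner ℝ e y • b j with hq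
  have hf : ∀ x y, ‖fderiv ℝ f x - fderiv ℝ f y‖ ≤ L * ‖x - y‖ := fun x y => by
    simpa [dist_eq_norm] using h.lipschitz_fderiv.dist_le_mul x y
  have happ : ∀ z, straightenDeriv e f z v = v + fderiv ℝ f z v • e -
      ∑ j, (fderiv ℝ f (z + inner ℝ e z • b j) (v + inner ℝ e v • b j) -
        fderiv ℝ f z v) • b j := fun z => by
    simp [straightenDeriv, hb]
  have h1 : (straightenDeriv e f x - straightenDeriv e f y) v =
      ((fderiv ℝ f x - fderiv ℝ f y) v) • e - ∑ j, ((fderiv ℝ f (p j) - fderiv ℝ f (q j))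
        (v + inner ℝ e v • b j) - (fderiv ℝ f x - fderiv ℝ f y) v) • b j := by
    rw [sub_apply, happ, happ]
    have h5 : ∑ j, ((fderiv ℝ f (p j) - fderiv ℝ f (q j))
        (v + inner ℝ e v • b j) - (fderiv ℝ f x - fderiv ℝ f y) v) • b j =
        ∑ j, (fderiv ℝ f (p j) (v + inner ℝ e v • b j) - fderiv ℝ f x v) • b j -
        ∑ j, (fderiv ℝ f (q j) (v + inner ℝ e v • b j) - fderiv ℝ f y v) • b j := by
      rw [← Finset.sum_sub_distrib]
      refine Finset.sum_congr rfl fun j _ => ?_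
      rw [← sub_smul, sub_apply, sub_apply]
      congr 1; ring
    rw [h5, sub_apply, sub_smul]
    abel
  have hinner : ∀ (z : Euc d) j, ‖z + inner ℝ e z • b j‖ ≤ 2 * ‖z‖ := by
    intro z j
    refine (norm_add_le _ _).trans ?_
    rw [norm_smul, b.norm_eq_one, mul_one, Real.norm_eq_abs]
    linarith [h.abs_inner_dir_le z]
  have hv : ‖(fderiv ℝ f x - fderiv ℝ f y) v‖ ≤ L * ‖x - y‖ * ‖v‖ :=
    (fderiv ℝ f x - fderiv ℝ f y).le_of_opNorm_le (hf x y) v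
  have h6 : ∀ j, ‖((fderiv ℝ f (p j) - fderiv ℝ f (q j)) (v + inner ℝ e v • b j) -
      (fderiv ℝ f x - fderiv ℝ f y) v) • b j‖ ≤ 5 * (L * ‖x - y‖ * ‖v‖) := by
    intro j
    rw [norm_smul, b.norm_eq_one, mul_one]
    have hpq : ‖p j - q j‖ ≤ 2 * ‖x - y‖ := by
      have : p j - q j = (x - y) + inner ℝ e (x - y) • b j := by
        simp only [hp, hq, inner_sub_right, sub_smul]; abel
      rw [this]; exact hinner _ _
    have h7 : ‖fderiv ℝ f (p j) - fderiv ℝ f (q j)‖ ≤ L * (2 * ‖x - y‖) :=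
      (hf _ _).trans (by gcongr)
    have h8 := (fderiv ℝ f (p j) - fderiv ℝ f (q j)).le_of_opNorm_le_of_le h7 (hinner v j)
    refine (norm_sub_le _ _).trans ?_
    linarith
  rw [h1]
  refine (norm_sub_le _ _).trans ?_
  have h11 := (norm_sum_le Finset.univ _).trans (Finset.sum_le_sum fun j _ => h6 j)
  simp only [Finset.sum_const, Finset.card_univ, Fintype.card_fin, nsmul_eq_mul] at h11
  rw [norm_smul, h.norm_dir, mul_one]
  linarith

lemma exists_hasFDerivAt_invFun (h : IsNearlyLinearGraph e f a ε L) (hQ : 1 + ‖a‖ ≤ Q)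
    (hε : 8 * d * Q * ε ≤ 1) (x : Euc d) :
    ∃ T : Euc d →L[ℝ] Euc d, HasFDerivAt (Function.invFun (straighten e f)) T x ∧
      (∀ v, straightenDeriv e f (Function.invFun (straighten e f) x) (T v) = v) ∧
      (∀ v, T (straightenDeriv e f (Function.invFun (straighten e f) x) v) = v) := by
  set z := Function.invFun (straighten e f) x with hz
  have hinj : Function.Injective (straightenDeriv e f z : Euc d →ₗ[ℝ] Euc d) := by
    refine (injective_iff_map_eq_zero _).2 fun v hv => ?_
    have h1 := h.norm_le_two_mul_norm_straightenDeriv hQ hε z v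
    rw [show straightenDeriv e f z v = 0 from hv, norm_zero, mul_zero] at h1
    exact norm_le_zero_iff.1 h1
  set T := (LinearEquiv.ofInjectiveEndo _ hinj).toContinuousLinearEquiv with hT
  have hTv : ∀ v, T v = straightenDeriv e f z v := fun v => rfl
  have hT' : (T : Euc d →L[ℝ] Euc d) = straightenDeriv e f z := by ext v; rfl
  refine ⟨T.symm, ?_, fun v => ?_, fun v => ?_⟩
  · refine HasFDerivAt.of_local_left_inverse (f := straighten e f) ?_ ?_ ?_
    · exact (h.lipschitzWith_invFun hQ hε).continuous.continuousAt
    · rw [hT']; exact h.hasFDerivAt_straighten z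
    · exact Filter.Eventually.of_forall fun y => h.straighten_invFun hQ hε y
  · rw [← hTv]; exact T.apply_symm_apply v
  · rw [← hTv]; exact T.symm_apply_apply v

lemma norm_fderiv_invFun_sub_le (h : IsNearlyLinearGraph e f a ε L) (hQ : 1 + ‖a‖ ≤ Q)
    (hε : 8 * d * Q * ε ≤ 1) (x y : Euc d) :
    ‖fderiv ℝ (Function.invFun (straighten e f)) x -
      fderiv ℝ (Function.invFun (straighten e f)) y‖ ≤ 8 * ((1 + 5 * d) * L) * ‖x - y‖ := by
  have hlip := h.lipschitzWith_invFun hQ hε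
  set G := Function.invFun (straighten e f) with hG
  obtain ⟨T, hT, -, hT2⟩ := h.exists_hasFDerivAt_invFun hQ hε x
  obtain ⟨S, hS, hS1, -⟩ := h.exists_hasFDerivAt_invFun hQ hε y
  rw [← hG] at hT hT2 hS hS1
  have hTn : ‖T‖ ≤ 2 := by simpa [hT.fderiv] using norm_fderiv_le_of_lipschitz ℝ hlip (x₀ := x)
  have hSn : ‖S‖ ≤ 2 := by simpa [hS.fderiv] using norm_fderiv_le_of_lipschitz ℝ hlip (x₀ := y)
  have h1 : T - S = T.comp ((straightenDeriv e f (G y) - straightenDeriv e f (G x)).comp S) := by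
    ext1 v
    simp only [sub_apply, ContinuousLinearMap.comp_apply, hS1 v, map_sub, hT2]
  rw [hT.fderiv, hS.fderiv, h1]
  have h2 := h.norm_straightenDeriv_sub_straightenDeriv_le (G y) (G x)
  have h3 : ‖G y - G x‖ ≤ 2 * ‖x - y‖ := by
    rw [norm_sub_rev]; simpa [dist_eq_norm] using hlip.dist_le_mul x y
  have h4 : ‖straightenDeriv e f (G y) - straightenDeriv e f (G x)‖ ≤
      (1 + 5 * d) * L * (2 * ‖x - y‖) := h2.trans (by gcongr)
  calc _ ≤ ‖T‖ * (‖straightenDeriv e f (G y) - straightenDeriv e f (G x)‖ * ‖S‖) :=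
        (ContinuousLinearMap.opNorm_comp_le _ _).trans
          (by gcongr; exact ContinuousLinearMap.opNorm_comp_le _ _)
    _ ≤ 2 * ((1 + 5 * d) * L * (2 * ‖x - y‖) * 2) := by gcongr
    _ = _ := by ring

lemma hasFDerivAt_graphReflection (h : IsNearlyLinearGraph e f a ε L) (hQ : 1 + ‖a‖ ≤ Q)
    (hε : 8 * d * Q * ε ≤ 1) (x : Euc d) :
    HasFDerivAt (graphReflection e f)
      ((straightenDeriv e f (mirror e (Function.invFun (straighten e f) x))).comp
        ((mirror e).comp (fderiv ℝ (Function.invFun (straighten e f)) x))) x := by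
  obtain ⟨T, hT, -, -⟩ := h.exists_hasFDerivAt_invFun hQ hε x
  rw [hT.fderiv]
  exact (h.hasFDerivAt_straighten _).comp x ((mirror e).hasFDerivAt.comp x hT)

lemma norm_mirror_le (h : IsNearlyLinearGraph e f a ε L) : ‖mirror e‖ ≤ 1 :=
  ContinuousLinearMap.opNorm_le_bound _ zero_le_one fun v => by rw [h.norm_mirror, one_mul]

lemma norm_fderiv_graphReflection_sub_le (h : IsNearlyLinearGraph e f a ε L) (hQ : 1 + ‖a‖ ≤ Q)
    (hε : 8 * d * Q * ε ≤ 1) (x y : Euc d) :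
    ‖fderiv ℝ (graphReflection e f) x - fderiv ℝ (graphReflection e f) y‖ ≤
      (4 + 16 * Q) * ((1 + 5 * d) * L) * ‖x - y‖ := by
  have hlip := h.lipschitzWith_invFun hQ hε
  rw [(h.hasFDerivAt_graphReflection hQ hε x).fderiv, (h.hasFDerivAt_graphReflection hQ hε y).fderiv]
  have hd := h.norm_fderiv_invFun_sub_le hQ hε x y
  set G := Function.invFun (straighten e f) with hG
  have hTn : ‖fderiv ℝ G x‖ ≤ 2 := norm_fderiv_le_of_lipschitz ℝ hlip
  set T := fderiv ℝ G x
  set S := fderiv ℝ G y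
  set F := straightenDeriv e f with hF
  have h1 : (F (mirror e (G x))).comp ((mirror e).comp T) -
      (F (mirror e (G y))).comp ((mirror e).comp S) =
      (F (mirror e (G x)) - F (mirror e (G y))).comp ((mirror e).comp T) +
        (F (mirror e (G y))).comp ((mirror e).comp (T - S)) := by
    ext1 v
    simp only [sub_apply, add_apply, ContinuousLinearMap.comp_apply, map_sub]
    abel
  have h3 : ‖mirror e (G x) - mirror e (G y)‖ ≤ 2 * ‖x - y‖ := by
    rw [← map_sub, h.norm_mirror]; simpa [dist_eq_norm] using hlip.dist_le_mul x y
  have h4 : ‖F (mirror e (G x)) - F (mirror e (G y))‖ ≤ (1 + 5 * d) * L * (2 * ‖x - y‖) :=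
    (h.norm_straightenDeriv_sub_straightenDeriv_le _ _).trans (by gcongr)
  have h5 : ∀ T : Euc d →L[ℝ] Euc d, ‖(mirror e).comp T‖ ≤ ‖T‖ := fun T =>
    (ContinuousLinearMap.opNorm_comp_le _ _).trans
      (mul_le_of_le_one_left (norm_nonneg _) h.norm_mirror_le)
  have hQ0 : 0 ≤ 2 * Q := by linarith [norm_nonneg a]
  have h6 := h.norm_straightenDeriv_le hQ hε (mirror e (G y))
  rw [h1]
  calc _ ≤ ‖F (mirror e (G x)) - F (mirror e (G y))‖ * ‖(mirror e).comp T‖ +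
        ‖F (mirror e (G y))‖ * ‖(mirror e).comp (T - S)‖ :=
        (norm_add_le _ _).trans (add_le_add (ContinuousLinearMap.opNorm_comp_le _ _)
          (ContinuousLinearMap.opNorm_comp_le _ _))
    _ ≤ (1 + 5 * d) * L * (2 * ‖x - y‖) * 2 +
        2 * Q * (8 * ((1 + 5 * d) * L) * ‖x - y‖) := by
        gcongr
        · exact (h5 _).trans hTn
        · exact (h5 _).trans hd
    _ = _ := by ring

/-- At a point of the graph the derivative of the reflection is an isometry. -/
lemma norm_fderiv_graphReflection_apply (h : IsNearlyLinearGraph e f a ε L) (hQ : 1 + ‖a‖ ≤ Q)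
    (hε : 8 * d * Q * ε ≤ 1) {x : Euc d} (hx : heightAbove e f x = 0) (v : Euc d) :
    ‖fderiv ℝ (graphReflection e f) x v‖ = ‖v‖ := by
  obtain ⟨z, rfl, hz⟩ := h.exists_straighten_eq_of_heightAbove_eq_zero hQ hε hx
  have hmz : mirror e z = z := by rw [mirror_apply, hz, mul_zero, zero_smul, sub_zero]
  obtain ⟨T, hT, hT1, -⟩ := h.exists_hasFDerivAt_invFun hQ hε (straighten e f z)
  rw [(h.hasFDerivAt_graphReflection hQ hε _).fderiv, hT.fderiv, h.invFun_straighten hQ hε, hmz]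
  rw [h.invFun_straighten hQ hε] at hT1
  simp only [ContinuousLinearMap.comp_apply]
  conv_rhs => rw [← hT1 v]
  set u := T v
  -- The derivative sends the direction `e` to a normal vector of the graph, and vectors orthogonal
  -- to `e` to tangent vectors; so the mirror preserves the norm of the image.
  have hF : ∀ u, straightenDeriv e f z u =
      u + fderiv ℝ f z u • e - inner ℝ e u • slopeVector (fderiv ℝ f z) := by
    intro u
    rw [← sum_apply_smul_basisFun, Finset.smul_sum]
    simp only [straightenDeriv, hz]
    simp [smul_smul]
  have hfm : fderiv ℝ f z (mirror e u) = fderiv ℝ f z u := by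
    rw [mirror_apply, map_sub, map_smul, h.fderiv_dir, smul_zero, sub_zero]
  have hN : ∀ u, ‖straightenDeriv e f z u‖ ^ 2 = ‖u‖ ^ 2 + (fderiv ℝ f z u) ^ 2 +
      (inner ℝ e u) ^ 2 * ‖slopeVector (fderiv ℝ f z)‖ ^ 2 := by
    intro u
    rw [hF, norm_sub_sq_real, norm_add_sq_real, inner_add_left, inner_smul_right,
      inner_smul_right, norm_smul, norm_smul, h.norm_dir, inner_smul_left, inner_smul_right,
      real_inner_comm (slopeVector (fderiv ℝ f z)) u, inner_slopeVector,
      real_inner_comm (slopeVector (fderiv ℝ f z)) e, inner_slopeVector, h.fderiv_dir,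
      mul_pow, mul_pow, Real.norm_eq_abs, Real.norm_eq_abs, sq_abs, sq_abs, real_inner_comm e u]
    simp only [conj_trivial]
    ring
  rw [← sq_eq_sq₀ (norm_nonneg _) (norm_nonneg _), hN, hN, hfm, h.norm_mirror, h.inner_mirror]
  ring

end IsNearlyLinearGraph
end ReflectionDeriv

/-! ### Two graphs that bound the same set in a ball -/

section Comparison

variable {d : ℕ}

/-- A nearly linear function that is positive at `x` and very negative at another point of the ball
vanishes at a point of the ball whose distance to `x` is controlled by the value at `x`. -/
lemma exists_zero_near {g : Euc d → ℝ} {l : Euc d →L[ℝ] ℝ} {ε r : ℝ} {x q x₀ : Euc d}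
    (hε : ε ≤ 1 / 16) (hg : ∀ x y, |g x - g y - l (x - y)| ≤ ε * ‖x - y‖) (hc : Continuous g)
    (hx : x ∈ ball x₀ r) (hq : q ∈ ball x₀ r) (hgq : g q = -(r / 2)) (hgx : 0 < g x) :
    ∃ p ∈ ball x₀ r, g p = 0 ∧ ‖x - p‖ ≤ 8 * g x := by
  have hr : 0 < r := dist_nonneg.trans_lt (mem_ball.1 hx)
  have hcont : ContinuousOn (fun t : ℝ => g (x + t • (q - x))) (Icc 0 1) := by fun_prop
  have hivt := intermediate_value_Icc' zero_le_one hcont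
  simp only [zero_smul, add_zero, one_smul, add_sub_cancel] at hivt
  obtain ⟨t, ⟨ht0, ht1⟩, hgt⟩ := hivt ⟨by rw [hgq]; linarith, hgx.le⟩
  refine ⟨x + t • (q - x), ?_, hgt, ?_⟩
  · exact (convex_ball x₀ r).add_smul_sub_mem hx hq ⟨ht0, ht1⟩
  · have hxq : ‖x - q‖ ≤ 2 * r := by
      have h1 := dist_triangle_right x q x₀
      rw [dist_eq_norm] at h1
      linarith [mem_ball.1 hx, mem_ball.1 hq]
    have h2 := (abs_le.1 (hg x q)).2
    have hn := norm_nonneg (x - q)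
    have h3 : ε * ‖x - q‖ ≤ 1 / 16 * ‖x - q‖ := by gcongr
    have h4 : 3 / 16 * ‖x - q‖ ≤ l (x - q) := by linarith
    have h5 := (abs_le.1 (hg x (x + t • (q - x)))).1
    have h6 : x - (x + t • (q - x)) = t • (x - q) := by module
    beta_reduce at hgt
    rw [h6, hgt, map_smul, norm_smul, Real.norm_eq_abs, abs_of_nonneg ht0, smul_eq_mul] at h5
    rw [h6, norm_smul, Real.norm_eq_abs, abs_of_nonneg ht0]
    nlinarith [mul_le_mul_of_nonneg_left h4 ht0, mul_le_mul_of_nonneg_left h3 ht0]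

/-- Let `g` and `g'` be nearly linear, and suppose that in a ball `g'` is negative where `g` is. If
both vanish at a point `p` of the ball and `g` is quite negative at `z`, then `g'` is negative at
`z`, even if `z` is not in the ball: the ray from `p` to `z` starts in the ball. -/
lemma neg_of_neg_in_ball {g g' : Euc d → ℝ} {l l' : Euc d →L[ℝ] ℝ} {ε ε' r δ : ℝ}
    {p z x₀ u : Euc d} (hg : ∀ x y, |g x - g y - l (x - y)| ≤ ε * ‖x - y‖)
    (hg' : ∀ x y, |g' x - g' y - l' (x - y)| ≤ ε' * ‖x - y‖) (hε : 0 ≤ ε) (hε' : 0 ≤ ε')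
    (hgp : g p = 0) (hgp' : g' p = 0) (hu : ‖u‖ = 1) (hlu : l' u = 1) (hp : p ∈ ball x₀ r)
    (hsign : ∀ y ∈ ball x₀ r, g y < 0 → g' y < 0) (hδ : 0 < δ)
    (hz : g z + 2 * ε * ‖z - p‖ + δ * (‖l‖ + ε) < 0) (hz' : 2 * ε' * ‖z - p‖ + ε' * δ < δ) :
    g' z < 0 := by
  set ζ := z - p + δ • u with hζ
  have hζn : ‖ζ‖ ≤ ‖z - p‖ + δ := by
    refine (norm_add_le _ _).trans ?_
    rw [norm_smul, hu, mul_one, Real.norm_eq_abs, abs_of_pos hδ]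
  have hlζ : l ζ + ε * ‖ζ‖ < 0 := by
    have h1 := (abs_le.1 (hg z p)).1
    have h2 : l u ≤ ‖l‖ := by
      have := l.le_opNorm u
      rw [hu, mul_one] at this
      exact (le_abs_self _).trans this
    rw [hζ, map_add, map_smul, smul_eq_mul, ← hζ]
    have h3 : ε * ‖ζ‖ ≤ ε * (‖z - p‖ + δ) := by gcongr
    have h4 : δ * l u ≤ δ * ‖l‖ := by gcongr
    linarith
  obtain ⟨t, ht, hball⟩ : ∃ t : ℝ, 0 < t ∧ p + t • ζ ∈ ball x₀ r := by
    have hcont : Continuous fun t : ℝ => p + t • ζ := by fun_prop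
    have h0 : (fun t : ℝ => p + t • ζ) 0 ∈ ball x₀ r := by simpa using hp
    have h1 := hcont.continuousAt.eventually (isOpen_ball.mem_nhds h0)
    obtain ⟨t, h2, h3⟩ := ((h1.filter_mono nhdsWithin_le_nhds).and
      (self_mem_nhdsWithin : Ioi (0 : ℝ) ∈ nhdsWithin 0 (Ioi 0))).exists
    exact ⟨t, h3, h2⟩
  have h5 : g (p + t • ζ) < 0 := by
    have h1 := (abs_le.1 (hg (p + t • ζ) p)).2
    rw [add_sub_cancel_left, map_smul, norm_smul, Real.norm_eq_abs, abs_of_pos ht, hgp,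
      smul_eq_mul] at h1
    nlinarith
  have h6 := hsign _ hball h5
  have h7 : l' ζ < ε' * ‖ζ‖ := by
    have h1 := (abs_le.1 (hg' (p + t • ζ) p)).1
    rw [add_sub_cancel_left, map_smul, norm_smul, Real.norm_eq_abs, abs_of_pos ht, hgp',
      smul_eq_mul] at h1
    by_contra! h2
    nlinarith
  have h8 : l' ζ = l' (z - p) + δ := by rw [hζ, map_add, map_smul, hlu, smul_eq_mul, mul_one]
  have h9 := (abs_le.1 (hg' z p)).2
  have h10 : ε' * ‖ζ‖ ≤ ε' * (‖z - p‖ + δ) := by gcongr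
  linarith

namespace IsNearlyLinearGraph

variable {e e' : Euc d} {f f' : Euc d → ℝ} {a a' : Euc d →L[ℝ] ℝ} {ε ε' Q : ℝ} {L L' : ℝ≥0}
  {x₀ : Euc d} {r : ℝ}

/-- Every point of the ball is a limit of points of the ball at lower height: move in the direction
`-e`. -/
lemma mem_closure_of_forall_lower (h : IsNearlyLinearGraph e f a ε L) {p : Euc d}
    (hp : p ∈ ball x₀ r) (P : Euc d → Prop) (hP : ∀ y ∈ ball x₀ r, heightAbove e f y < heightAbove e f p → P y) :
    p ∈ closure {y | P y} := by
  have hcont : Continuous fun t : ℝ => p + (-t) • e := by fun_prop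
  have hlim : Filter.Tendsto (fun t : ℝ => p + (-t) • e) (nhdsWithin 0 (Ioi 0)) (nhds p) := by
    have := hcont.tendsto 0
    simp only [neg_zero, zero_smul, add_zero] at this
    exact this.mono_left nhdsWithin_le_nhds
  refine mem_closure_of_tendsto hlim ?_
  filter_upwards [hlim.eventually (isOpen_ball.mem_nhds hp), self_mem_nhdsWithin] with t h1 h2
  refine hP _ h1 ?_
  rw [h.heightAbove_add_smul]
  linarith [mem_Ioi.1 h2]

/-- Two graphs that bound the same set in a ball coincide there. -/
lemma heightAbove_eq_zero_of_sign (h : IsNearlyLinearGraph e f a ε L)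
    (h' : IsNearlyLinearGraph e' f' a' ε' L')
    (hsign : ∀ y ∈ ball x₀ r, heightAbove e f y < 0 ↔ heightAbove e' f' y < 0)
    {p : Euc d} (hp : p ∈ ball x₀ r) (hp0 : heightAbove e f p = 0) : heightAbove e' f' p = 0 := by
  refine le_antisymm ?_ ?_
  · have h1 := h.mem_closure_of_forall_lower hp (fun y => heightAbove e' f' y ≤ 0)
      (fun y hy hlt => ((hsign y hy).1 (hp0 ▸ hlt)).le)
    rwa [(isClosed_le h'.continuous_heightAbove continuous_const).closure_eq] at h1
  · by_contra! h1
    exact absurd ((hsign p hp).2 h1) (by rw [hp0]; exact lt_irrefl _)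

/-- The linear form `innerSL ℝ e - a` is the derivative of `heightAbove e f`, up to an error `ε`. -/
lemma norm_innerSL_sub_le (h : IsNearlyLinearGraph e f a ε L) (hQ : 1 + ‖a‖ ≤ Q) :
    ‖innerSL ℝ e - a‖ ≤ Q := by
  refine (norm_sub_le _ _).trans ?_
  rwa [innerSL_apply_norm, h.norm_dir]

lemma eight_mul_le (h : IsNearlyLinearGraph e f a ε L) (hQ : 1 + ‖a‖ ≤ Q)
    (hε : 4096 * d * Q ^ 4 * ε ≤ 1) : 8 * d * Q * ε ≤ 1 := by
  have h1 : 1 ≤ Q := by linarith [norm_nonneg a]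
  have h2 := h.dim_pos
  have h3 := h.eps_nonneg
  have h4 : Q ≤ Q ^ 4 := le_self_pow₀ h1 (by norm_num)
  have h5 : d * ε * Q ≤ d * ε * Q ^ 4 := by gcongr
  have h6 : 0 ≤ d * ε * Q := by positivity
  nlinarith

/-- The reflection across one graph maps the upper part of the ball below the other graph, and the
lower part above it, if the two graphs bound the same set in the ball. The image of `x` may lie
outside the ball. But the height `σ` of `x` controls both the depth of the image below the first
graph and its distance to a common zero `p` of both heights in the ball, and near linearity
transports the sign along the ray from `p` to the image. -/
lemma heightAbove_graphReflection_of_sign (h : IsNearlyLinearGraph e f a ε L)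
    (h' : IsNearlyLinearGraph e' f' a' ε' L') (hQ : 1 + ‖a‖ ≤ Q)
    (hε : 4096 * d * Q ^ 4 * ε ≤ 1) (hε' : 4096 * d * Q ^ 4 * ε' ≤ 1)
    (hsign : ∀ y ∈ ball x₀ r, heightAbove e f y < 0 ↔ heightAbove e' f' y < 0)
    (hx₀ : heightAbove e f x₀ = 0) {x : Euc d} (hx : x ∈ ball x₀ r) :
    (0 < heightAbove e f x → heightAbove e' f' (graphReflection e f x) < 0) ∧
      (heightAbove e f x < 0 → 0 < heightAbove e' f' (graphReflection e f x)) := by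
  have hr : 0 < r := dist_nonneg.trans_lt (mem_ball.1 hx)
  have h8 := h.eight_mul_le hQ hε
  have hQ1 : 1 ≤ Q := by linarith [norm_nonneg a]
  have hQ0 : 0 < Q := by linarith
  have hd := h.dim_pos
  have hε0 := h.eps_nonneg
  have hε0' := h'.eps_nonneg
  have hsmall : ∀ η : ℝ, 0 ≤ η → 4096 * d * Q ^ 4 * η ≤ 1 → η ≤ 1 / (4096 * Q ^ 4) := by
    intro η h1 h2
    rw [le_div_iff₀ (by positivity)]
    have : Q ^ 4 * η ≤ d * (Q ^ 4 * η) := le_mul_of_one_le_left (by positivity) hd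
    linarith
  have hs := hsmall ε hε0 hε
  have hs' := hsmall ε' hε0' hε'
  have hε16 : ε ≤ 1 / 16 := hs.trans (by
    apply one_div_le_one_div_of_le (by norm_num)
    nlinarith [one_le_pow₀ hQ1 (n := 4)])
  have hzero' : ∀ p ∈ ball x₀ r, heightAbove e f p = 0 → heightAbove e' f' p = 0 :=
    fun p hp => h.heightAbove_eq_zero_of_sign h' hsign hp
  have hzero : ∀ p ∈ ball x₀ r, heightAbove e' f' p = 0 → heightAbove e f p = 0 :=
    fun p hp => h'.heightAbove_eq_zero_of_sign h (fun y hy => (hsign y hy).symm) hp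
  have hl' : (innerSL ℝ e' - a') e' = 1 := by
    rw [sub_apply, innerSL_apply_apply, h'.inner_dir_self, h'.slope_dir, sub_zero]
  have hl := h.norm_innerSL_sub_le hQ
  -- The constants: the reflected point has height at most `-σ / (4 Q²)`, and its distance to the
  -- nearby zero is at most `32 Q σ`. The point is first raised by `σ / (16 Q³)`, which leaves room for
  -- the errors of both graphs; this requires `ε` and `ε'` to be small compared with `Q⁻⁴`.
  have harith : ∀ σ n m : ℝ, 0 < σ → 0 ≤ n → n ≤ 4 * Q * (8 * σ) → m ≤ -(σ / (4 * Q ^ 2)) →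
      m + 2 * ε * n + σ / (16 * Q ^ 3) * (‖innerSL ℝ e - a‖ + ε) < 0 ∧
      2 * ε' * n + ε' * (σ / (16 * Q ^ 3)) < σ / (16 * Q ^ 3) := by
    intro σ n m hσ hn hn2 hm
    have e1 : ∀ η : ℝ, 0 ≤ η → η ≤ 1 / (4096 * Q ^ 4) → 2 * η * n ≤ σ / (64 * Q ^ 3) := by
      intro η h1 h2
      calc 2 * η * n ≤ 2 * (1 / (4096 * Q ^ 4)) * (4 * Q * (8 * σ)) := by gcongr
        _ = σ / (64 * Q ^ 3) := by field_simp; norm_num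
    have e2 : σ / (64 * Q ^ 3) ≤ σ / (64 * Q ^ 2) := by
      have : Q ^ 2 ≤ Q ^ 3 := pow_le_pow_right₀ hQ1 (by norm_num)
      gcongr
    have e3 : σ / (16 * Q ^ 3) * (‖innerSL ℝ e - a‖ + ε) ≤ σ / (8 * Q ^ 2) := by
      calc _ ≤ σ / (16 * Q ^ 3) * (Q + Q) := by gcongr; linarith
        _ = σ / (8 * Q ^ 2) := by field_simp; norm_num
    have hpos2 : 0 < σ / Q ^ 2 := by positivity
    have hpos3 : 0 < σ / Q ^ 3 := by positivity
    have f1 : σ / (64 * Q ^ 2) = σ / Q ^ 2 / 64 := by field_simp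
    have f2 : σ / (8 * Q ^ 2) = σ / Q ^ 2 / 8 := by field_simp
    have f3 : σ / (4 * Q ^ 2) = σ / Q ^ 2 / 4 := by field_simp
    have f4 : σ / (64 * Q ^ 3) = σ / Q ^ 3 / 64 := by field_simp
    have f5 : σ / (16 * Q ^ 3) = σ / Q ^ 3 / 16 := by field_simp
    refine ⟨by linarith [e1 ε hε0 hs], ?_⟩
    have e4 : ε' * (σ / (16 * Q ^ 3)) ≤ 1 / 16 * (σ / (16 * Q ^ 3)) := by
      gcongr
      exact hs'.trans (one_div_le_one_div_of_le (by norm_num)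
        (by nlinarith [one_le_pow₀ hQ1 (n := 4)]))
    linarith [e1 ε' hε0' hs']
  have hn : ∀ p, heightAbove e f p = 0 → ∀ σ, ‖x - p‖ ≤ 8 * σ →
      ‖graphReflection e f x - p‖ ≤ 4 * Q * (8 * σ) := by
    intro p hp σ hσ
    have := h.dist_graphReflection_le hQ h8 x p
    rw [h.graphReflection_eq_self hQ h8 hp, dist_eq_norm, dist_eq_norm] at this
    exact this.trans (by gcongr)
  have hqball : ∀ t : ℝ, |t| = r / 2 → x₀ + t • e ∈ ball x₀ r := by
    intro t ht
    rw [mem_ball, dist_eq_norm, add_sub_cancel_left, norm_smul, h.norm_dir, mul_one,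
      Real.norm_eq_abs, ht]
    linarith
  constructor
  · intro hpos
    obtain ⟨p, hp, hp0, hxp⟩ := exists_zero_near (l := innerSL ℝ e - a) (q := x₀ + (-(r / 2)) • e)
      hε16 (fun x y => by simpa using h.abs_heightAbove_sub_le x y) h.continuous_heightAbove hx
      (hqball _ (by rw [abs_neg, abs_of_pos (by linarith)]))
      (by rw [h.heightAbove_add_smul, hx₀, zero_add]) hpos
    obtain ⟨h1, h2⟩ := harith _ _ _ hpos (norm_nonneg _) (hn p hp0 _ hxp)
      (h.heightAbove_graphReflection_le hQ h8 hpos)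
    exact neg_of_neg_in_ball (l := innerSL ℝ e - a) (l' := innerSL ℝ e' - a') (u := e')
      (fun x y => by simpa using h.abs_heightAbove_sub_le x y)
      (fun x y => by simpa using h'.abs_heightAbove_sub_le x y) hε0 hε0' hp0 (hzero' p hp hp0)
      h'.norm_dir hl' hp (fun y hy => (hsign y hy).1) (by positivity) h1 h2
  · intro hneg
    have hg : ∀ x y, |-heightAbove e f x - -heightAbove e f y - (-(innerSL ℝ e - a)) (x - y)| ≤
        ε * ‖x - y‖ := by
      intro x y
      convert h.abs_heightAbove_sub_le x y using 1
      rw [← abs_neg]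
      congr 1
      simp only [neg_apply, sub_apply, innerSL_apply_apply]
      ring
    have hg' : ∀ x y, |-heightAbove e' f' x - -heightAbove e' f' y -
        (-(innerSL ℝ e' - a')) (x - y)| ≤ ε' * ‖x - y‖ := by
      intro x y
      convert h'.abs_heightAbove_sub_le x y using 1
      rw [← abs_neg]
      congr 1
      simp only [neg_apply, sub_apply, innerSL_apply_apply]
      ring
    obtain ⟨p, hp, hp0, hxp⟩ := exists_zero_near (g := fun x => -heightAbove e f x)
      (q := x₀ + (r / 2) • e) hε16 hg h.continuous_heightAbove.neg hx
      (hqball _ (abs_of_pos (by linarith)))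
      (by rw [h.heightAbove_add_smul, hx₀, zero_add]) (neg_pos.2 hneg)
    have hp0' := neg_eq_zero.1 hp0
    have hle := h.le_heightAbove_graphReflection hQ h8 hneg
    obtain ⟨h1, h2⟩ := harith (-heightAbove e f x) _ (-heightAbove e f (graphReflection e f x))
      (neg_pos.2 hneg) (norm_nonneg _) (hn p hp0' _ hxp) (by rw [neg_div, neg_neg] at *; linarith)
    refine neg_neg_iff_pos.1 (neg_of_neg_in_ball (u := -e') hg hg' hε0 hε0' hp0 ?_
      (by rw [norm_neg, h'.norm_dir]) ?_ hp ?_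
      (div_pos (neg_pos.2 hneg) (by positivity)) (by rw [norm_neg]; exact h1) h2)
    · simpa using hzero' p hp hp0'
    · rw [neg_apply, map_neg, neg_neg, hl']
    · intro y hy hlt
      have h3 : 0 < heightAbove e f y := neg_neg_iff_pos.1 hlt
      refine neg_neg_iff_pos.2 (lt_of_le_of_ne ?_ fun h4 => ?_)
      · by_contra! h5
        exact absurd ((hsign y hy).2 h5) (not_lt.2 h3.le)
      · exact h3.ne' (hzero y hy h4.symm)

end IsNearlyLinearGraph
end Comparison

/-! ### Integration along lines, and test functions -/

section Lines

lemma integral_eq_zero_of_hasDerivAt_off_countable {u u' : ℝ → ℝ} {s : Set ℝ} {R : ℝ}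
    (hu : Continuous u) (hR : ∀ t, R < |t| → u t = 0) (hs : s.Countable)
    (hd : ∀ t ∉ s, HasDerivAt u (u' t) t) (hi : Integrable u') : ∫ t, u' t = 0 := by
  have h1 := intervalIntegral_tendsto_integral (μ := volume) hi
    (Filter.tendsto_neg_atTop_atBot) (Filter.tendsto_id (α := ℝ) (x := Filter.atTop))
  refine tendsto_nhds_unique h1 (Filter.Tendsto.congr' ?_ tendsto_const_nhds)
  filter_upwards [Filter.eventually_gt_atTop R, Filter.eventually_ge_atTop 0] with T hT hT0
  rw [integral_eq_of_hasDerivAt_off_countable u u' hs hu.continuousOn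
    (fun t ht => hd t ht.2) hi.intervalIntegrable, id,
    hR T (by rwa [abs_of_nonneg hT0]), hR (-T) (by rwa [abs_neg, abs_of_nonneg hT0]), sub_zero]

lemma integral_prod_eq_zero_of_hasLineDerivAt {V : Type*} [NormedAddCommGroup V] [NormedSpace ℝ V]
    [MeasurableSpace V] {ν : Measure V} [SFinite ν] {f f' : V × ℝ → ℝ} {S : Set (V × ℝ)}
    (hf : Continuous f) (hc : HasCompactSupport f)
    (hS : ∀ x, {t : ℝ | (x, t) ∈ S}.Countable)
    (hd : ∀ x ∉ S, HasLineDerivAt ℝ f (f' x) x (0, 1)) (hi : Integrable f' (ν.prod volume)) :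
    ∫ x, f' x ∂(ν.prod volume) = 0 := by
  obtain ⟨R, hR⟩ := hc.isCompact.isBounded.exists_norm_le
  rw [integral_prod _ hi]
  refine integral_eq_zero_of_ae ?_
  filter_upwards [hi.prod_right_ae] with x hx
  refine integral_eq_zero_of_hasDerivAt_off_countable (u := fun t => f (x, t)) (R := R)
    (by fun_prop) (fun t ht => ?_) (hS x) (fun t ht => ?_) hx
  · by_contra h0
    have h1 := hR (x, t) (subset_tsupport f h0)
    exact absurd ((norm_snd_le (x, t)).trans h1) (not_le.2 (by simpa using ht))
  · convert! (hd (x, t) ht).scomp_of_eq t ((hasDerivAt_id t).add (hasDerivAt_const t (-t)))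
      (by simp) <;> simp

/-- The integral of a line derivative of a continuous function with compact support vanishes, even
if the derivative is missing at countably many points of each line. -/
lemma integral_eq_zero_of_hasLineDerivAt_off {d : ℕ} {f f' : Euc d → ℝ} {S : Set (Euc d)}
    {w : Euc d} (hw : w ≠ 0) (hf : Continuous f) (hc : HasCompactSupport f)
    (hS : ∀ x, {t : ℝ | x + t • w ∈ S}.Countable)
    (hd : ∀ x ∉ S, HasLineDerivAt ℝ f (f' x) x w) (hi : Integrable f') : ∫ x, f' x = 0 := by
  have : Nontrivial (Euc d) := ⟨w, 0, hw⟩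
  -- In linear coordinates in which `w` is the last coordinate vector, Fubini's theorem reduces the
  -- claim to lines. Lebesgue measure changes by a constant factor only.
  let n := Module.finrank ℝ (Euc d)
  let V := Fin (n - 1) → ℝ
  obtain ⟨T, hT⟩ : ∃ T : Euc d ≃L[ℝ] (V × ℝ), T w = (0, 1) := by
    have hfin : Module.finrank ℝ (V × ℝ) = n := by
      rw [Module.finrank_prod, Module.finrank_fin_fun, Module.finrank_self]
      exact Nat.sub_add_cancel Module.finrank_pos
    have T₀ : Euc d ≃L[ℝ] (V × ℝ) := (ContinuousLinearEquiv.ofFinrankEq hfin).symm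
    obtain ⟨M, hM⟩ : ∃ M : (V × ℝ) ≃L[ℝ] (V × ℝ), M (T₀ w) = (0, 1) := by
      apply SeparatingDual.exists_continuousLinearEquiv_apply_eq
      · simpa using hw
      · simp
    exact ⟨T₀.trans M, by simp [hM]⟩
  have hT' : T.symm (0, 1) = w := by rw [← hT, T.symm_apply_apply]
  let μ : Measure (V × ℝ) := Measure.map T volume
  let ν : Measure (V × ℝ) := (volume : Measure V).prod volume
  have T_emb : MeasurableEmbedding T := T.toHomeomorph.measurableEmbedding
  have hμ : ν =
      (Measure.addHaarScalarFactor ν μ) • μ :=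
    Measure.isAddLeftInvariant_eq_smul _ _
  have hμ' : μ = (Measure.addHaarScalarFactor μ ν) • ν :=
    Measure.isAddLeftInvariant_eq_smul _ _
  have hint : Integrable (fun y => f' (T.symm y)) ν := by
    rw [hμ]
    refine Integrable.smul_measure_nnreal ?_
    simpa [μ, T_emb.integrable_map_iff, Function.comp_def] using hi
  have hzero : ∫ y, f' (T.symm y) ∂ν = 0 := by
    refine integral_prod_eq_zero_of_hasLineDerivAt (f := fun y => f (T.symm y))
      (S := T.symm ⁻¹' S) (hf.comp T.symm.continuous)
      (hc.comp_homeomorph T.symm.toHomeomorph) (fun x => ?_) (fun y hy => ?_) hint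
    · refine (hS (T.symm (x, 0))).mono fun t ht => ?_
      have h1 : T.symm (x, t) = T.symm (x, 0) + t • w := by
        rw [← hT', ← map_smul, ← map_add]; simp
      rwa [mem_ofPred_eq, ← h1]
    · have h2 := hd (T.symm y) hy
      unfold HasLineDerivAt at h2 ⊢
      convert h2 using 3 with t
      rw [map_add, map_smul, hT']
  have h3 : ∫ x, f' x = ∫ y, f' (T.symm y) ∂μ := by
    simp [μ, T_emb.integral_map]
  rw [h3, hμ', integral_smul_nnreal_measure, hzero, smul_zero]

end Lines

section TestFunctions

variable {d : ℕ}

/-- A `C^1` function with compact support is a limit of smooth functions with supports in a fixed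
ball, with uniform convergence of the derivatives. -/
lemma exists_smooth_approx {ψ : Euc d → ℝ} (hψ : ContDiff ℝ 1 ψ) (hc : HasCompactSupport ψ) :
    ∃ R : ℝ, (∀ x ∉ ball (0 : Euc d) R, fderiv ℝ ψ x = 0) ∧ ∀ η > 0, ∃ u : Euc d → ℝ,
      ContDiff ℝ ∞ u ∧ HasCompactSupport u ∧ (∀ x ∉ ball (0 : Euc d) R, fderiv ℝ u x = 0) ∧
      ∀ x, ‖fderiv ℝ u x - fderiv ℝ ψ x‖ ≤ η := by
  obtain ⟨R₀, hR₀⟩ := hc.isCompact.isBounded.exists_norm_le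
  have hdc : Continuous (fderiv ℝ ψ) := hψ.continuous_fderiv one_ne_zero
  have hduc : UniformContinuous (fderiv ℝ ψ) :=
    (hc.fderiv (𝕜 := ℝ)).uniformContinuous_of_continuous hdc
  have hout : ∀ x, R₀ < ‖x‖ → fderiv ℝ ψ x = 0 := by
    intro x hx
    by_contra h0
    exact absurd (hR₀ x (tsupport_fderiv_subset ℝ (subset_tsupport _ h0))) (not_le.2 hx)
  refine ⟨R₀ + 2, fun x hx => hout x ?_, fun η hη => ?_⟩
  · rw [mem_ball_zero_iff, not_lt] at hx; linarith
  · obtain ⟨δ, hδ, hδ'⟩ := Metric.uniformContinuous_iff.1 hduc η hη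
    set ρ := min δ 1 with hρ
    have hρ0 : 0 < ρ := lt_min hδ one_pos
    let φ : ContDiffBump (0 : Euc d) := ⟨ρ / 2, ρ, by linarith, by linarith⟩
    have hint : LocallyIntegrable (φ.normed volume) volume :=
      φ.continuous_normed.locallyIntegrable
    set u : Euc d → ℝ := convolution (φ.normed volume) ψ (ContinuousLinearMap.lsmul ℝ ℝ) volume
      with hu
    have hder : ∀ x, HasFDerivAt u (convolution (φ.normed volume) (fderiv ℝ ψ)
        (ContinuousLinearMap.lsmul ℝ ℝ) volume x) x := by
      intro x
      have := hc.hasFDerivAt_convolution_right (ContinuousLinearMap.lsmul ℝ ℝ) hint hψ x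
      refine this.congr_fderiv (integral_congr_ae (Filter.Eventually.of_forall fun t => ?_))
      ext v
      simp [ContinuousLinearMap.precompR_apply]
    have hcs : HasCompactSupport u :=
      φ.hasCompactSupport_normed.convolution _ hc
    refine ⟨u, ?_, hcs, fun x hx => ?_, fun x => ?_⟩
    · exact φ.hasCompactSupport_normed.contDiff_convolution_left _ φ.contDiff_normed
        (hψ.continuous.locallyIntegrable)
    · rw [(hder x).fderiv]
      have h0 : fderiv ℝ ψ x = 0 := hout x (by rw [mem_ball_zero_iff, not_lt] at hx; linarith)
      rw [φ.normed_convolution_eq_right (fun y hy => ?_), h0]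
      rw [h0]
      refine hout y ?_
      rw [mem_ball_zero_iff, not_lt] at hx
      have h1 : dist y x < ρ := hy
      have h2 := norm_sub_norm_le x y
      rw [← dist_eq_norm, dist_comm] at h2
      have h3 : ρ ≤ 1 := min_le_right _ _
      linarith
    · rw [(hder x).fderiv, ← dist_eq_norm]
      refine φ.dist_normed_convolution_le hdc.aestronglyMeasurable fun y hy => ?_
      exact (hδ' (lt_of_lt_of_le hy (min_le_left _ _))).le

namespace IsNeumannHarmonic

variable {Ω : Set (Euc d)} {h : Euc d → ℝ}

lemma contDiffAt (hh : IsNeumannHarmonic Ω h) {x : Euc d} (hx : x ∈ Ω) : ContDiffAt ℝ 2 h x :=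
  (hh.harmonic x hx).1

lemma continuousOn_gradient (hh : IsNeumannHarmonic Ω h) : ContinuousOn (∇ h) Ω := by
  intro x hx
  have h1 : ContinuousAt (fderiv ℝ h) x :=
    (((hh.contDiffAt hx).fderiv_right (m := 1) (by norm_num)).continuousAt)
  exact ((InnerProductSpace.toDual ℝ (Euc d)).symm.continuous.continuousAt.comp
    h1).continuousWithinAt

lemma aestronglyMeasurable_gradient (hh : IsNeumannHarmonic Ω h) (hΩ : IsOpen Ω) :
    AEStronglyMeasurable (∇ h) (volume.restrict Ω) :=
  hh.continuousOn_gradient.aestronglyMeasurable hΩ.measurableSet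

lemma memLp_gradient (hh : IsNeumannHarmonic Ω h) (hΩ : IsOpen Ω) (R : ℝ) :
    MemLp (∇ h) 2 (volume.restrict (Ω ∩ ball 0 R)) :=
  (memLp_two_iff_integrable_sq_norm ((hh.aestronglyMeasurable_gradient hΩ).mono_measure
    (Measure.restrict_mono inter_subset_left le_rfl))).2 (hh.energy R)

lemma integrableOn_gradient (hh : IsNeumannHarmonic Ω h) (hΩ : IsOpen Ω) (R : ℝ) :
    IntegrableOn (∇ h) (Ω ∩ ball 0 R) := by
  have : IsFiniteMeasure (volume.restrict (Ω ∩ ball (0 : Euc d) R)) :=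
    ⟨by
      rw [Measure.restrict_apply_univ]
      exact (measure_mono inter_subset_right).trans_lt measure_ball_lt_top⟩
  exact (hh.memLp_gradient hΩ R).integrable (by norm_num)

lemma integrableOn_inner_gradient (hh : IsNeumannHarmonic Ω h) (hΩ : IsOpen Ω) {R : ℝ}
    {X : Euc d → Euc d} (hX : Continuous X) (hXc : HasCompactSupport X)
    (hR : ∀ x ∉ ball (0 : Euc d) R, X x = 0) :
    IntegrableOn (fun x => inner ℝ (∇ h x) (X x)) Ω := by
  obtain ⟨C, hC⟩ := hXc.exists_bound_of_continuous hX
  have hm : AEStronglyMeasurable (fun x => inner ℝ (∇ h x) (X x)) (volume.restrict Ω) :=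
    (hh.aestronglyMeasurable_gradient hΩ).inner hX.aestronglyMeasurable
  have h1 : IntegrableOn (fun x => inner ℝ (∇ h x) (X x)) (Ω ∩ ball 0 R) := by
    refine Integrable.mono' ((hh.integrableOn_gradient hΩ R).norm.mul_const C)
      (hm.mono_measure (Measure.restrict_mono inter_subset_left le_rfl)) ?_
    refine Filter.Eventually.of_forall fun x => ?_
    refine (norm_inner_le_norm _ _).trans ?_
    gcongr
    exact hC x
  refine h1.of_forall_sdiff_eq_zero hΩ.measurableSet fun x hx => ?_
  rw [hR x fun hxR => hx.2 ⟨hx.1, hxR⟩, inner_zero_right]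

/-- The weak Neumann condition holds for test functions that are only `C^1`. -/
lemma integral_inner_gradient_eq_zero (hh : IsNeumannHarmonic Ω h) (hΩ : IsOpen Ω)
    {ψ : Euc d → ℝ} (hψ : ContDiff ℝ 1 ψ) (hc : HasCompactSupport ψ) :
    ∫ x in Ω, inner ℝ (∇ h x) (∇ ψ x) = 0 := by
  obtain ⟨R, hψR, happ⟩ := exists_smooth_approx hψ hc
  have hgrad : ∀ {u : Euc d → ℝ}, ContDiff ℝ 1 u → Continuous (∇ u) := fun hu =>
    (InnerProductSpace.toDual ℝ (Euc d)).symm.continuous.comp (hu.continuous_fderiv one_ne_zero)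
  have hgradc : ∀ {u : Euc d → ℝ}, HasCompactSupport u → HasCompactSupport (∇ u) := fun hu =>
    (hu.fderiv (𝕜 := ℝ)).comp_left (map_zero _)
  have hgrad0 : ∀ {u : Euc d → ℝ} {x}, fderiv ℝ u x = 0 → ∇ u x = 0 := fun hu => by
    rw [gradient, hu, map_zero]
  set I := ∫ x in Ω ∩ ball (0 : Euc d) R, ‖∇ h x‖ with hI
  have hI0 : 0 ≤ I := integral_nonneg fun x => norm_nonneg _
  have key : ∀ η > 0, |∫ x in Ω, inner ℝ (∇ h x) (∇ ψ x)| ≤ I * η := by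
    intro η hη
    obtain ⟨u, hu, huc, huR, hclose⟩ := happ η hη
    have hu1 : ContDiff ℝ 1 u := hu.of_le (by exact_mod_cast le_top)
    have h1 := hh.integrableOn_inner_gradient hΩ (hgrad hψ) (hgradc hc) (R := R)
      fun x hx => hgrad0 (hψR x hx)
    have h2 := hh.integrableOn_inner_gradient hΩ (hgrad hu1) (hgradc huc) (R := R)
      fun x hx => hgrad0 (huR x hx)
    have h3 : ∫ x in Ω, inner ℝ (∇ h x) (∇ ψ x) =
        ∫ x in Ω, inner ℝ (∇ h x) (∇ ψ x - ∇ u x) := by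
      simp_rw [inner_sub_right]
      rw [integral_sub h1 h2, hh.neumann u hu huc, sub_zero]
    have h4 : ∫ x in Ω, inner ℝ (∇ h x) (∇ ψ x - ∇ u x) =
        ∫ x in Ω ∩ ball (0 : Euc d) R, inner ℝ (∇ h x) (∇ ψ x - ∇ u x) := by
      refine (setIntegral_eq_of_subset_of_forall_sdiff_eq_zero hΩ.measurableSet
        inter_subset_left fun x hx => ?_)
      have hx' : x ∉ ball (0 : Euc d) R := fun hxR => hx.2 ⟨hx.1, hxR⟩
      rw [hgrad0 (hψR x hx'), hgrad0 (huR x hx'), sub_zero, inner_zero_right]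
    rw [h3, h4, ← Real.norm_eq_abs, hI, ← integral_mul_const]
    refine norm_integral_le_of_norm_le ((hh.integrableOn_gradient hΩ R).norm.mul_const η) ?_
    refine Filter.Eventually.of_forall fun x => (norm_inner_le_norm _ _).trans ?_
    gcongr
    rw [gradient, gradient, ← map_sub, LinearIsometryEquiv.norm_map, norm_sub_rev]
    exact hclose x
  by_contra h0
  have hpos := abs_pos.2 h0
  have h5 := key (|∫ x in Ω, inner ℝ (∇ h x) (∇ ψ x)| / (2 * (I + 1))) (by positivity)
  rw [mul_div_assoc', le_div_iff₀ (by positivity)] at h5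
  nlinarith

end IsNeumannHarmonic
end TestFunctions

/-! ### The coefficients of the reflected equation -/

/-- The matrix of a linear map in the standard basis. -/
noncomputable def opMatrix {d : ℕ} (T : Euc d →L[ℝ] Euc d) : Matrix (Fin d) (Fin d) ℝ :=
  Matrix.of fun i k => T (EuclideanSpace.basisFun (Fin d) ℝ k) i

/-- A continuously differentiable involution `Ψ` with Lipschitz derivative that fixes the zero set
of `ρ` and whose derivative is an isometry there: a model of the reflection across that set. -/
structure IsSmoothReflection {d : ℕ} (ρ : Euc d → ℝ) (Ψ : Euc d → Euc d) (K L : ℝ≥0) : Prop where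
  continuous : Continuous ρ
  involutive : Function.Involutive Ψ
  lipschitz : LipschitzWith K Ψ
  differentiable : Differentiable ℝ Ψ
  lipschitz_fderiv : LipschitzWith L (fderiv ℝ Ψ)
  fixed : ∀ x, ρ x = 0 → Ψ x = x
  isometry : ∀ x, ρ x = 0 → ∀ v, ‖fderiv ℝ Ψ x v‖ = ‖v‖

/-- The coefficients of the equation for `h ∘ Ψ` when `h` is harmonic: with `D` the derivative of
`Ψ`, they are `|det D| D⁻¹ D⁻ᵀ`, where the inverse of `D` at `x` is the derivative of `Ψ` at
`Ψ x`, as `Ψ` is an involution. -/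
noncomputable def transformedCoeff {d : ℕ} (Ψ : Euc d → Euc d) : MatField d := fun x =>
  |(fderiv ℝ Ψ x).det| • (opMatrix (fderiv ℝ Ψ (Ψ x)) * (opMatrix (fderiv ℝ Ψ (Ψ x)))ᵀ)

open Classical in
/-- The identity where `ρ < 0`, and the coefficients of the reflected equation elsewhere. -/
noncomputable def reflectedCoeff {d : ℕ} (ρ : Euc d → ℝ) (Ψ : Euc d → Euc d) : MatField d :=
  fun x => if ρ x < 0 then 1 else transformedCoeff Ψ x

section Matrices

variable {d : ℕ}

lemma opMatrix_apply (T : Euc d →L[ℝ] Euc d) (i k : Fin d) :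
    opMatrix T i k = T (EuclideanSpace.basisFun (Fin d) ℝ k) i := rfl

lemma opMatrix_eq_toMatrix (T : Euc d →L[ℝ] Euc d) :
    opMatrix T = LinearMap.toMatrix (EuclideanSpace.basisFun (Fin d) ℝ).toBasis
      (EuclideanSpace.basisFun (Fin d) ℝ).toBasis (T : Euc d →ₗ[ℝ] Euc d) := by
  ext i k
  simp [opMatrix_apply, LinearMap.toMatrix_apply]

lemma det_opMatrix (T : Euc d →L[ℝ] Euc d) : (opMatrix T).det = T.det := by
  rw [opMatrix_eq_toMatrix, LinearMap.det_toMatrix]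

lemma opMatrix_mul (S T : Euc d →L[ℝ] Euc d) : opMatrix S * opMatrix T = opMatrix (S.comp T) := by
  rw [opMatrix_eq_toMatrix, opMatrix_eq_toMatrix, opMatrix_eq_toMatrix,
    ← LinearMap.toMatrix_comp]
  rfl

lemma opMatrix_id : opMatrix (ContinuousLinearMap.id ℝ (Euc d)) = 1 := by
  rw [opMatrix_eq_toMatrix]
  exact LinearMap.toMatrix_id _

lemma inner_basisFun (v : Euc d) (i : Fin d) :
    inner ℝ (EuclideanSpace.basisFun (Fin d) ℝ i) v = v i := by
  rw [EuclideanSpace.basisFun_apply, EuclideanSpace.inner_single_left]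
  simp

lemma opMatrix_transpose_mulVec (T : Euc d →L[ℝ] Euc d) (ξ : Fin d → ℝ) :
    (opMatrix T)ᵀ *ᵥ ξ = (ContinuousLinearMap.adjoint T (WithLp.toLp 2 ξ)).ofLp := by
  ext k
  rw [← inner_basisFun, ContinuousLinearMap.adjoint_inner_right, PiLp.inner_apply]
  simp [Matrix.mulVec, dotProduct, opMatrix_apply, mul_comm]

lemma opMatrix_adjoint (T : Euc d →L[ℝ] Euc d) :
    opMatrix (ContinuousLinearMap.adjoint T) = (opMatrix T)ᵀ := by
  ext i k
  rw [opMatrix_apply, ← inner_basisFun, ContinuousLinearMap.adjoint_inner_right, real_inner_comm,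
    inner_basisFun]
  rfl

lemma dotProduct_self_ofLp (v : Euc d) : v.ofLp ⬝ᵥ v.ofLp = ‖v‖ ^ 2 := by
  rw [← real_inner_self_eq_norm_sq, PiLp.inner_apply]
  simp [dotProduct, sq]

lemma dotProduct_transpose_mulVec_le {T : Euc d →L[ℝ] Euc d} {K : ℝ} (hT : ‖T‖ ≤ K)
    (ξ : Fin d → ℝ) :
    ((opMatrix T)ᵀ *ᵥ ξ) ⬝ᵥ ((opMatrix T)ᵀ *ᵥ ξ) ≤ K ^ 2 * (ξ ⬝ᵥ ξ) := by
  rw [opMatrix_transpose_mulVec, dotProduct_self_ofLp,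
    show ξ = (WithLp.toLp 2 ξ : Euc d).ofLp from rfl, dotProduct_self_ofLp, ← mul_pow]
  gcongr
  refine (ContinuousLinearMap.adjoint T).le_of_opNorm_le ?_ _
  rwa [LinearIsometryEquiv.norm_map]

lemma opMatrix_mul_transpose_of_isometry {T : Euc d →L[ℝ] Euc d} (hT : ∀ v, ‖T v‖ = ‖v‖) :
    opMatrix T * (opMatrix T)ᵀ = 1 := by
  rw [mul_eq_one_comm, ← opMatrix_adjoint, opMatrix_mul,
    (ContinuousLinearMap.norm_map_iff_adjoint_comp_self T).1 hT]
  exact opMatrix_id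

lemma abs_opMatrix_le (T : Euc d →L[ℝ] Euc d) (i k : Fin d) : |opMatrix T i k| ≤ ‖T‖ := by
  rw [opMatrix_apply, ← Real.norm_eq_abs]
  refine (PiLp.norm_apply_le _ i).trans ?_
  simpa using T.le_opNorm (EuclideanSpace.basisFun (Fin d) ℝ k)

lemma abs_opMatrix_sub_le (S T : Euc d →L[ℝ] Euc d) (i k : Fin d) :
    |opMatrix S i k - opMatrix T i k| ≤ ‖S - T‖ := by
  have := abs_opMatrix_le (S - T) i k
  simpa [opMatrix_apply] using this

/-- The determinant is bounded and Lipschitz on bounded sets. -/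
lemma exists_det_bound (d : ℕ) (K : ℝ) : ∃ C : ℝ, 1 ≤ C ∧ ∀ S T : Euc d →L[ℝ] Euc d,
    ‖S‖ ≤ K → ‖T‖ ≤ K → |S.det| ≤ C ∧ |S.det - T.det| ≤ C * ‖S - T‖ := by
  have hcd : ContDiff ℝ 1 fun T : Euc d →L[ℝ] Euc d => T.det := by
    have h1 : (fun T : Euc d →L[ℝ] Euc d => T.det) = fun T =>
        ∑ σ : Equiv.Perm (Fin d), (Equiv.Perm.sign σ : ℤ) •
          ∏ i, T (EuclideanSpace.basisFun (Fin d) ℝ i) (σ i) := by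
      ext T
      rw [← det_opMatrix, Matrix.det_apply]
      rfl
    rw [h1]
    refine ContDiff.sum fun σ _ => ContDiff.const_smul _ (contDiff_prod fun i _ => ?_)
    have h2 : ContDiff ℝ 1 fun T : Euc d →L[ℝ] Euc d => T (EuclideanSpace.basisFun (Fin d) ℝ i) :=
      contDiff_id.clm_apply contDiff_const
    exact contDiff_euclidean.1 h2 (σ i)
  have hcomp : IsCompact (closedBall (0 : Euc d →L[ℝ] Euc d) K) := isCompact_closedBall _ _
  obtain ⟨C₁, hC₁⟩ := hcomp.exists_bound_of_continuousOn hcd.continuous.continuousOn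
  obtain ⟨C₂, hC₂⟩ := hcomp.exists_bound_of_continuousOn
    (hcd.continuous_fderiv one_ne_zero).continuousOn
  refine ⟨max 1 (max C₁ C₂), le_max_left _ _, fun S T hS hT => ⟨?_, ?_⟩⟩
  · exact (hC₁ S (mem_closedBall_zero_iff.2 hS)).trans ((le_max_left _ _).trans (le_max_right _ _))
  · have := (convex_closedBall (0 : Euc d →L[ℝ] Euc d) K).norm_image_sub_le_of_norm_fderiv_le
      (𝕜 := ℝ) (fun x _ => hcd.differentiable one_ne_zero x) hC₂ (mem_closedBall_zero_iff.2 hT)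
      (mem_closedBall_zero_iff.2 hS)
    refine this.trans ?_
    gcongr
    exact (le_max_right _ _).trans (le_max_right _ _)

end Matrices

/-- A segment between the two sides of the zero set of `ρ` meets the zero set. -/
lemma exists_zero_between {d : ℕ} {ρ : Euc d → ℝ} (hρ : Continuous ρ) {x y : Euc d} (hx : ρ x ≤ 0)
    (hy : 0 ≤ ρ y) : ∃ p, ρ p = 0 ∧ dist x p + dist p y = dist x y := by
  have hcont : ContinuousOn (fun t : ℝ => ρ (x + t • (y - x))) (Icc 0 1) := by fun_prop
  have hivt := intermediate_value_Icc zero_le_one hcont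
  simp only [zero_smul, add_zero, one_smul, add_sub_cancel] at hivt
  obtain ⟨t, ⟨ht0, ht1⟩, ht⟩ := hivt ⟨hx, hy⟩
  refine ⟨x + t • (y - x), ht, ?_⟩
  rw [dist_eq_norm, dist_eq_norm, dist_eq_norm,
    show x - (x + t • (y - x)) = t • (x - y) by module,
    show x + t • (y - x) - y = (1 - t) • (x - y) by module, norm_smul, norm_smul,
    Real.norm_eq_abs, Real.norm_eq_abs, abs_of_nonneg ht0, abs_of_nonneg (by linarith)]
  ring

section Coefficients

variable {d : ℕ} {ρ : Euc d → ℝ} {Ψ : Euc d → Euc d} {K L : ℝ≥0}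

lemma dotProduct_transformedCoeff (Ψ : Euc d → Euc d) (x : Euc d) (ξ η : Fin d → ℝ) :
    ξ ⬝ᵥ (transformedCoeff Ψ x *ᵥ η) = |(fderiv ℝ Ψ x).det| *
      (((opMatrix (fderiv ℝ Ψ (Ψ x)))ᵀ *ᵥ ξ) ⬝ᵥ ((opMatrix (fderiv ℝ Ψ (Ψ x)))ᵀ *ᵥ η)) := by
  rw [transformedCoeff, Matrix.smul_mulVec, dotProduct_smul, smul_eq_mul, ← Matrix.mulVec_mulVec,
    Matrix.dotProduct_mulVec, ← Matrix.mulVec_transpose]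

namespace IsSmoothReflection

lemma norm_fderiv_le (h : IsSmoothReflection ρ Ψ K L) (x : Euc d) : ‖fderiv ℝ Ψ x‖ ≤ K :=
  norm_fderiv_le_of_lipschitz ℝ h.lipschitz

lemma fderiv_comp_fderiv (h : IsSmoothReflection ρ Ψ K L) (x : Euc d) :
    (fderiv ℝ Ψ (Ψ x)).comp (fderiv ℝ Ψ x) = ContinuousLinearMap.id ℝ (Euc d) := by
  have h1 := (h.differentiable (Ψ x)).hasFDerivAt.comp x (h.differentiable x).hasFDerivAt
  rw [h.involutive.comp_self] at h1
  exact h1.unique (hasFDerivAt_id x)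

lemma fderiv_comp_fderiv' (h : IsSmoothReflection ρ Ψ K L) (x : Euc d) :
    (fderiv ℝ Ψ x).comp (fderiv ℝ Ψ (Ψ x)) = ContinuousLinearMap.id ℝ (Euc d) := by
  simpa [h.involutive x] using h.fderiv_comp_fderiv (Ψ x)

lemma abs_det_mul_abs_det (h : IsSmoothReflection ρ Ψ K L) (x : Euc d) :
    |(fderiv ℝ Ψ x).det| * |(fderiv ℝ Ψ (Ψ x)).det| = 1 := by
  rw [← abs_mul, ← det_opMatrix, ← det_opMatrix, ← Matrix.det_mul, opMatrix_mul,
    h.fderiv_comp_fderiv', opMatrix_id, Matrix.det_one, abs_one]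

lemma contDiff (h : IsSmoothReflection ρ Ψ K L) : ContDiff ℝ 1 Ψ :=
  contDiff_one_iff_fderiv.2 ⟨h.differentiable, h.lipschitz_fderiv.continuous⟩

lemma transformedCoeff_eq_one (h : IsSmoothReflection ρ Ψ K L) {x : Euc d} (hx : ρ x = 0) :
    transformedCoeff Ψ x = 1 := by
  have h1 := opMatrix_mul_transpose_of_isometry (h.isometry x hx)
  rw [transformedCoeff, h.fixed x hx, h1]
  have h2 := h.abs_det_mul_abs_det x
  rw [h.fixed x hx] at h2
  rw [(mul_self_eq_one_iff.1 h2).resolve_right (by linarith [abs_nonneg (fderiv ℝ Ψ x).det]),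
    one_smul]

end IsSmoothReflection

/-- The reflected coefficients are elliptic and Lipschitz, with constants that depend only on those
of the reflection. They are continuous across the zero set of `ρ` because the derivative of the
reflection is an isometry there. -/
lemma exists_isEllipticLipschitz_reflectedCoeff (d : ℕ) (K L : ℝ≥0) (hK : 1 ≤ K) :
    ∃ (lam Lam : ℝ) (L' : ℝ≥0), 0 < lam ∧ ∀ (ρ : Euc d → ℝ) (Ψ : Euc d → Euc d),
      IsSmoothReflection ρ Ψ K L → ∀ U, IsEllipticLipschitz U lam Lam L' (reflectedCoeff ρ Ψ) := by
  obtain ⟨C, hC1, hC⟩ := exists_det_bound d K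
  have hK1 : (1 : ℝ) ≤ K := by exact_mod_cast hK
  have hCK : (1 : ℝ) ≤ C * K ^ 2 := one_le_mul_of_one_le_of_one_le hC1 (one_le_pow₀ hK1)
  set L' : ℝ≥0 := Real.toNNReal (C * L * (d * (K * K)) + C * (d * (K * (L * K) + K * (L * K))))
    with hL'
  refine ⟨1 / (C * K ^ 2), C * K ^ 2, L', by positivity, fun ρ Ψ h U => ?_⟩
  have hD : ∀ x, |(fderiv ℝ Ψ x).det| ≤ C := fun x =>
    (hC _ _ (h.norm_fderiv_le x) (h.norm_fderiv_le x)).1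
  have hsymm : ∀ x, (transformedCoeff Ψ x).IsSymm := fun x =>
    (Matrix.isSymm_mul_transpose_self _).smul _
  have hlip : ∀ i j, LipschitzWith L' fun x => transformedCoeff Ψ x i j := by
    intro i j
    refine LipschitzWith.of_dist_le_mul fun x y => ?_
    have hfd : ∀ x y, ‖fderiv ℝ Ψ x - fderiv ℝ Ψ y‖ ≤ L * dist x y := fun x y => by
      rw [← dist_eq_norm]; exact h.lipschitz_fderiv.dist_le_mul x y
    have hfd' : ‖fderiv ℝ Ψ (Ψ x) - fderiv ℝ Ψ (Ψ y)‖ ≤ L * K * dist x y := by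
      refine (hfd _ _).trans ?_
      rw [mul_assoc]; gcongr; exact h.lipschitz.dist_le_mul x y
    set X := opMatrix (fderiv ℝ Ψ (Ψ x)) with hX
    set Y := opMatrix (fderiv ℝ Ψ (Ψ y)) with hY
    have hXb : ∀ i k, |X i k| ≤ K := fun i k => (abs_opMatrix_le _ i k).trans (h.norm_fderiv_le _)
    have hYb : ∀ i k, |Y i k| ≤ K := fun i k => (abs_opMatrix_le _ i k).trans (h.norm_fderiv_le _)
    have hXY : ∀ i k, |X i k - Y i k| ≤ L * K * dist x y := fun i k =>
      (abs_opMatrix_sub_le _ _ i k).trans hfd'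
    have hval : ∀ z, transformedCoeff Ψ z i j = |(fderiv ℝ Ψ z).det| *
        ∑ k, opMatrix (fderiv ℝ Ψ (Ψ z)) i k * opMatrix (fderiv ℝ Ψ (Ψ z)) j k := fun z => by
      simp [transformedCoeff, Matrix.mul_apply]
    have hsum : |∑ k, X i k * X j k| ≤ d * (K * K) := by
      refine (Finset.abs_sum_le_sum_abs _ _).trans ?_
      have : ∀ k, |X i k * X j k| ≤ K * K := fun k => by
        rw [abs_mul]; exact mul_le_mul (hXb i k) (hXb j k) (abs_nonneg _) K.2
      refine (Finset.sum_le_sum fun k _ => this k).trans ?_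
      simp
    have hdiff : |∑ k, X i k * X j k - ∑ k, Y i k * Y j k| ≤
        d * (K * (L * K * dist x y) + K * (L * K * dist x y)) := by
      rw [← Finset.sum_sub_distrib]
      refine (Finset.abs_sum_le_sum_abs _ _).trans ?_
      have : ∀ k, |X i k * X j k - Y i k * Y j k| ≤
          K * (L * K * dist x y) + K * (L * K * dist x y) := fun k => by
        have e : X i k * X j k - Y i k * Y j k =
            X i k * (X j k - Y j k) + Y j k * (X i k - Y i k) := by ring
        rw [e]
        refine (abs_add_le _ _).trans ?_
        rw [abs_mul, abs_mul]
        gcongr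
        exacts [hXb i k, hXY j k, hYb j k, hXY i k]
      refine (Finset.sum_le_sum fun k _ => this k).trans ?_
      simp only [Finset.sum_const, Finset.card_univ, Fintype.card_fin, nsmul_eq_mul]
      rfl
    have hdet : abs (|(fderiv ℝ Ψ x).det| - |(fderiv ℝ Ψ y).det|) ≤ C * (L * dist x y) := by
      refine (abs_abs_sub_abs_le_abs_sub _ _).trans
        ((hC _ _ (h.norm_fderiv_le x) (h.norm_fderiv_le y)).2.trans ?_)
      gcongr
      exact hfd x y
    rw [Real.dist_eq, hval, hval]
    have e : |(fderiv ℝ Ψ x).det| * ∑ k, X i k * X j k - |(fderiv ℝ Ψ y).det| * ∑ k, Y i k * Y j k =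
        (|(fderiv ℝ Ψ x).det| - |(fderiv ℝ Ψ y).det|) * ∑ k, X i k * X j k +
        |(fderiv ℝ Ψ y).det| * (∑ k, X i k * X j k - ∑ k, Y i k * Y j k) := by ring
    rw [e]
    refine (abs_add_le _ _).trans ?_
    rw [abs_mul, abs_mul, abs_abs, hL', Real.coe_toNNReal _ (by positivity)]
    calc _ ≤ C * (L * dist x y) * (d * (K * K)) +
          C * (d * (K * (L * K * dist x y) + K * (L * K * dist x y))) := by
          gcongr
          exact hD y
      _ = _ := by ring
  refine ⟨fun x _ => ?_, fun x _ ξ => ?_, fun i j => LipschitzOnWith.of_dist_le_mul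
    fun x _ y _ => ?_⟩
  · unfold reflectedCoeff
    split_ifs
    exacts [Matrix.isSymm_one, hsymm x]
  · have hξ : 0 ≤ ξ ⬝ᵥ ξ := by
      rw [show ξ = (WithLp.toLp 2 ξ : Euc d).ofLp from rfl, dotProduct_self_ofLp]; positivity
    unfold reflectedCoeff
    split_ifs
    · rw [Matrix.one_mulVec]
      exact ⟨mul_le_of_le_one_left hξ ((div_le_one (by positivity)).2 hCK),
        le_mul_of_one_le_left hξ hCK⟩
    · rw [dotProduct_transformedCoeff]
      set X := opMatrix (fderiv ℝ Ψ (Ψ x)) with hX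
      set η := Xᵀ *ᵥ ξ with hη
      have h1 : η ⬝ᵥ η ≤ K ^ 2 * (ξ ⬝ᵥ ξ) := dotProduct_transpose_mulVec_le (h.norm_fderiv_le _) ξ
      have h2 : ξ ⬝ᵥ ξ ≤ K ^ 2 * (η ⬝ᵥ η) := by
        have h3 : (opMatrix (fderiv ℝ Ψ x))ᵀ *ᵥ η = ξ := by
          rw [hη, Matrix.mulVec_mulVec, ← Matrix.transpose_mul, opMatrix_mul,
            h.fderiv_comp_fderiv, opMatrix_id, Matrix.transpose_one, Matrix.one_mulVec]
        have h4 := dotProduct_transpose_mulVec_le (h.norm_fderiv_le x) η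
        rwa [h3] at h4
      have hη0 : 0 ≤ η ⬝ᵥ η := by nlinarith [sq_nonneg (K : ℝ), hK1]
      have hdl : 1 / C ≤ |(fderiv ℝ Ψ x).det| := by
        rw [div_le_iff₀ (by linarith), ← h.abs_det_mul_abs_det x]
        gcongr
        exact hD _
      constructor
      · calc 1 / (C * K ^ 2) * (ξ ⬝ᵥ ξ) ≤ 1 / (C * K ^ 2) * (K ^ 2 * (η ⬝ᵥ η)) := by gcongr
          _ = 1 / C * (η ⬝ᵥ η) := by field_simp
          _ ≤ _ := by gcongr
      · calc _ ≤ C * (K ^ 2 * (ξ ⬝ᵥ ξ)) := by gcongr; exact hD x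
          _ = _ := by ring
  · -- A segment from the set `ρ < 0` to its complement meets the zero set of `ρ`, where the two
    -- definitions of the coefficients agree.
    have hcross : ∀ x y, ρ x < 0 → ¬ ρ y < 0 →
        dist ((1 : Matrix (Fin d) (Fin d) ℝ) i j) (transformedCoeff Ψ y i j) ≤ L' * dist x y := by
      intro x y hx hy
      obtain ⟨p, hp, hxy⟩ := exists_zero_between h.continuous hx.le (not_lt.1 hy)
      rw [← h.transformedCoeff_eq_one hp]
      refine ((hlip i j).dist_le_mul _ _).trans ?_
      gcongr
      linarith [dist_nonneg (x := x) (y := p)]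
    unfold reflectedCoeff
    split_ifs with hx hy hy
    · rw [dist_self]; positivity
    · exact hcross x y hx hy
    · rw [dist_comm, dist_comm x]; exact hcross y x hy hx
    · exact (hlip i j).dist_le_mul x y

end Coefficients

/-! ### The reflected function is a weak solution -/

open Classical in
/-- The identity where `ρ ≤ 0`, and `Ψ` where `ρ > 0`. -/
noncomputable def foldMap {d : ℕ} (ρ : Euc d → ℝ) (Ψ : Euc d → Euc d) (x : Euc d) : Euc d :=
  if ρ x ≤ 0 then x else Ψ x

open Classical in
/-- The gradient of `h ∘ foldMap ρ Ψ` off the zero set of `ρ`. It is set to be zero on that set, so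
that no integral sees it. -/
noncomputable def foldGradient {d : ℕ} (ρ : Euc d → ℝ) (Ψ : Euc d → Euc d) (h : Euc d → ℝ)
    (x : Euc d) : Euc d :=
  if ρ x < 0 then ∇ h x else
    if 0 < ρ x then ContinuousLinearMap.adjoint (fderiv ℝ Ψ x) (∇ h (Ψ x)) else 0

section WeakSolution

variable {d : ℕ} {Ω : Set (Euc d)} {x₀ : Euc d} {r : ℝ} {ρ : Euc d → ℝ} {Ψ : Euc d → Euc d}
  {K L c : ℝ≥0} {h : Euc d → ℝ} {e : Euc d}

/-- The set `Ω` is `{ρ < 0}` in the ball, the map `Ψ` exchanges the two sides, and `ρ` grows at unit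
speed in the direction `e`. -/
structure IsReflectedInBall (Ω : Set (Euc d)) (x₀ : Euc d) (r : ℝ) (ρ : Euc d → ℝ)
    (Ψ : Euc d → Euc d) (e : Euc d) (c : ℝ≥0) : Prop where
  isOpen : IsOpen Ω
  mem_iff : ∀ x ∈ ball x₀ r, x ∈ Ω ↔ ρ x < 0
  mem_closure_iff : ∀ x ∈ ball x₀ r, x ∈ closure Ω ↔ ρ x ≤ 0
  maps_pos : ∀ x ∈ ball x₀ r, 0 < ρ x → Ψ x ∈ Ω
  maps_nonpos : ∀ x ∈ ball x₀ r, ρ x ≤ 0 → Ψ x ∉ Ω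
  dir : ∀ x (t : ℝ), ρ (x + t • e) = ρ x + t
  lipschitz : LipschitzWith c ρ

lemma fderiv_eq_innerSL_gradient {u : Euc d → ℝ} (x : Euc d) : fderiv ℝ u x = innerSL ℝ (∇ u x) := by
  ext v
  rw [innerSL_apply_apply, inner_gradient_left]

lemma gradient_apply (u : Euc d → ℝ) (x : Euc d) (i : Fin d) :
    (∇ u x) i = fderiv ℝ u x (EuclideanSpace.basisFun (Fin d) ℝ i) := by
  rw [← inner_basisFun, real_inner_comm, inner_gradient_left]

lemma gradient_comp {u : Euc d → ℝ} {x : Euc d} (hu : DifferentiableAt ℝ u (Ψ x))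
    (hΨ : DifferentiableAt ℝ Ψ x) :
    ∇ (u ∘ Ψ) x = ContinuousLinearMap.adjoint (fderiv ℝ Ψ x) (∇ u (Ψ x)) := by
  refine ext_inner_right ℝ fun v => ?_
  rw [inner_gradient_left, fderiv_comp x hu hΨ, ContinuousLinearMap.adjoint_inner_left,
    inner_gradient_left]
  rfl

lemma continuous_mul_of_tsupport_subset {U : Set (Euc d)} {v ψ : Euc d → ℝ} (hU : IsOpen U)
    (hv : ContinuousOn v U) (hψ : Continuous ψ) (hs : tsupport ψ ⊆ U) :
    Continuous fun x => v x * ψ x := by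
  refine continuous_iff_continuousAt.2 fun x => ?_
  by_cases hx : x ∈ tsupport ψ
  · exact (hv.continuousAt (hU.mem_nhds (hs hx))).mul hψ.continuousAt
  · refine (continuousAt_const (y := (0 : ℝ))).congr ?_
    filter_upwards [notMem_tsupport_iff_eventuallyEq.1 hx] with y hy
    rw [hy, Pi.zero_apply, mul_zero]

lemma continuous_foldMap (hs : IsSmoothReflection ρ Ψ K L) : Continuous (foldMap ρ Ψ) := by
  unfold foldMap
  exact continuous_id.if_le hs.lipschitz.continuous hs.continuous continuous_const
    fun x hx => (hs.fixed x hx).symm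

namespace IsReflectedInBall

lemma foldMap_mem_closure (hb : IsReflectedInBall Ω x₀ r ρ Ψ e c) {x : Euc d}
    (hx : x ∈ ball x₀ r) : foldMap ρ Ψ x ∈ closure Ω := by
  unfold foldMap
  split_ifs with h0
  · exact (hb.mem_closure_iff x hx).2 h0
  · exact subset_closure (hb.maps_pos x hx (not_le.1 h0))

lemma continuousOn_comp_foldMap (hb : IsReflectedInBall Ω x₀ r ρ Ψ e c)
    (hs : IsSmoothReflection ρ Ψ K L) (hh : IsNeumannHarmonic Ω h) :
    ContinuousOn (h ∘ foldMap ρ Ψ) (ball x₀ r) :=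
  hh.continuousOn.comp (continuous_foldMap hs).continuousOn fun _ hx => hb.foldMap_mem_closure hx

lemma hasFDerivAt_comp_foldMap (hb : IsReflectedInBall Ω x₀ r ρ Ψ e c)
    (hs : IsSmoothReflection ρ Ψ K L) (hh : IsNeumannHarmonic Ω h) {x : Euc d}
    (hx : x ∈ ball x₀ r) (hρ : ρ x ≠ 0) :
    HasFDerivAt (h ∘ foldMap ρ Ψ) (innerSL ℝ (foldGradient ρ Ψ h x)) x := by
  rcases lt_or_gt_of_ne hρ with h0 | h0
  · have hd : DifferentiableAt ℝ h x :=
      (hh.contDiffAt ((hb.mem_iff x hx).2 h0)).differentiableAt two_ne_zero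
    rw [foldGradient, if_pos h0, ← fderiv_eq_innerSL_gradient]
    refine hd.hasFDerivAt.congr_of_eventuallyEq ?_
    filter_upwards [hs.continuous.continuousAt.eventually (gt_mem_nhds h0)] with y hy
    simp [foldMap, hy.le]
  · have hd : DifferentiableAt ℝ h (Ψ x) :=
      (hh.contDiffAt (hb.maps_pos x hx h0)).differentiableAt two_ne_zero
    rw [foldGradient, if_neg h0.not_gt, if_pos h0, ← gradient_comp hd (hs.differentiable x),
      ← fderiv_eq_innerSL_gradient]
    refine (hd.comp x (hs.differentiable x)).hasFDerivAt.congr_of_eventuallyEq ?_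
    filter_upwards [hs.continuous.continuousAt.eventually (lt_mem_nhds h0)] with y hy
    simp [foldMap, not_le.2 hy]

lemma isOpen_pos (hs : IsSmoothReflection ρ Ψ K L) : IsOpen (ball x₀ r ∩ {x | 0 < ρ x}) :=
  isOpen_ball.inter (isOpen_lt continuous_const hs.continuous)

lemma isOpen_neg (hs : IsSmoothReflection ρ Ψ K L) : IsOpen (ball x₀ r ∩ {x | ρ x < 0}) :=
  isOpen_ball.inter (isOpen_lt hs.continuous continuous_const)

lemma image_pos_subset (hb : IsReflectedInBall Ω x₀ r ρ Ψ e c) :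
    Ψ '' (ball x₀ r ∩ {x | 0 < ρ x}) ⊆ Ω := by
  rintro _ ⟨x, hx, rfl⟩
  exact hb.maps_pos x hx.1 hx.2

/-- The energy of the reflected function is controlled by the energy of `h`, by the change of
variables `Ψ`. -/
lemma memLp_reflected_gradient (hb : IsReflectedInBall Ω x₀ r ρ Ψ e c)
    (hs : IsSmoothReflection ρ Ψ K L) (hh : IsNeumannHarmonic Ω h) :
    MemLp (fun x => ContinuousLinearMap.adjoint (fderiv ℝ Ψ x) (∇ h (Ψ x))) 2
      (volume.restrict (ball x₀ r ∩ {x | 0 < ρ x})) := by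
  set S := ball x₀ r ∩ {x | 0 < ρ x} with hS
  have hSo : IsOpen S := isOpen_pos hs
  obtain ⟨C, hC1, hC⟩ := exists_det_bound d K
  have hcont : ContinuousOn (fun x => ContinuousLinearMap.adjoint (fderiv ℝ Ψ x) (∇ h (Ψ x))) S := by
    refine ContinuousOn.clm_apply ?_ ?_
    · exact (ContinuousLinearMap.adjoint.continuous.comp
        hs.lipschitz_fderiv.continuous).continuousOn
    · exact hh.continuousOn_gradient.comp hs.lipschitz.continuous.continuousOn
        fun x hx => hb.maps_pos x hx.1 hx.2
  have hmeas := hcont.aestronglyMeasurable (μ := volume) hSo.measurableSet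
  refine (memLp_two_iff_integrable_sq_norm hmeas).2 ?_
  obtain ⟨R, hR⟩ : ∃ R, Ψ '' S ⊆ ball 0 R :=
    ((hs.lipschitz.isBounded_image (isBounded_ball.subset inter_subset_left)).subset_ball 0)
  have h1 : IntegrableOn (fun z => ‖∇ h z‖ ^ 2) (Ψ '' S) :=
    (hh.energy R).mono_set (subset_inter hb.image_pos_subset hR)
  rw [integrableOn_image_iff_integrableOn_abs_det_fderiv_smul volume hSo.measurableSet
    (fun x _ => (hs.differentiable x).hasFDerivAt.hasFDerivWithinAt)
    hs.involutive.injective.injOn] at h1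
  refine Integrable.mono' (h1.const_mul (K ^ 2 * C)) (hmeas.norm.pow 2) ?_
  refine Filter.Eventually.of_forall fun x => ?_
  have h2 : ‖ContinuousLinearMap.adjoint (fderiv ℝ Ψ x) (∇ h (Ψ x))‖ ≤ K * ‖∇ h (Ψ x)‖ :=
    ContinuousLinearMap.le_of_opNorm_le _
      (by rw [LinearIsometryEquiv.norm_map]; exact hs.norm_fderiv_le x) _
  have h3 : 1 ≤ C * |(fderiv ℝ Ψ x).det| := by
    rw [← hs.abs_det_mul_abs_det x, mul_comm]
    gcongr
    exact (hC _ _ (hs.norm_fderiv_le (Ψ x)) (hs.norm_fderiv_le (Ψ x))).1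
  rw [norm_pow, norm_norm, smul_eq_mul]
  calc _ ≤ (K * ‖∇ h (Ψ x)‖) ^ 2 := by gcongr
    _ = 1 * (K ^ 2 * ‖∇ h (Ψ x)‖ ^ 2) := by ring
    _ ≤ C * |(fderiv ℝ Ψ x).det| * (K ^ 2 * ‖∇ h (Ψ x)‖ ^ 2) := by gcongr
    _ = _ := by ring

lemma memLp_foldGradient (hb : IsReflectedInBall Ω x₀ r ρ Ψ e c)
    (hs : IsSmoothReflection ρ Ψ K L) (hh : IsNeumannHarmonic Ω h) :
    MemLp (foldGradient ρ Ψ h) 2 (volume.restrict (ball x₀ r)) := by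
  obtain ⟨R, hR⟩ : ∃ R, ball x₀ r ⊆ ball 0 R := isBounded_ball.subset_ball 0
  have hneg : MemLp ((ball x₀ r ∩ {x | ρ x < 0}).indicator (∇ h)) 2 volume := by
    rw [memLp_indicator_iff_restrict (isOpen_neg hs).measurableSet]
    refine (hh.memLp_gradient hb.isOpen R).mono_measure (Measure.restrict_mono ?_ le_rfl)
    exact fun x hx => ⟨(hb.mem_iff x hx.1).2 hx.2, hR hx.1⟩
  have hpos := (memLp_indicator_iff_restrict (isOpen_pos hs).measurableSet).2
    (hb.memLp_reflected_gradient hs hh)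
  refine ((hneg.add hpos).mono_measure Measure.restrict_le_self).ae_eq ?_
  filter_upwards [ae_restrict_mem measurableSet_ball] with x hx
  unfold foldGradient
  rcases lt_trichotomy (ρ x) 0 with h0 | h0 | h0
  · simp [h0, hx, h0.not_gt]
  · simp [h0]
  · simp [h0, hx, h0.not_gt]

lemma integrable_inner_foldGradient (hb : IsReflectedInBall Ω x₀ r ρ Ψ e c)
    (hs : IsSmoothReflection ρ Ψ K L) (hh : IsNeumannHarmonic Ω h) {ψ : Euc d → ℝ}
    (hψ : Continuous ψ) (hc : HasCompactSupport ψ) (hsub : tsupport ψ ⊆ ball x₀ r) (w : Euc d) :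
    Integrable fun x => inner ℝ (foldGradient ρ Ψ h x) w * ψ x := by
  obtain ⟨C, hC⟩ := hc.exists_bound_of_continuous hψ
  have : IsFiniteMeasure (volume.restrict (ball x₀ r)) :=
    ⟨by rw [Measure.restrict_apply_univ]; exact measure_ball_lt_top⟩
  have h1 : Integrable (foldGradient ρ Ψ h) (volume.restrict (ball x₀ r)) :=
    (hb.memLp_foldGradient hs hh).integrable (by norm_num)
  have h2 : IntegrableOn (fun x => inner ℝ (foldGradient ρ Ψ h x) w * ψ x) (ball x₀ r) :=
    (h1.inner_const w).mul_bdd hψ.aestronglyMeasurable (Filter.Eventually.of_forall hC)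
  rwa [integrableOn_iff_integrable_of_support_subset] at h2
  intro x hx
  exact hsub (subset_tsupport _ (right_ne_zero_of_mul hx))

lemma integrable_comp_foldMap_mul (hb : IsReflectedInBall Ω x₀ r ρ Ψ e c)
    (hs : IsSmoothReflection ρ Ψ K L) (hh : IsNeumannHarmonic Ω h) {ψ : Euc d → ℝ}
    (hψ : ContDiff ℝ ∞ ψ) (hc : HasCompactSupport ψ) (hsub : tsupport ψ ⊆ ball x₀ r) (w : Euc d) :
    Integrable fun x => (h ∘ foldMap ρ Ψ) x * fderiv ℝ ψ x w := by
  have hts : tsupport (fun x => fderiv ℝ ψ x w) ⊆ tsupport ψ := tsupport_fderiv_apply_subset ℝ w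
  have hcont : Continuous fun x => fderiv ℝ ψ x w :=
    (hψ.continuous_fderiv (by simp)).clm_apply continuous_const
  refine Continuous.integrable_of_hasCompactSupport (continuous_mul_of_tsupport_subset isOpen_ball
    (hb.continuousOn_comp_foldMap hs hh) hcont (hts.trans hsub)) ?_
  exact (hc.fderiv_apply (𝕜 := ℝ) w).mul_left

/-- Integration by parts in a direction that is transversal to the zero set of `ρ`: each line in
this direction meets the set at most once, and the reflected function is continuous there. -/
lemma integral_parts_of_transversal (hb : IsReflectedInBall Ω x₀ r ρ Ψ e c)
    (hs : IsSmoothReflection ρ Ψ K L) (hh : IsNeumannHarmonic Ω h) {ψ : Euc d → ℝ}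
    (hψ : ContDiff ℝ ∞ ψ) (hc : HasCompactSupport ψ) (hsub : tsupport ψ ⊆ ball x₀ r) {w : Euc d}
    (hw : ∀ x, Function.Injective fun t : ℝ => ρ (x + t • w)) :
    (∫ x, (h ∘ foldMap ρ Ψ) x * fderiv ℝ ψ x w) +
      ∫ x, inner ℝ (foldGradient ρ Ψ h x) w * ψ x = 0 := by
  have hi1 := hb.integrable_comp_foldMap_mul hs hh hψ hc hsub w
  have hi2 := hb.integrable_inner_foldGradient hs hh hψ.continuous hc hsub w
  rw [← integral_add hi1 hi2]
  refine integral_eq_zero_of_hasLineDerivAt_off (S := {x | ρ x = 0}) (w := w)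
    (f := fun x => (h ∘ foldMap ρ Ψ) x * ψ x) ?_ ?_ ?_ ?_ ?_ (hi1.add hi2)
  · rintro rfl
    have := @hw 0 0 1 (by simp)
    exact zero_ne_one this
  · exact continuous_mul_of_tsupport_subset isOpen_ball (hb.continuousOn_comp_foldMap hs hh)
      hψ.continuous hsub
  · exact hc.mul_left
  · intro x
    refine Set.Subsingleton.countable fun t ht t' ht' => hw x ?_
    exact (show ρ (x + t • w) = 0 from ht).trans (show ρ (x + t' • w) = 0 from ht').symm
  · intro x hx
    by_cases hxs : x ∈ tsupport ψ
    · have h1 := hb.hasFDerivAt_comp_foldMap hs hh (hsub hxs) hx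
      have h2 : HasFDerivAt ψ (fderiv ℝ ψ x) x :=
        ((hψ.differentiable (by simp)) x).hasFDerivAt
      have h3 := (h1.mul h2).hasLineDerivAt w
      have h4 : ((h ∘ foldMap ρ Ψ) x • fderiv ℝ ψ x +
          ψ x • innerSL ℝ (foldGradient ρ Ψ h x)) w =
          (h ∘ foldMap ρ Ψ) x * fderiv ℝ ψ x w + inner ℝ (foldGradient ρ Ψ h x) w * ψ x := by
        simp [mul_comm]
      rw [h4] at h3
      exact h3
    · have h0 := notMem_tsupport_iff_eventuallyEq.1 hxs
      have h1 : (fun x => (h ∘ foldMap ρ Ψ) x * ψ x) =ᶠ[nhds x] fun _ => 0 := by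
        filter_upwards [h0] with y hy
        rw [hy, Pi.zero_apply, mul_zero]
      have h2 : fderiv ℝ ψ x = 0 := by
        rw [h0.fderiv_eq]; simp
      rw [h2, h0.self_of_nhds]
      have h3 : HasFDerivAt (fun x => (h ∘ foldMap ρ Ψ) x * ψ x) (0 : Euc d →L[ℝ] ℝ) x :=
        (hasFDerivAt_const (0 : ℝ) x).congr_of_eventuallyEq h1
      simpa using h3.hasLineDerivAt w

lemma isWeakGradient (hb : IsReflectedInBall Ω x₀ r ρ Ψ e c)
    (hs : IsSmoothReflection ρ Ψ K L) (hh : IsNeumannHarmonic Ω h) :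
    IsWeakGradient (ball x₀ r) (h ∘ foldMap ρ Ψ) (foldGradient ρ Ψ h) where
  memLp S hS hSc := by
    have : IsFiniteMeasure (volume.restrict S) :=
      ⟨by rw [Measure.restrict_apply_univ]; exact hSc.measure_lt_top⟩
    have hcont := (hb.continuousOn_comp_foldMap hs hh).mono hS
    obtain ⟨C, hC⟩ := hSc.exists_bound_of_continuousOn hcont
    refine MemLp.of_bound (hcont.aestronglyMeasurable_of_isCompact hSc hSc.measurableSet) C ?_
    filter_upwards [ae_restrict_mem hSc.measurableSet] with x hx
    exact hC x hx
  memLp_grad S hS _ := (hb.memLp_foldGradient hs hh).mono_measure (Measure.restrict_mono hS le_rfl)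
  parts ψ hψ hc hsub i := by
    set b := EuclideanSpace.basisFun (Fin d) ℝ i with hbi
    have hinj : ∀ w : Euc d, ‖w‖ ≤ 1 → ∀ x,
        Function.Injective fun t : ℝ => ρ (x + t • (w + (c + 1 : ℝ) • e)) := by
      intro w hw1 x t t' htt
      have hexp : ∀ t : ℝ, ρ (x + t • (w + (c + 1 : ℝ) • e)) = ρ (x + t • w) + t * (c + 1) := by
        intro t
        rw [← hb.dir]; congr 1; module
      beta_reduce at htt
      rw [hexp, hexp] at htt
      have h1 := hb.lipschitz.dist_le_mul (x + t • w) (x + t' • w)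
      have h2 : dist (x + t • w) (x + t' • w) ≤ |t - t'| := by
        rw [dist_eq_norm, show x + t • w - (x + t' • w) = (t - t') • w by module, norm_smul,
          Real.norm_eq_abs]
        exact mul_le_of_le_one_right (abs_nonneg _) hw1
      rw [Real.dist_eq, show ρ (x + t • w) - ρ (x + t' • w) = -((t - t') * (c + 1)) by linarith,
        abs_neg, abs_mul, abs_of_pos (by positivity : (0 : ℝ) < c + 1)] at h1
      have h3 : (c : ℝ) * dist (x + t • w) (x + t' • w) ≤ c * |t - t'| := by gcongr
      have h4 : |t - t'| ≤ 0 := by linarith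
      exact sub_eq_zero.1 (abs_nonpos_iff.1 h4)
    -- The basis vector is the difference of two transversal directions.
    have h1 := hb.integral_parts_of_transversal hs hh hψ hc hsub (hinj b (by simp [hbi]))
    have h0 := hb.integral_parts_of_transversal hs hh hψ hc hsub (hinj 0 (by simp))
    have hb0 : b = (b + (c + 1 : ℝ) • e) - (0 + (c + 1 : ℝ) • e) := by module
    have e1 : ∫ x, (h ∘ foldMap ρ Ψ) x * (∇ ψ x) i =
        (∫ x, (h ∘ foldMap ρ Ψ) x * fderiv ℝ ψ x (b + (c + 1 : ℝ) • e)) -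
          ∫ x, (h ∘ foldMap ρ Ψ) x * fderiv ℝ ψ x (0 + (c + 1 : ℝ) • e) := by
      rw [← integral_sub (hb.integrable_comp_foldMap_mul hs hh hψ hc hsub _)
        (hb.integrable_comp_foldMap_mul hs hh hψ hc hsub _)]
      refine integral_congr_ae (Filter.Eventually.of_forall fun x => ?_)
      beta_reduce
      rw [gradient_apply, ← mul_sub, ← map_sub, ← hb0]
    have e2 : ∫ x, (foldGradient ρ Ψ h x) i * ψ x =
        (∫ x, inner ℝ (foldGradient ρ Ψ h x) (b + (c + 1 : ℝ) • e) * ψ x) -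
          ∫ x, inner ℝ (foldGradient ρ Ψ h x) (0 + (c + 1 : ℝ) • e) * ψ x := by
      rw [← integral_sub (hb.integrable_inner_foldGradient hs hh hψ.continuous hc hsub _)
        (hb.integrable_inner_foldGradient hs hh hψ.continuous hc hsub _)]
      refine integral_congr_ae (Filter.Eventually.of_forall fun x => ?_)
      beta_reduce
      rw [← sub_mul, ← inner_sub_right, ← hb0, real_inner_comm, inner_basisFun]
    rw [e1, e2]
    linarith

/-- The weak equation splits into two Neumann conditions for `h`: one with the test function itself
on the side of `Ω`, and one with the reflected test function on the other side. -/
theorem isWeakSolution (hb : IsReflectedInBall Ω x₀ r ρ Ψ e c)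
    (hs : IsSmoothReflection ρ Ψ K L) (hh : IsNeumannHarmonic Ω h) :
    IsWeakSolution (reflectedCoeff ρ Ψ) (ball x₀ r) (h ∘ foldMap ρ Ψ) := by
  refine ⟨_, hb.isWeakGradient hs hh, fun ψ hψ hc hsub => ?_⟩
  set Sn := ball x₀ r ∩ {x | ρ x < 0} with hSn
  set Sp := ball x₀ r ∩ {x | 0 < ρ x} with hSp
  have hψ1 : ContDiff ℝ 1 ψ := hψ.of_le (by exact_mod_cast le_top)
  have hψd : Differentiable ℝ ψ := hψ1.differentiable one_ne_zero
  have hφ1 : ContDiff ℝ 1 (ψ ∘ Ψ) := hψ1.comp hs.contDiff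
  have hφc : HasCompactSupport (ψ ∘ Ψ) :=
    hc.comp_homeomorph (Homeomorph.mk hs.involutive.toPerm hs.lipschitz.continuous
      hs.lipschitz.continuous)
  have hgrad : ∀ {u : Euc d → ℝ}, ContDiff ℝ 1 u → HasCompactSupport u →
      IntegrableOn (fun x => inner ℝ (∇ h x) (∇ u x)) Ω := by
    intro u hu huc
    have h1 : Continuous (∇ u) := (InnerProductSpace.toDual ℝ (Euc d)).symm.continuous.comp
      (hu.continuous_fderiv one_ne_zero)
    have h2 : HasCompactSupport (∇ u) := (huc.fderiv (𝕜 := ℝ)).comp_left (map_zero _)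
    obtain ⟨R, hR⟩ := h2.isCompact.isBounded.subset_ball 0
    exact hh.integrableOn_inner_gradient hb.isOpen h1 h2 (R := R)
      fun x hx => image_eq_zero_of_notMem_tsupport fun hx' => hx (hR hx')
  have hψ0 : ∀ x ∉ ball x₀ r, ∇ ψ x = 0 := by
    intro x hx
    have : fderiv ℝ ψ x = 0 := by
      by_contra h0
      exact hx (hsub (tsupport_fderiv_subset ℝ (subset_tsupport _ h0)))
    rw [gradient, this, map_zero]
  have hcomp : ∀ z, ∇ (ψ ∘ Ψ) z = ContinuousLinearMap.adjoint (fderiv ℝ Ψ z) (∇ ψ (Ψ z)) :=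
    fun z => gradient_comp (hψd _) (hs.differentiable z)
  set G : Euc d → ℝ := fun z => inner ℝ (∇ h z) (∇ (ψ ∘ Ψ) z) with hG
  have hSnΩ : Sn ⊆ Ω := fun x hx => (hb.mem_iff x hx.1).2 hx.2
  have hder : ∀ x ∈ Sp, HasFDerivWithinAt Ψ (fderiv ℝ Ψ x) Sp x :=
    fun x _ => (hs.differentiable x).hasFDerivAt.hasFDerivWithinAt
  have hSnm : MeasurableSet Sn := (isOpen_neg hs).measurableSet
  have hSpm : MeasurableSet Sp := (isOpen_pos hs).measurableSet
  have hi1 : IntegrableOn (fun x => inner ℝ (∇ h x) (∇ ψ x)) Sn :=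
    (hgrad hψ1 hc).mono_set hSnΩ
  have hi2 : IntegrableOn (fun x => |(fderiv ℝ Ψ x).det| • G (Ψ x)) Sp :=
    (integrableOn_image_iff_integrableOn_abs_det_fderiv_smul volume hSpm hder
      hs.involutive.injective.injOn G).1 ((hgrad hφ1 hφc).mono_set hb.image_pos_subset)
  have hsplit : (fun x => (∇ ψ x).ofLp ⬝ᵥ
      (reflectedCoeff ρ Ψ x *ᵥ (foldGradient ρ Ψ h x).ofLp)) =
      fun x => Sn.indicator (fun x => inner ℝ (∇ h x) (∇ ψ x)) x +
        Sp.indicator (fun x => |(fderiv ℝ Ψ x).det| • G (Ψ x)) x := by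
    have hdot : ∀ u v : Euc d, u.ofLp ⬝ᵥ v.ofLp = inner ℝ v u := fun u v => by
      rw [PiLp.inner_apply]; simp [dotProduct]
    ext x
    by_cases hx : x ∈ ball x₀ r
    · rcases lt_trichotomy (ρ x) 0 with h0 | h0 | h0
      · simp [hSn, hSp, hx, h0, h0.not_gt, reflectedCoeff, foldGradient, hdot]
      · simp [hSn, hSp, h0, foldGradient]
      · have h1 : foldGradient ρ Ψ h x =
            ContinuousLinearMap.adjoint (fderiv ℝ Ψ x) (∇ h (Ψ x)) := by
          rw [foldGradient, if_neg h0.not_gt, if_pos h0]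
        have h2 : ∀ u, ContinuousLinearMap.adjoint (fderiv ℝ Ψ (Ψ x))
            (ContinuousLinearMap.adjoint (fderiv ℝ Ψ x) u) = u := by
          intro u
          rw [← ContinuousLinearMap.comp_apply, ← ContinuousLinearMap.adjoint_comp,
            hs.fderiv_comp_fderiv', ContinuousLinearMap.adjoint_id, ContinuousLinearMap.id_apply]
        rw [reflectedCoeff, if_neg h0.not_gt, dotProduct_transformedCoeff, h1,
          opMatrix_transpose_mulVec, opMatrix_transpose_mulVec, hdot]
        simp [hSn, hSp, hx, h0, h0.not_gt, hG, hcomp, hs.involutive x, h2]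
    · simp [hSn, hSp, hx, hψ0 x hx]
  rw [hsplit, integral_add ((integrable_indicator_iff hSnm).2 hi1)
    ((integrable_indicator_iff hSpm).2 hi2), integral_indicator hSnm, integral_indicator hSpm,
    ← integral_image_eq_integral_abs_det_fderiv_smul volume hSpm hder
      hs.involutive.injective.injOn G]
  have e1 : ∫ x in Sn, inner ℝ (∇ h x) (∇ ψ x) = 0 := by
    rw [← hh.neumann ψ hψ hc]
    refine (setIntegral_eq_of_subset_of_forall_sdiff_eq_zero hb.isOpen.measurableSet hSnΩ
      fun x hx => ?_).symm
    have hxb : x ∉ ball x₀ r := fun hxb => hx.2 ⟨hxb, (hb.mem_iff x hxb).1 hx.1⟩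
    rw [hψ0 x hxb, inner_zero_right]
  have e2 : ∫ x in Ψ '' Sp, G x = 0 := by
    rw [← hh.integral_inner_gradient_eq_zero hb.isOpen hφ1 hφc]
    refine (setIntegral_eq_of_subset_of_forall_sdiff_eq_zero hb.isOpen.measurableSet
      hb.image_pos_subset fun z hz => ?_).symm
    -- Every point of `Ω` that `Ψ` maps to the ball is the reflection of a point above the graph.
    have hzb : Ψ z ∉ ball x₀ r := by
      intro hzb
      refine hz.2 ⟨Ψ z, ⟨hzb, ?_⟩, hs.involutive z⟩
      by_contra h0
      exact hb.maps_nonpos _ hzb (not_lt.1 h0) (by rw [hs.involutive z]; exact hz.1)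
    simp only [hG]
    rw [hcomp, hψ0 _ hzb, map_zero, inner_zero_right]
  rw [e1, e2, add_zero]

/-- The folding map has the properties of a reflection map. -/
lemma isReflectionMap (hb : IsReflectedInBall Ω x₀ r ρ Ψ e c)
    (hs : IsSmoothReflection ρ Ψ K L) (hK : 1 ≤ K) :
    IsReflectionMap Ω x₀ r K (foldMap ρ Ψ) where
  eq_self x hx := if_pos ((hb.mem_closure_iff x hx.1).1 hx.2)
  mapsTo x hx := by
    have h0 : ¬ ρ x ≤ 0 := fun h0 => hx.2 ((hb.mem_closure_iff x hx.1).2 h0)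
    rw [foldMap, if_neg h0]
    exact hb.maps_pos x hx.1 (not_le.1 h0)
  lipschitz := by
    have hK' : (1 : ℝ) ≤ K := by exact_mod_cast hK
    have hcross : ∀ x y, ρ x ≤ 0 → ¬ ρ y ≤ 0 → dist x (Ψ y) ≤ K * dist x y := by
      intro x y hx hy
      obtain ⟨p, hp, hxy⟩ := exists_zero_between hs.continuous hx (not_le.1 hy).le
      have h3 := hs.lipschitz.dist_le_mul p y
      rw [hs.fixed p hp] at h3
      have h4 := dist_triangle x p (Ψ y)
      have h5 : dist x p ≤ K * dist x p := le_mul_of_one_le_left dist_nonneg hK'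
      rw [← hxy, mul_add]
      linarith
    refine LipschitzOnWith.of_dist_le_mul fun x _ y _ => ?_
    unfold foldMap
    split_ifs with hx hy hy
    · exact le_mul_of_one_le_left dist_nonneg hK'
    · exact hcross x y hx hy
    · rw [dist_comm, dist_comm x]; exact hcross y x hy hx
    · exact hs.lipschitz.dist_le_mul x y
  antilipschitz x hx y hy := by
    have hfold : ∀ z ∈ ball x₀ r \ Ω, foldMap ρ Ψ z = Ψ z := by
      intro z hz
      unfold foldMap
      split_ifs with h0
      · refine (hs.fixed z (le_antisymm h0 (not_lt.1 fun h1 => hz.2 ?_))).symm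
        exact (hb.mem_iff z hz.1).2 h1
      · rfl
    rw [hfold x hx, hfold y hy]
    have := hs.lipschitz.dist_le_mul (Ψ x) (Ψ y)
    rwa [hs.involutive x, hs.involutive y] at this

end IsReflectedInBall
end WeakSolution

/-! ### Uniform graph representations -/

/-- In the ball `B(x₀, R)` the set `Ω` lies below the graph of a `C^{1,1}` function, with all
constants at most `M`. -/
def IsLocallyBelowGraph {d : ℕ} (Ω : Set (Euc d)) (x₀ : Euc d) (R : ℝ) (M : ℝ≥0) : Prop :=
  ∃ (e : Euc d) (f : Euc d → ℝ), ‖e‖ = 1 ∧ (∀ (x : Euc d) (t : ℝ), f (x + t • e) = f x) ∧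
    Differentiable ℝ f ∧ LipschitzWith M (fderiv ℝ f) ∧ ‖fderiv ℝ f x₀‖ ≤ M ∧
    ∀ x ∈ ball x₀ R, x ∈ Ω ↔ inner ℝ e x < f x

/-- The orthogonal projection to the hyperplane orthogonal to the unit vector `e`. -/
noncomputable def projAlong {d : ℕ} (e : Euc d) : Euc d →L[ℝ] Euc d :=
  ContinuousLinearMap.id ℝ (Euc d) - (innerSL ℝ e).smulRight e

section Projection

variable {d : ℕ} {e : Euc d}

lemma projAlong_apply (e x : Euc d) : projAlong e x = x - inner ℝ e x • e := by
  simp [projAlong]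

lemma norm_projAlong_le (he : ‖e‖ = 1) : ‖projAlong e‖ ≤ 1 := by
  refine ContinuousLinearMap.opNorm_le_bound _ zero_le_one fun v => ?_
  rw [one_mul, ← sq_le_sq₀ (norm_nonneg _) (norm_nonneg _), projAlong_apply, norm_sub_sq_real,
    norm_smul, he, inner_smul_right, real_inner_comm, mul_one, Real.norm_eq_abs, sq_abs]
  nlinarith [sq_nonneg (inner ℝ v e : ℝ)]

lemma projAlong_self (he : ‖e‖ = 1) : projAlong e e = 0 := by
  rw [projAlong_apply, real_inner_self_eq_norm_sq, he]; simp

/-- Composing with an affine map of norm at most one preserves the Lipschitz constant of the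
derivative. -/
lemma lipschitzWith_fderiv_comp {m : ℕ} {φ : Euc m → ℝ} {M : ℝ≥0} (hφ : Differentiable ℝ φ)
    (hM : LipschitzWith M (fderiv ℝ φ)) {P : Euc d →L[ℝ] Euc m} (hP : ‖P‖ ≤ 1) (y : Euc m) :
    (∀ x, HasFDerivAt (fun x => φ (P x + y)) ((fderiv ℝ φ (P x + y)).comp P) x) ∧
      LipschitzWith M (fderiv ℝ fun x => φ (P x + y)) := by
  have h1 : ∀ x, HasFDerivAt (fun x => φ (P x + y)) ((fderiv ℝ φ (P x + y)).comp P) x := fun x =>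
    (hφ (P x + y)).hasFDerivAt.comp x (P.hasFDerivAt.add_const y)
  refine ⟨h1, LipschitzWith.of_dist_le_mul fun x x' => ?_⟩
  rw [(h1 x).fderiv, (h1 x').fderiv, dist_eq_norm, ← ContinuousLinearMap.sub_comp]
  refine (ContinuousLinearMap.opNorm_comp_le _ _).trans
    ((mul_le_of_le_one_right (norm_nonneg _) hP).trans ?_)
  rw [← dist_eq_norm]
  refine (hM.dist_le_mul _ _).trans ?_
  gcongr
  rw [dist_eq_norm, dist_eq_norm, add_sub_add_right_eq_sub, ← map_sub]
  exact (P.le_opNorm _).trans (mul_le_of_le_one_left (norm_nonneg _) hP)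

end Projection

section Uniform

variable {d : ℕ} {Ω : Set (Euc d)}

lemma IsLocallyBelowGraph.mono {x₀ : Euc d} {R R' : ℝ} {M M' : ℝ≥0}
    (h : IsLocallyBelowGraph Ω x₀ R M) (hR : R' ≤ R) (hM : M ≤ M') :
    IsLocallyBelowGraph Ω x₀ R' M' := by
  obtain ⟨e, f, h1, h2, h3, h4, h5, h6⟩ := h
  exact ⟨e, f, h1, h2, h3, h4.weaken hM, h5.trans (by exact_mod_cast hM),
    fun x hx => h6 x (ball_subset_ball hR hx)⟩

/-- The graph representation at `x₁` serves all points near `x₁`. The graph function is composed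
with the orthogonal projection, so that it does not depend on the height of its argument. -/
lemma IsC11Domain.exists_ball_isLocallyBelowGraph (hΩ : IsC11Domain Ω) {x₁ : Euc d}
    (hx₁ : x₁ ∈ frontier Ω) : ∃ R > 0, ∃ M : ℝ≥0, ∀ x₀ ∈ ball x₁ R,
      IsLocallyBelowGraph Ω x₀ R M := by
  obtain ⟨e, φ, ρ, M, he, hρ, hφ, hM, hiff⟩ := hΩ.graph x₁ hx₁
  have hφd : Differentiable ℝ φ := hφ.differentiable one_ne_zero
  obtain ⟨h1, h2⟩ := lipschitzWith_fderiv_comp hφd hM (norm_projAlong_le he) (-projAlong e x₁)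
  set f₀ : Euc d → ℝ := fun x => φ (projAlong e x + -projAlong e x₁) with hf₀
  set f : Euc d → ℝ := fun x => inner ℝ e x₁ + f₀ x with hf
  have hfd : ∀ x, fderiv ℝ f x = fderiv ℝ f₀ x := fun x => fderiv_const_add _
  have hfd' : fderiv ℝ f = fderiv ℝ f₀ := funext hfd
  refine ⟨ρ / 2, by linarith, M + ‖fderiv ℝ f x₁‖₊ + M * Real.toNNReal ρ, fun x₀ hx₀ =>
    ⟨e, f, he, fun x t => ?_, ?_, ?_, ?_, fun x hx => ?_⟩⟩
  · simp only [hf, hf₀, map_add, map_smul, projAlong_self he, smul_zero, add_zero]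
  · exact fun x => (h1 x).differentiableAt.const_add _
  · rw [hfd']
    exact h2.weaken (by rw [add_assoc]; exact le_self_add)
  · have h3 := h2.dist_le_mul x₀ x₁
    rw [← hfd', dist_eq_norm] at h3
    have h4 := norm_sub_norm_le (fderiv ℝ f x₀) (fderiv ℝ f x₁)
    have h5 : (M : ℝ) * dist x₀ x₁ ≤ M * ρ := by
      gcongr
      linarith [mem_ball.1 hx₀]
    push_cast
    rw [Real.coe_toNNReal _ hρ.le]
    linarith [M.2]
  · have hx' : x ∈ ball x₁ ρ := by
      have := dist_triangle x x₀ x₁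
      rw [mem_ball] at *
      linarith
    rw [hiff x hx']
    have e1 : projAlong e x + -projAlong e x₁ = (x - x₁) - (inner ℝ (x - x₁) e) • e := by
      rw [← sub_eq_add_neg, ← map_sub, projAlong_apply, real_inner_comm]
    simp only [hf, hf₀]
    rw [e1, inner_sub_left, real_inner_comm e x, real_inner_comm e x₁, sub_lt_iff_lt_add']

/-- By compactness of the boundary, the graph representations have uniform constants. -/
lemma IsC11Domain.exists_uniform (hΩ : IsC11Domain Ω) (hc : IsCompact (frontier Ω)) :
    ∃ R > 0, ∃ M : ℝ≥0, ∀ x₀ ∈ frontier Ω, IsLocallyBelowGraph Ω x₀ R M := by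
  refine hc.induction_on (p := fun s => ∃ R > 0, ∃ M : ℝ≥0, ∀ x₀ ∈ s, IsLocallyBelowGraph Ω x₀ R M)
    ⟨1, one_pos, 0, by simp⟩ ?_ ?_ ?_
  · rintro s t hst ⟨R, hR, M, h⟩
    exact ⟨R, hR, M, fun x hx => h x (hst hx)⟩
  · rintro s t ⟨R, hR, M, h⟩ ⟨R', hR', M', h'⟩
    refine ⟨min R R', lt_min hR hR', max M M', fun x hx => ?_⟩
    rcases hx with hx | hx
    · exact (h x hx).mono (min_le_left _ _) (le_max_left _ _)
    · exact (h' x hx).mono (min_le_right _ _) (le_max_right _ _)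
  · intro x hx
    obtain ⟨R, hR, M, h⟩ := hΩ.exists_ball_isLocallyBelowGraph hx
    exact ⟨ball x R, mem_nhdsWithin_of_mem_nhds (ball_mem_nhds x hR), R, hR, M, h⟩

end Uniform

/-! ### Cylinders -/

section Cylinder

variable {n : ℕ}

/-- The projection of `ℝ^{n+1}` to the first `n` coordinates. -/
noncomputable def dropLast (n : ℕ) : Euc (n + 1) →L[ℝ] Euc n :=
  LinearMap.toContinuousLinearMap
    { toFun := fun x => WithLp.toLp 2 fun i : Fin n => x i.castSucc
      map_add' := fun _ _ => rfl
      map_smul' := fun _ _ => rfl }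

/-- The embedding of `ℝ^n` in `ℝ^{n+1}` with last coordinate zero. -/
noncomputable def appendZero {n : ℕ} (y : Euc n) : Euc (n + 1) :=
  WithLp.toLp 2 (Fin.snoc (α := fun _ => ℝ) y.ofLp 0)

lemma dropLast_apply (x : Euc (n + 1)) (i : Fin n) : dropLast n x i = x i.castSucc := rfl

lemma mem_solidCylinder {Ω₀ : Set (Euc n)} {x : Euc (n + 1)} :
    x ∈ solidCylinder Ω₀ ↔ dropLast n x ∈ Ω₀ := Iff.rfl

lemma norm_sq_eq_dropLast (x : Euc (n + 1)) :
    ‖x‖ ^ 2 = ‖dropLast n x‖ ^ 2 + x (Fin.last n) ^ 2 := by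
  rw [EuclideanSpace.real_norm_sq_eq, EuclideanSpace.real_norm_sq_eq, Fin.sum_univ_castSucc]
  rfl

lemma norm_dropLast_le : ‖dropLast n‖ ≤ 1 := by
  refine ContinuousLinearMap.opNorm_le_bound _ zero_le_one fun x => ?_
  rw [one_mul, ← sq_le_sq₀ (norm_nonneg _) (norm_nonneg _), norm_sq_eq_dropLast x]
  linarith [sq_nonneg (x (Fin.last n))]

lemma dropLast_appendZero (y : Euc n) : dropLast n (appendZero y) = y := by
  ext i
  simp [dropLast_apply, appendZero]

lemma inner_appendZero (y : Euc n) (x : Euc (n + 1)) :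
    inner ℝ (appendZero y) x = (inner ℝ y (dropLast n x) : ℝ) := by
  rw [PiLp.inner_apply, PiLp.inner_apply, Fin.sum_univ_castSucc]
  simp [appendZero, dropLast_apply]

lemma norm_appendZero (y : Euc n) : ‖appendZero y‖ = ‖y‖ := by
  rw [← sq_eq_sq₀ (norm_nonneg _) (norm_nonneg _), norm_sq_eq_dropLast, dropLast_appendZero]
  simp [appendZero]

lemma isOpenMap_dropLast : IsOpenMap (dropLast n) :=
  (dropLast n).isOpenMap fun y => ⟨appendZero y, dropLast_appendZero y⟩

lemma frontier_solidCylinder (Ω₀ : Set (Euc n)) :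
    frontier (solidCylinder Ω₀) = dropLast n ⁻¹' frontier Ω₀ :=
  (isOpenMap_dropLast.preimage_frontier_eq_frontier_preimage (dropLast n).continuous Ω₀).symm

lemma isOpen_solidCylinder {Ω₀ : Set (Euc n)} (h : IsOpen Ω₀) : IsOpen (solidCylinder Ω₀) :=
  h.preimage (dropLast n).continuous

lemma IsLocallyBelowGraph.solidCylinder {Ω₀ : Set (Euc n)} {x₀ : Euc (n + 1)} {R : ℝ} {M : ℝ≥0}
    (h : IsLocallyBelowGraph Ω₀ (dropLast n x₀) R M) :
    IsLocallyBelowGraph (solidCylinder Ω₀) x₀ R M := by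
  obtain ⟨e, f, h1, h2, h3, h4, h5, h6⟩ := h
  obtain ⟨hd, hl⟩ := lipschitzWith_fderiv_comp h3 h4 (norm_dropLast_le (n := n)) 0
  simp only [add_zero] at hd hl
  refine ⟨appendZero e, fun x => f (dropLast n x), by rw [norm_appendZero, h1], fun x t => ?_,
    fun x => (hd x).differentiableAt, hl, ?_, fun x hx => ?_⟩
  · beta_reduce
    rw [map_add, map_smul, dropLast_appendZero, h2]
  · rw [(hd x₀).fderiv]
    exact (ContinuousLinearMap.opNorm_comp_le _ _).trans
      ((mul_le_of_le_one_right (norm_nonneg _) norm_dropLast_le).trans h5)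
  · rw [mem_solidCylinder, h6, inner_appendZero]
    rw [mem_ball, dist_eq_norm, ← map_sub]
    refine lt_of_le_of_lt ?_ (mem_ball.1 hx)
    rw [dist_eq_norm]
    exact ((dropLast n).le_opNorm _).trans (mul_le_of_le_one_left (norm_nonneg _) norm_dropLast_le)

lemma isCompact_frontier_solidCylinder_inter {Ω₀ : Set (Euc n)} (hb : Bornology.IsBounded Ω₀)
    (T : ℝ) : IsCompact {x ∈ frontier (solidCylinder Ω₀) | |x (Fin.last n)| ≤ T} := by
  obtain ⟨C, hC⟩ := (hb.closure.subset frontier_subset_closure).exists_norm_le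
  refine isCompact_of_isClosed_isBounded ?_ ?_
  · have h1 : Continuous fun x : Euc (n + 1) => |x (Fin.last n)| := by fun_prop
    exact isClosed_frontier.inter (isClosed_le h1 continuous_const)
  · refine (isBounded_iff_forall_norm_le.2 ⟨Real.sqrt (C ^ 2 + T ^ 2), fun x hx => ?_⟩)
    obtain ⟨hx1, hx2⟩ := hx
    rw [frontier_solidCylinder] at hx1
    refine Real.le_sqrt_of_sq_le ?_
    rw [norm_sq_eq_dropLast]
    have h2 := hC _ hx1
    have h3 : x (Fin.last n) ^ 2 ≤ T ^ 2 := by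
      rw [← sq_abs]; gcongr
    gcongr

end Cylinder

/-! ### Cutting off a graph -/

section Cutoff

variable {d : ℕ}

/-- A product of a factor `u` that vanishes outside a ball and of a factor `w` that is controlled
inside the ball only is Lipschitz on the whole space. -/
lemma norm_bilinear_sub_le {V W Z : Type*} [NormedAddCommGroup V] [NormedSpace ℝ V]
    [NormedAddCommGroup W] [NormedSpace ℝ W] [NormedAddCommGroup Z] [NormedSpace ℝ Z]
    {B : V →L[ℝ] W →L[ℝ] Z} (hB : ‖B‖ ≤ 1) {u : Euc d → V} {w : Euc d → W} {s U A C D : ℝ}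
    (hu0 : ∀ x, s < ‖x‖ → u x = 0) (hu : ∀ x, ‖u x‖ ≤ U) (huA : ∀ x y, ‖u x - u y‖ ≤ A * ‖x - y‖)
    (hw : ∀ x, ‖x‖ ≤ s → ‖w x‖ ≤ C)
    (hwD : ∀ x y, ‖x‖ ≤ s → ‖y‖ ≤ s → ‖w x - w y‖ ≤ D * ‖x - y‖) (hA : 0 ≤ A) (hC : 0 ≤ C)
    (hD : 0 ≤ D) (x y : Euc d) :
    ‖B (u x) (w x) - B (u y) (w y)‖ ≤ (A * C + U * D) * ‖x - y‖ := by
  have hU : 0 ≤ U := (norm_nonneg _).trans (hu 0)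
  have hBle : ∀ v z, ‖B v z‖ ≤ ‖v‖ * ‖z‖ := fun v z => by
    refine (B.le_opNorm₂ v z).trans ?_
    rw [mul_assoc]
    exact mul_le_of_le_one_left (by positivity) hB
  have hone : ∀ x y, ‖x‖ ≤ s → s < ‖y‖ →
      ‖B (u x) (w x) - B (u y) (w y)‖ ≤ (A * C + U * D) * ‖x - y‖ := by
    intro x y hx hy
    rw [hu0 y hy, map_zero, zero_apply, sub_zero]
    have h1 := huA x y
    rw [hu0 y hy, sub_zero] at h1
    calc _ ≤ ‖u x‖ * ‖w x‖ := hBle _ _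
      _ ≤ A * ‖x - y‖ * C := by gcongr; exact hw x hx
      _ ≤ _ := by nlinarith [mul_nonneg (mul_nonneg hU hD) (norm_nonneg (x - y))]
  rcases le_or_gt ‖x‖ s with hx | hx <;> rcases le_or_gt ‖y‖ s with hy | hy
  · have h1 : B (u x) (w x) - B (u y) (w y) = B (u x - u y) (w x) + B (u y) (w x - w y) := by
      simp only [map_sub, sub_apply]; abel
    rw [h1]
    calc _ ≤ ‖u x - u y‖ * ‖w x‖ + ‖u y‖ * ‖w x - w y‖ :=
          (norm_add_le _ _).trans (add_le_add (hBle _ _) (hBle _ _))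
      _ ≤ A * ‖x - y‖ * C + U * (D * ‖x - y‖) := by
          gcongr
          exacts [huA x y, hw x hx, hu y, hwD x y hx hy]
      _ = _ := by ring
  · exact hone x y hx hy
  · rw [norm_sub_rev, norm_sub_rev x]; exact hone y x hy hx
  · rw [hu0 x hx, hu0 y hy]; simp; positivity

/-- There are cutoff functions at every scale whose derivatives scale as expected. -/
lemma exists_cutoff (d : ℕ) : ∃ C : ℝ, 0 < C ∧ ∀ δ : ℝ, 0 < δ → ∃ χ : Euc d → ℝ,
    Differentiable ℝ χ ∧ (∀ x, ‖x‖ ≤ δ → χ x = 1) ∧ (∀ x, |χ x| ≤ 1) ∧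
    (∀ x, 2 * δ < ‖x‖ → χ x = 0) ∧ (∀ x, 2 * δ < ‖x‖ → fderiv ℝ χ x = 0) ∧
    (∀ x, ‖fderiv ℝ χ x‖ ≤ C / δ) ∧
    ∀ x y, ‖fderiv ℝ χ x - fderiv ℝ χ y‖ ≤ C / δ ^ 2 * ‖x - y‖ := by
  let β : ContDiffBump (0 : Euc d) := ⟨1, 2, one_pos, one_lt_two⟩
  have hβ : ContDiff ℝ 2 β := β.contDiff
  have hβ' : ContDiff ℝ 1 (fderiv ℝ β) := hβ.fderiv_right (by norm_num)
  have hβc : HasCompactSupport (fderiv ℝ β) := β.hasCompactSupport.fderiv (𝕜 := ℝ)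
  obtain ⟨C₁, hC₁⟩ := hβc.exists_bound_of_continuous hβ'.continuous
  obtain ⟨C₂, hC₂⟩ := hβ'.lipschitzWith_of_hasCompactSupport hβc one_ne_zero
  refine ⟨max 1 (max C₁ C₂), by positivity, fun δ hδ => ⟨fun x => β (δ⁻¹ • x), ?_⟩⟩
  have hd : ∀ x, HasFDerivAt (fun x => β (δ⁻¹ • x)) (δ⁻¹ • fderiv ℝ β (δ⁻¹ • x)) x := by
    intro x
    have h1 := ((hβ.differentiable two_ne_zero) (δ⁻¹ • x)).hasFDerivAt.comp x
      ((hasFDerivAt_id x).const_smul δ⁻¹)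
    refine h1.congr_fderiv ?_
    ext v
    simp
  have hn : ∀ x : Euc d, ‖δ⁻¹ • x‖ = ‖x‖ / δ := fun x => by
    rw [norm_smul, norm_inv, Real.norm_eq_abs, abs_of_pos hδ, inv_mul_eq_div]
  have hns : ∀ x : Euc d, 2 * δ < ‖x‖ → δ⁻¹ • x ∉ tsupport β := by
    intro x hx
    rw [β.tsupport_eq, mem_closedBall_zero_iff, hn, not_le]
    exact (lt_div_iff₀ hδ).2 hx
  refine ⟨fun x => (hd x).differentiableAt, fun x hx => ?_, fun x => ?_, fun x hx => ?_,
    fun x hx => ?_, fun x => ?_, fun x y => ?_⟩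
  · refine β.one_of_mem_closedBall ?_
    rw [mem_closedBall_zero_iff, hn]
    exact (div_le_one hδ).2 hx
  · rw [abs_of_nonneg β.nonneg]; exact β.le_one
  · exact image_eq_zero_of_notMem_tsupport (hns x hx)
  · rw [(hd x).fderiv, image_eq_zero_of_notMem_tsupport
      (fun h => hns x hx (tsupport_fderiv_subset ℝ h)), smul_zero]
  · rw [(hd x).fderiv, norm_smul, norm_inv, Real.norm_eq_abs, abs_of_pos hδ, inv_mul_eq_div]
    gcongr
    exact (hC₁ _).trans ((le_max_left _ _).trans (le_max_right _ _))
  · rw [(hd x).fderiv, (hd y).fderiv, ← smul_sub, norm_smul, norm_inv, Real.norm_eq_abs,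
      abs_of_pos hδ, ← dist_eq_norm]
    have h1 := hC₂.dist_le_mul (δ⁻¹ • x) (δ⁻¹ • y)
    rw [dist_eq_norm (δ⁻¹ • x), ← smul_sub, hn] at h1
    calc _ ≤ δ⁻¹ * (C₂ * (‖x - y‖ / δ)) := by gcongr
      _ = C₂ / δ ^ 2 * ‖x - y‖ := by field_simp
      _ ≤ _ := by
        gcongr
        exact (le_max_right _ _).trans (le_max_right _ _)

/-- A `C^{1,1}` function agrees near a point with one whose derivative is everywhere close to its
value at that point and has a Lipschitz constant that depends only on the data. The remainder of
the first order expansion at the point is cut off at scale `δ`. -/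
lemma exists_isNearlyLinearGraph (d : ℕ) (M : ℝ≥0) {R η : ℝ} (hR : 0 < R) (hη : 0 < η) :
    ∃ (L : ℝ≥0) (δ : ℝ), 0 < δ ∧ δ ≤ R ∧ ∀ (e : Euc d) (f : Euc d → ℝ) (x₀ : Euc d), ‖e‖ = 1 →
      (∀ (x : Euc d) (t : ℝ), f (x + t • e) = f x) → Differentiable ℝ f →
      LipschitzWith M (fderiv ℝ f) → ∃ f₁ : Euc d → ℝ,
        IsNearlyLinearGraph e f₁ (fderiv ℝ f x₀) η L ∧ ∀ x ∈ ball x₀ δ, f₁ x = f x := by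
  obtain ⟨C, hC0, hC⟩ := exists_cutoff d
  -- The derivative of the cut off remainder is at most `M δ (2 + 4 C)`.
  set δ := min R (η / ((M + 1) * (2 + 4 * C))) with hδ
  have hδ0 : 0 < δ := lt_min hR (by positivity)
  have hδη : M * δ * (2 + 4 * C) ≤ η := by
    have h1 : δ ≤ η / ((M + 1) * (2 + 4 * C)) := min_le_right _ _
    rw [le_div_iff₀ (by positivity)] at h1
    have : 0 ≤ δ * (2 + 4 * C) := by positivity
    linarith
  obtain ⟨χ, hχd, hχ1, hχb, hχ0, hχ0', hχ', hχ''⟩ := hC δ hδ0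
  set L : ℝ≥0 := Real.toNNReal ((C / δ * (2 * M * δ) + 1 * M) +
    (C / δ ^ 2 * (4 * M * δ ^ 2) + C / δ * (2 * M * δ))) with hL
  refine ⟨L, δ, hδ0, min_le_left _ _, fun e f x₀ he hinv hf hM => ?_⟩
  set a := fderiv ℝ f x₀ with ha
  have hae : a e = 0 := fderiv_eq_zero_of_invariant hf hinv x₀
  set g : Euc d → ℝ := fun y => f (x₀ + y) - f x₀ - a y with hg
  have hgd : ∀ y, HasFDerivAt g (fderiv ℝ f (x₀ + y) - a) y := by
    intro y
    have h1 : HasFDerivAt (fun y => f (x₀ + y)) (fderiv ℝ f (x₀ + y)) y := by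
      have := (hf (x₀ + y)).hasFDerivAt.comp y ((hasFDerivAt_id y).const_add x₀)
      refine this.congr_fderiv ?_
      ext v
      simp
    exact (h1.sub_const _).sub a.hasFDerivAt
  have hg' : ∀ y, ‖fderiv ℝ f (x₀ + y) - a‖ ≤ M * ‖y‖ := by
    intro y
    have := hM.dist_le_mul (x₀ + y) x₀
    rwa [dist_eq_norm, dist_eq_norm, add_sub_cancel_left] at this
  have hglip : ∀ x y, ‖x‖ ≤ 2 * δ → ‖y‖ ≤ 2 * δ → ‖g x - g y‖ ≤ 2 * M * δ * ‖x - y‖ := by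
    intro x y hx hy
    refine (convex_closedBall (0 : Euc d) (2 * δ)).norm_image_sub_le_of_norm_hasFDerivWithin_le
      (fun z _ => (hgd z).hasFDerivWithinAt) (fun z hz => (hg' z).trans ?_)
      (mem_closedBall_zero_iff.2 hy) (mem_closedBall_zero_iff.2 hx)
    calc (M : ℝ) * ‖z‖ ≤ M * (2 * δ) := by gcongr; exact mem_closedBall_zero_iff.1 hz
      _ = 2 * M * δ := by ring
  have hgb : ∀ x, ‖x‖ ≤ 2 * δ → ‖g x‖ ≤ 4 * M * δ ^ 2 := by
    intro x hx
    have h1 := hglip x 0 hx (by simp; positivity)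
    have h2 : g 0 = 0 := by simp [hg]
    rw [h2, sub_zero, sub_zero] at h1
    calc _ ≤ 2 * M * δ * ‖x‖ := h1
      _ ≤ 2 * M * δ * (2 * δ) := by gcongr
      _ = _ := by ring
  set G' : Euc d → (Euc d →L[ℝ] ℝ) := fun y =>
    χ y • (fderiv ℝ f (x₀ + y) - a) + g y • fderiv ℝ χ y with hG'
  have hGd : ∀ y, HasFDerivAt (fun y => χ y * g y) (G' y) y := fun y =>
    (hχd y).hasFDerivAt.mul (hgd y)
  have hG'b : ∀ y, ‖G' y‖ ≤ η := by
    intro y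
    rcases le_or_gt ‖y‖ (2 * δ) with hy | hy
    · refine (norm_add_le _ _).trans (le_trans ?_ hδη)
      rw [norm_smul, norm_smul]
      have h1 : ‖χ y‖ * ‖fderiv ℝ f (x₀ + y) - a‖ ≤ 1 * (M * (2 * δ)) := by
        gcongr
        · exact hχb y
        · exact (hg' y).trans (by gcongr)
      have h2 : ‖g y‖ * ‖fderiv ℝ χ y‖ ≤ 4 * M * δ ^ 2 * (C / δ) := by
        gcongr
        · exact hgb y hy
        · exact hχ' y
      have h3 : 4 * M * δ ^ 2 * (C / δ) = M * δ * (4 * C) := by field_simp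
      linarith
    · simp only [hG', hχ0 y hy, hχ0' y hy, zero_smul, smul_zero, add_zero, norm_zero]
      exact hη.le
  have hχlip : ∀ x y, ‖χ x - χ y‖ ≤ C / δ * ‖x - y‖ := fun x y =>
    convex_univ.norm_image_sub_le_of_norm_fderiv_le (fun z _ => hχd z) (fun z _ => hχ' z)
      (mem_univ y) (mem_univ x)
  have hG'lip : ∀ x y, ‖G' x - G' y‖ ≤ L * ‖x - y‖ := by
    intro x y
    have h1 := norm_bilinear_sub_le (B := ContinuousLinearMap.lsmul ℝ ℝ (E := Euc d →L[ℝ] ℝ))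
      ContinuousLinearMap.opNorm_lsmul_le hχ0 hχb hχlip (C := 2 * M * δ) (D := M)
      (w := fun y => fderiv ℝ f (x₀ + y) - a)
      (fun z hz => (hg' z).trans (by nlinarith [M.2]))
      (fun z w _ _ => by
        have := hM.dist_le_mul (x₀ + z) (x₀ + w)
        rwa [dist_add_left, dist_eq_norm, dist_eq_norm, ← sub_sub_sub_cancel_right _ _ a] at this)
      (by positivity) (by positivity) M.2 x y
    have h2 := norm_bilinear_sub_le
      (B := (ContinuousLinearMap.lsmul ℝ ℝ (E := Euc d →L[ℝ] ℝ)).flip)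
      (by rw [ContinuousLinearMap.opNorm_flip]; exact ContinuousLinearMap.opNorm_lsmul_le)
      hχ0' hχ' hχ'' hgb hglip (by positivity) (by positivity) (by positivity) x y
    simp only [ContinuousLinearMap.flip_apply, ContinuousLinearMap.lsmul_apply] at h1 h2
    rw [hL, Real.coe_toNNReal _ (by positivity), add_mul]
    have h3 : G' x - G' y = (χ x • (fderiv ℝ f (x₀ + x) - a) - χ y • (fderiv ℝ f (x₀ + y) - a)) +
        (g x • fderiv ℝ χ x - g y • fderiv ℝ χ y) := by
      simp only [hG']; abel
    rw [h3]
    exact (norm_add_le _ _).trans (add_le_add h1 h2)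
  have hGfd : ∀ y, fderiv ℝ (fun y => χ y * g y) y = G' y := fun y => (hGd y).fderiv
  obtain ⟨hGP, hGPlip⟩ := lipschitzWith_fderiv_comp (φ := fun y => χ y * g y) (M := L)
    (fun y => (hGd y).differentiableAt)
    (LipschitzWith.of_dist_le_mul fun x y => by
      rw [hGfd, hGfd, dist_eq_norm, dist_eq_norm]; exact hG'lip x y)
    (norm_projAlong_le he) (-projAlong e x₀)
  -- The cut off remainder is composed with the projection, since the cutoff function is not
  -- invariant in the direction `e`.
  set H : Euc d → ℝ := fun x => χ (projAlong e x + -projAlong e x₀) *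
    g (projAlong e x + -projAlong e x₀) with hH
  have hfd : ∀ x, HasFDerivAt (fun x => (f x₀ + a (x - x₀)) + H x) (a + fderiv ℝ H x) x := by
    intro x
    refine HasFDerivAt.add ?_ (hGP x).differentiableAt.hasFDerivAt
    have := (a.hasFDerivAt.comp x ((hasFDerivAt_id x).sub_const x₀)).const_add (f x₀)
    simpa using this
  refine ⟨fun x => (f x₀ + a (x - x₀)) + H x, ⟨he, fun x t => ?_,
    fun x => (hfd x).differentiableAt, LipschitzWith.of_dist_le_mul fun x y => ?_, hae,
    fun x => ?_⟩, fun x hx => ?_⟩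
  · have h1 : x + t • e - x₀ = (x - x₀) + t • e := by abel
    simp only [hH, map_add, map_smul, projAlong_self he, smul_zero, add_zero, h1, hae]
  · rw [(hfd x).fderiv, (hfd y).fderiv, dist_add_left]
    exact hGPlip.dist_le_mul x y
  · rw [(hfd x).fderiv, add_sub_cancel_left, (hGP x).fderiv, hGfd]
    exact (ContinuousLinearMap.opNorm_comp_le _ _).trans
      ((mul_le_of_le_one_right (norm_nonneg _) (norm_projAlong_le he)).trans (hG'b _))
  · have h1 : projAlong e x + -projAlong e x₀ = projAlong e (x - x₀) := by
      rw [map_sub, sub_eq_add_neg]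
    have h2 : ‖projAlong e (x - x₀)‖ ≤ δ :=
      ((projAlong e).le_opNorm _).trans ((mul_le_of_le_one_left (norm_nonneg _)
        (norm_projAlong_le he)).trans (by rw [← dist_eq_norm]; exact (mem_ball.1 hx).le))
    have h3 : a (projAlong e (x - x₀)) = a (x - x₀) := by
      rw [projAlong_apply, map_sub, map_smul, hae, smul_zero, sub_zero]
    have h4 : f (x₀ + projAlong e (x - x₀)) = f x := by
      rw [projAlong_apply, show x₀ + (x - x₀ - inner ℝ e (x - x₀) • e) =
        x + (-inner ℝ e (x - x₀)) • e by module, hinv]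
    simp only [hH, h1, hχ1 _ h2, one_mul, hg, h3, h4]
    ring

end Cutoff

/-! ### The rule -/

/-- In the ball `B(x₀, r)` the set `U` lies below the graph of `f` in direction `e`, the constants
of the graph are at most `m`, and the graph is close enough to a linear one for the reflection
`graphReflection e f` to exist and to respect every other such description of `U`. -/
def IsGraphDescription {d : ℕ} (x₀ : Euc d) (r : ℝ) (U : Set (Euc d)) (m : ℕ) (e : Euc d)
    (f : Euc d → ℝ) : Prop :=
  ∃ (a : Euc d →L[ℝ] ℝ) (ε : ℝ), 1 + ‖a‖ ≤ m ∧ 4096 * d * (1 + ‖a‖) ^ 4 * ε ≤ 1 ∧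
    IsNearlyLinearGraph e f a ε m ∧ ∀ x ∈ ball x₀ r, x ∈ U ↔ heightAbove e f x < 0

open Classical in
/-- The matrix field attached to `(x₀, r, U)`: the coefficients of the reflection across some graph
that describes `U` in `B(x₀, r)`. Among all graphs one with the least constant `m` is chosen, so
that the bounds on the coefficients are those of the best description. -/
noncomputable def reflectionRule {d : ℕ} (x₀ : Euc d) (r : ℝ) (U : Set (Euc d)) : MatField d :=
  if H : ∃ (m : ℕ) (e : Euc d) (f : Euc d → ℝ), IsGraphDescription x₀ r U m e f then
    reflectedCoeff (heightAbove (Nat.find_spec H).choose (Nat.find_spec H).choose_spec.choose)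
      (graphReflection (Nat.find_spec H).choose (Nat.find_spec H).choose_spec.choose)
  else 1

section Rule

variable {d : ℕ} {x₀ : Euc d} {r : ℝ} {U Ω : Set (Euc d)} {m m' : ℕ} {e e' : Euc d}
  {f f' : Euc d → ℝ} {a a' : Euc d →L[ℝ] ℝ} {ε ε' : ℝ} {L L' : ℝ≥0}

lemma IsNearlyLinearGraph.weaken (h : IsNearlyLinearGraph e f a ε L) (hL : L ≤ L') :
    IsNearlyLinearGraph e f a ε L' :=
  { h with lipschitz_fderiv := h.lipschitz_fderiv.weaken hL }

lemma IsGraphDescription.mono (h : IsGraphDescription x₀ r U m e f) (hm : m ≤ m') :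
    IsGraphDescription x₀ r U m' e f := by
  obtain ⟨a, ε, h1, h2, h3, h4⟩ := h
  exact ⟨a, ε, h1.trans (by exact_mod_cast hm), h2, h3.weaken (by exact_mod_cast hm), h4⟩

lemma exists_reflectionRule_eq (h : IsGraphDescription x₀ r U m e f) :
    ∃ (e' : Euc d) (f' : Euc d → ℝ), IsGraphDescription x₀ r U m e' f' ∧
      reflectionRule x₀ r U = reflectedCoeff (heightAbove e' f') (graphReflection e' f') := by
  classical
  have H : ∃ (m : ℕ) (e : Euc d) (f : Euc d → ℝ), IsGraphDescription x₀ r U m e f := ⟨m, e, f, h⟩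
  refine ⟨_, _, (Nat.find_spec H).choose_spec.choose_spec.mono (Nat.find_min' H ⟨e, f, h⟩), ?_⟩
  rw [reflectionRule, dif_pos H]

lemma IsNearlyLinearGraph.lipschitzWith_heightAbove (h : IsNearlyLinearGraph e f a ε L) :
    LipschitzWith (Real.toNNReal (1 + ‖a‖ + ε)) (heightAbove e f) := by
  refine LipschitzWith.of_dist_le_mul fun x y => ?_
  have h1 := h.abs_heightAbove_sub_le x y
  have h2 := (innerSL ℝ e - a).le_of_opNorm_le (h.norm_innerSL_sub_le le_rfl) (x - y)
  rw [sub_apply, innerSL_apply_apply, Real.norm_eq_abs] at h2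
  rw [Real.coe_toNNReal _ (by linarith [h.eps_nonneg, norm_nonneg a]), Real.dist_eq, dist_eq_norm]
  have h3 := abs_add_le (heightAbove e f x - heightAbove e f y - (inner ℝ e (x - y) - a (x - y)))
    (inner ℝ e (x - y) - a (x - y))
  rw [sub_add_cancel] at h3
  linarith

lemma IsNearlyLinearGraph.isSmoothReflection (h : IsNearlyLinearGraph e f a ε m)
    (hm : 1 + ‖a‖ ≤ m) (hε : 4096 * d * (1 + ‖a‖) ^ 4 * ε ≤ 1) :
    IsSmoothReflection (heightAbove e f) (graphReflection e f) (4 * m)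
      ((4 + 16 * m) * ((1 + 5 * d) * m)) := by
  have hε' := h.eight_mul_le le_rfl hε
  refine ⟨h.continuous_heightAbove, h.graphReflection_involutive le_rfl hε', ?_, fun x =>
    (h.hasFDerivAt_graphReflection le_rfl hε' x).differentiableAt, ?_,
    fun x => h.graphReflection_eq_self le_rfl hε',
    fun x => h.norm_fderiv_graphReflection_apply le_rfl hε'⟩
  · refine LipschitzWith.of_dist_le_mul fun x y =>
      (h.dist_graphReflection_le le_rfl hε' x y).trans ?_
    push_cast
    gcongr
  · refine LipschitzWith.of_dist_le_mul fun x y => ?_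
    rw [dist_eq_norm, dist_eq_norm]
    refine (h.norm_fderiv_graphReflection_sub_le le_rfl hε' x y).trans ?_
    push_cast
    gcongr

/-- The reflection across one graph maps the ball to the correct side of `Ω`, although points may
leave the ball: a second graph, which describes `Ω` in a larger ball and is much closer to a linear
one, decides on which side of `Ω` the image lies. -/
lemma IsNearlyLinearGraph.isReflectedInBall (h : IsNearlyLinearGraph e f a ε m)
    (hm : 1 + ‖a‖ ≤ m) (hε : 4096 * d * (1 + ‖a‖) ^ 4 * ε ≤ 1)
    (h' : IsNearlyLinearGraph e' f' a' ε' L') (hε' : 4096 * d * (m : ℝ) ^ 4 * ε' ≤ 1)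
    (hΩ : IsOpen Ω) (hr : 0 < r) (hx₀ : x₀ ∈ frontier Ω) {δ : ℝ} (hδ : (4 * m + 1) * r ≤ δ)
    (hiff : ∀ x ∈ ball x₀ r, x ∈ Ω ↔ heightAbove e f x < 0)
    (hiff' : ∀ x ∈ ball x₀ δ, x ∈ Ω ↔ heightAbove e' f' x < 0) :
    ∃ c, IsReflectedInBall Ω x₀ r (heightAbove e f) (graphReflection e f) e c := by
  have hrδ : r ≤ δ := by
    have : 0 ≤ 4 * m * r := by positivity
    linarith
  have hε8 := h.eight_mul_le le_rfl hε
  have hε'' : 4096 * d * (1 + ‖a‖) ^ 4 * ε' ≤ 1 := by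
    have := h'.eps_nonneg
    refine le_trans ?_ hε'
    gcongr
  have hcl : ∀ x ∈ ball x₀ r, x ∈ closure Ω ↔ heightAbove e f x ≤ 0 := by
    intro x hx
    refine ⟨fun hxc => ?_, fun hx0 => ?_⟩
    · by_contra! hpos
      obtain ⟨y, ⟨hy, hyb⟩, hyΩ⟩ := mem_closure_iff.1 hxc ({y | 0 < heightAbove e f y} ∩ ball x₀ r)
        ((isOpen_lt continuous_const h.continuous_heightAbove).inter isOpen_ball) ⟨hpos, hx⟩
      exact lt_asymm hy ((hiff y hyb).1 hyΩ)
    · exact h.mem_closure_of_forall_lower hx (· ∈ Ω)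
        fun y hy hlt => (hiff y hy).2 (hlt.trans_le hx0)
  have hx₀b : x₀ ∈ ball x₀ r := mem_ball_self hr
  have hx₀0 : heightAbove e f x₀ = 0 := by
    refine le_antisymm ((hcl x₀ hx₀b).1 hx₀.1) (not_lt.1 fun hlt => ?_)
    rw [hΩ.frontier_eq] at hx₀
    exact hx₀.2 ((hiff x₀ hx₀b).2 hlt)
  have hsign : ∀ y ∈ ball x₀ r, heightAbove e f y < 0 ↔ heightAbove e' f' y < 0 := fun y hy =>
    (hiff y hy).symm.trans (hiff' y (ball_subset_ball hrδ hy))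
  have hmem : ∀ x ∈ ball x₀ r, graphReflection e f x ∈ ball x₀ δ := by
    intro x hx
    have h1 := h.dist_graphReflection_le le_rfl hε8 x x₀
    rw [h.graphReflection_eq_self le_rfl hε8 hx₀0] at h1
    have h2 : 4 * (1 + ‖a‖) * dist x x₀ ≤ 4 * m * r := by
      gcongr
      exact (mem_ball.1 hx).le
    rw [mem_ball]
    linarith
  refine ⟨_, hΩ, hiff, hcl, fun x hx hpos => ?_, fun x hx hnonpos => ?_, h.heightAbove_add_smul,
    h.lipschitzWith_heightAbove⟩
  · exact (hiff' _ (hmem x hx)).2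
      ((h.heightAbove_graphReflection_of_sign h' le_rfl hε hε'' hsign hx₀0 hx).1 hpos)
  · rcases hnonpos.lt_or_eq with hneg | hzero
    · rw [hiff' _ (hmem x hx)]
      exact lt_asymm
        ((h.heightAbove_graphReflection_of_sign h' le_rfl hε hε'' hsign hx₀0 hx).2 hneg)
    · rw [h.graphReflection_eq_self le_rfl hε8 hzero, hiff x hx, hzero]
      exact lt_irrefl 0

/-- A set that has uniform graph representations near its boundary admits reflections in all small
balls centered at the boundary. -/
theorem exists_reflectsUpTo (hd : 0 < d) (hΩ : IsOpen Ω) {R : ℝ} {M : ℝ≥0} (hR : 0 < R)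
    (hloc : ∀ x₀ ∈ frontier Ω, IsLocallyBelowGraph Ω x₀ R M) :
    ∃ r₀ : ℝ, 0 < r₀ ∧ ReflectsUpTo reflectionRule Ω r₀ := by
  have hd' : (0 : ℝ) < d := by exact_mod_cast hd
  have hη : ∀ Q : ℝ, 0 < Q → 0 < 1 / (4096 * d * Q ^ 4) := fun Q hQ => by positivity
  obtain ⟨L₁, δ₁, hδ₁, hδ₁R, hg₁⟩ := exists_isNearlyLinearGraph d M hR (hη (1 + M) (by positivity))
  -- The bound `m` controls all descriptions that the rule may choose. The second family of graphs
  -- is as close to linear ones as a description with constant `m` demands.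
  obtain ⟨m, hm⟩ := exists_nat_ge (max (1 + (M : ℝ)) L₁)
  have hmM : 1 + (M : ℝ) ≤ m := (le_max_left _ _).trans hm
  have hmL : (L₁ : ℝ) ≤ m := (le_max_right _ _).trans hm
  have hm1 : (1 : ℝ) ≤ m := le_trans (by simp) hmM
  obtain ⟨L₂, δ₂, hδ₂, hδ₂R, hg₂⟩ := exists_isNearlyLinearGraph d M hR (hη m (by linarith))
  have hK : (1 : ℝ≥0) ≤ 4 * m := by
    have : (1 : ℝ≥0) ≤ m := by exact_mod_cast hm1
    exact this.trans (le_mul_of_one_le_left zero_le (by norm_num))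
  obtain ⟨lam, Lam, L, hlam, hell⟩ := exists_isEllipticLipschitz_reflectedCoeff d (4 * m)
    ((4 + 16 * m) * ((1 + 5 * d) * m)) hK
  refine ⟨min δ₁ (δ₂ / (4 * m + 1)), by positivity, lam, Lam, L, 4 * m, hlam,
    fun x₀ hx₀ r hr hr₀ => ?_⟩
  obtain ⟨e, f, he, hinv, hf, hfM, hfx₀, hiff⟩ := hloc x₀ hx₀
  obtain ⟨f₁, hf₁, hf₁eq⟩ := hg₁ e f x₀ he hinv hf hfM
  obtain ⟨f₂, hf₂, hf₂eq⟩ := hg₂ e f x₀ he hinv hf hfM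
  have hrδ₁ : r ≤ δ₁ := hr₀.trans (min_le_left _ _)
  have hrδ₂ : (4 * m + 1) * r ≤ δ₂ := by
    have := hr₀.trans (min_le_right _ _)
    rwa [le_div_iff₀' (by positivity)] at this
  have hdesc : IsGraphDescription x₀ r (Ω ∩ ball x₀ r) m e f₁ := by
    refine ⟨fderiv ℝ f x₀, _, by linarith, ?_, hf₁.weaken (by exact_mod_cast hmL), fun x hx => ?_⟩
    · rw [mul_one_div, div_le_one (by positivity)]
      gcongr
    · rw [heightAbove, hf₁eq x (ball_subset_ball hrδ₁ hx), sub_neg, ← hiff x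
        (ball_subset_ball (hrδ₁.trans hδ₁R) hx)]
      exact and_iff_left hx
  obtain ⟨e', f', ⟨a, ε, hma, hε, hgraph, hiff'⟩, hrule⟩ := exists_reflectionRule_eq hdesc
  rw [hrule]
  have hiffΩ : ∀ x ∈ ball x₀ r, x ∈ Ω ↔ heightAbove e' f' x < 0 := fun x hx =>
    (and_iff_left hx).symm.trans (hiff' x hx)
  have hs := hgraph.isSmoothReflection hma hε
  obtain ⟨c, hb⟩ := hgraph.isReflectedInBall hma hε hf₂
    (mul_one_div_cancel (by positivity)).le hΩ hr hx₀ hrδ₂ hiffΩ fun x hx => by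
      rw [heightAbove, hf₂eq x hx, sub_neg, hiff x (ball_subset_ball hδ₂R hx)]
  exact ⟨hell _ _ hs _, fun x hx => if_pos ((hiffΩ x hx.1).1 hx.2), _,
    hb.isReflectionMap hs hK, fun h hh => hb.isWeakSolution hs hh⟩

lemma exists_finset_cover_ball {s t : Set (Euc d)} (ht : IsCompact t) (hts : t ⊆ s) (hr : 0 < r) :
    ∃ u : Finset (Euc d), (u : Set (Euc d)) ⊆ s ∧ t ⊆ ⋃ x ∈ u, ball x r := by
  obtain ⟨u, hu, hcov⟩ := ht.elim_nhds_subcover (fun x => ball x r) fun x _ => ball_mem_nhds x hr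
  exact ⟨u, fun x hx => hts (hu x hx), hcov⟩

end Rule

theorem lemma2p1 (n : ℕ) :
    ∃ 𝓑 : Euc (n + 1) → ℝ → Set (Euc (n + 1)) → MatField (n + 1),
      (∀ Ω : Set (Euc (n + 1)), IsC11Domain Ω → Bornology.IsBounded Ω →
        ∃ r₀ : ℝ, 0 < r₀ ∧
          (∃ t : Finset (Euc (n + 1)), (t : Set (Euc (n + 1))) ⊆ frontier Ω ∧
            frontier Ω ⊆ ⋃ x ∈ t, ball x r₀) ∧
          ReflectsUpTo 𝓑 Ω r₀) ∧
      (∀ Ω₀ : Set (Euc n), IsC11Domain Ω₀ → Bornology.IsBounded Ω₀ →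
        ∃ r₀ : ℝ, 0 < r₀ ∧
          (∀ T : ℝ, ∃ t : Finset (Euc (n + 1)),
            (t : Set (Euc (n + 1))) ⊆ frontier (solidCylinder Ω₀) ∧
            {x ∈ frontier (solidCylinder Ω₀) | |x (Fin.last n)| ≤ T} ⊆ ⋃ x ∈ t, ball x r₀) ∧
          ReflectsUpTo 𝓑 (solidCylinder Ω₀) r₀) := by
  have hcomp : ∀ {d : ℕ} {Ω : Set (Euc d)}, Bornology.IsBounded Ω → IsCompact (frontier Ω) :=
    fun hb => isCompact_of_isClosed_isBounded isClosed_frontier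
      (hb.closure.subset frontier_subset_closure)
  refine ⟨reflectionRule, fun Ω hΩ hb => ?_, fun Ω₀ hΩ hb => ?_⟩
  · obtain ⟨R, hR, M, hloc⟩ := hΩ.exists_uniform (hcomp hb)
    obtain ⟨r₀, hr₀, hrefl⟩ := exists_reflectsUpTo n.succ_pos hΩ.isOpen hR hloc
    exact ⟨r₀, hr₀, exists_finset_cover_ball (hcomp hb) Subset.rfl hr₀, hrefl⟩
  · obtain ⟨R, hR, M, hloc⟩ := hΩ.exists_uniform (hcomp hb)
    obtain ⟨r₀, hr₀, hrefl⟩ := exists_reflectsUpTo n.succ_pos (isOpen_solidCylinder hΩ.isOpen) hR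
      fun x₀ hx₀ => (hloc (dropLast n x₀) (by rwa [frontier_solidCylinder] at hx₀)).solidCylinder
    exact ⟨r₀, hr₀, fun T => exists_finset_cover_ball
      (isCompact_frontier_solidCylinder_inter hb T) (sep_subset _ _) hr₀, hrefl⟩
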